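/- Let $m, n, N$ be positive integers with $2 \le m < n/2$ and $N < \binom{n}{m}$, and put $p = N/\binom{n}{m}$. Let $X_1, \dots, X_n$ be independent identically distributed random variables with values in a measurable space $M$, and let $h : M^m \to \mathbb{R}$ be a measurable symmetric kernel with $\mathbb{E}[h(X_1,\dots,X_m)] = 0$ and $0 < \sigma_h^2 := \operatorname{var}[h(X_1,\dots,X_m)] < \infty$. Let $g(x) := \mathbb{E}[h(x, X_2, \dots, X_m)]$ and suppose that $h$ is non-degenerate: $\sigma_g^2 := \operatorname{var}[g(X_1)] > 0$. Let $I_{n,m}$ be the set of tuples $\mathbf{i} = (i_1, \dots, i_m)$ with $1 \le i_1 < \dots < i_m \le n$, let $(Z_{\mathbf{i}})_{\mathbf{i} \in I_{n,m}}$ be independent Bernoulli random variables with success probability $p$ that are independent of $(X_1, \dots, X_n)$, and let $$U'_{n,N} := \frac{1}{\hat N} \sum_{\mathbf{i} \in I_{n,m}} Z_{\mathbf{i}}\, h(X_{i_1}, \dots, X_{i_m}), \qquad \hat N := \sum_{\mathbf{i} \in I_{n,m}} Z_{\mathbf{i}},$$ with $U'_{n,N} := 0$ when $\hat N = 0$.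 Then $$\sup_{z \in \mathbb{R}} \left| P\left( \frac{\sqrt{n}\, U'_{n,N}}{m \sigma_g} \le z \right) - \Phi(z) \right| \le C \left\{ \frac{\mathbb{E}[|g(X_1)|^3]}{\sqrt{n}\, \sigma_g^3} + \left( \frac{m}{n} \left( \frac{\sigma_h^2}{m \sigma_g^2} - 1 \right) \right)^{1/2} + \left( \frac{n (1-p) \sigma_h^2}{N m \sigma_g^2} \right)^{1/2} + \frac{1}{\sqrt{N}} \right\},$$ where $\Phi$ is the standard normal distribution function and $C > 0$ is an absolute constant, i.e. it depends neither on $m, n, N$ nor on $h$, on $M$ or on the distribution of the data. (The right-hand side is $\infty$ if $\mathbb{E}[|g(X_1)|^3] = \infty$.) -/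

import Mathlib

open MeasureTheory ProbabilityTheory
open scoped ENNReal

namespace IncompleteUStat

/-- The index set of all strictly increasing `m`-tuples `i_1 < ... < i_m` in `{1, ..., n}`. -/
abbrev Idx (m n : ℕ) : Type := Fin m ↪o Fin n

noncomputable instance (m n : ℕ) : Fintype (Idx m n) := Fintype.ofFinite _

/-- A kernel is symmetric if it is invariant under permutations of its arguments. -/
def IsSymmetricKernel {M : Type*} {m : ℕ} (h : (Fin m → M) → ℝ) : Prop :=
  ∀ (π : Equiv.Perm (Fin m)) (x : Fin m → M), h (fun j => x (π j)) = h x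

/-- The first projection `g(x) = E[h(x, X_2, ..., X_m)]` of a kernel `h`, where `X_2, ..., X_m` are
independent with law `μ`. The integral is over the coordinates other than the first one. -/
noncomputable def firstProj {M : Type*} [MeasurableSpace M] {m : ℕ} (h : (Fin m → M) → ℝ)
    (μ : Measure M) (x : M) : ℝ :=
  ∫ y : {j : Fin m // j.val ≠ 0} → M,
    h (fun j => if hj : j.val ≠ 0 then y ⟨j, hj⟩ else x) ∂(Measure.pi fun _ => μ)

/-- `σ_h`, the standard deviation of `h(X_1, ..., X_m)` for independent `X_j` with law `μ`. -/
noncomputable def sigmaH {M : Type*} [MeasurableSpace M] {m : ℕ} (h : (Fin m → M) → ℝ)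
    (μ : Measure M) : ℝ :=
  √(Var[h; Measure.pi fun _ : Fin m => μ])

/-- `σ_g`, the standard deviation of `g(X_1)` for `X_1` with law `μ`. -/
noncomputable def sigmaG {M : Type*} [MeasurableSpace M] {m : ℕ} (h : (Fin m → M) → ℝ)
    (μ : Measure M) : ℝ :=
  √(Var[firstProj h μ; μ])

/-- The third absolute moment `E[|g(X_1)|^3]`, which may be infinite. -/
noncomputable def thirdMomentG {M : Type*} [MeasurableSpace M] {m : ℕ} (h : (Fin m → M) → ℝ)
    (μ : Measure M) : ℝ≥0∞ :=
  ∫⁻ x, ENNReal.ofReal (|firstProj h μ x| ^ 3) ∂μ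

/-- The Bernoulli sampling probability `p = N / (n choose m)`. -/
noncomputable def sampProb (m n N : ℕ) : ℝ := (N : ℝ) / (n.choose m : ℝ)

/-- The incomplete U-statistic `(∑ᵢ Zᵢ)⁻¹ ∑ᵢ Zᵢ h(X_{i_1}, ..., X_{i_m})`, for given values of the
data `x` and of the samplers `z`. It is `0` when all samplers vanish. -/
noncomputable def incompleteU {M : Type*} {m n : ℕ} (h : (Fin m → M) → ℝ)
    (x : Fin n → M) (z : Idx m n → ℝ) : ℝ :=
  (1 / ∑ i, z i) * ∑ i, z i * h (fun j => x (i j))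

/-- The Kolmogorov distance `sup_z |P(Y ≤ z) - Φ(z)|` of a real random variable `Y` to `N(0, 1)`. -/
noncomputable def kolmogorovDistNormal {Ω : Type*} [MeasurableSpace Ω] (P : Measure Ω)
    (Y : Ω → ℝ) : ℝ≥0∞ :=
  ⨆ z : ℝ, ENNReal.ofReal |P.real {ω | Y ω ≤ z} - cdf (gaussianReal 0 1) z|

/-- The sampling scheme: `X_1, ..., X_n` are i.i.d. with law `μ`, the samplers `Z_i` are i.i.d.
Bernoulli with success probability `p`, and the samplers are independent of the data. -/
structure IsBernoulliSampling {Ω M : Type*} [MeasurableSpace Ω] [MeasurableSpace M]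
    {m n : ℕ} (P : Measure Ω) (μ : Measure M) (p : ℝ)
    (X : Fin n → Ω → M) (Z : Idx m n → Ω → ℝ) : Prop where
  measurable_X : ∀ k, Measurable (X k)
  law_X : ∀ k, P.map (X k) = μ
  indep_X : iIndepFun X P
  measurable_Z : ∀ i, Measurable (Z i)
  prob_one : ∀ i, P.real {ω | Z i ω = 1} = p
  prob_zero : ∀ i, P.real {ω | Z i ω = 0} = 1 - p
  indep_Z : iIndepFun Z P
  indep_X_Z : IndepFun (fun ω k => X k ω) (fun ω i => Z i ω) P

end IncompleteUStat

/-! Put r = N̂/N. Where r > 0, the normalized statistic is at most z exactly when W + D ≤ z r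
(`linearPart_add_remainder`). Here W is the normalized Hájek projection, a sum of n i.i.d. terms ξ_k
depending on one observation each, and D collects the degenerate part of the complete U-statistic
and the centred sampling noise. The random denominator has moved into the threshold z r, which
depends on the samplers alone and is therefore independent of W.

Exchanging W + D for W costs at most P(|W - z r| ≤ |D|). The randomized concentration inequality
`concentration` bounds this by the Lyapunov ratio γ, by E|W D| and by the sum of E|ξ_k (D - D_k)|,
where D_k is D with the k-th observation replaced by a fresh one. By Cauchy-Schwarz only E D² and
the total influence ∑ E (D - D_k)² matter, so h itself needs no moment beyond the second.

Both quantities are controlled in `Setting.remainder_bounds`. For the degenerate part, let ζ(c) be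
the covariance of the kernel at two index sets with c common elements. Then ζ(0) = ζ(1) = 0, and all
forward differences of ζ at 0 are non-negative, being the variances of the Hoeffding components
(`fwdDiff_overlapCov_nonneg`). Newton's expansion of ζ and counting of overlaps (`sum_overlap_le`)
bound second moment and influence by multiples of (m/n)² ζ(m), with ζ(m) = σ_h² - m σ_g²; the
condition m < n/2 keeps the factor for the influence absolute. For the sampling noise, distinct
index sets are orthogonal because the centred samplers are uncorrelated.

It remains to treat P(W ≤ z r). Given the samplers the threshold is a constant, so the Berry-Esseen
bound applies uniformly; `berry_esseen` proves it by Stein's method, with the same concentration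
inequality handling the jump of the derivative of the Stein solution. Finally Φ(z r) and Φ(z) differ
by at most 2 |r - 1|, and E|r - 1| ≤ 1/√N, which also bounds the probability of r ≤ 0. -/

namespace IncompleteUStat

open Set Filter Topology

/-! ### The standard normal density and distribution function. -/

/-- The standard normal density. -/
noncomputable def stdPdf (w : ℝ) : ℝ := gaussianPDFReal 0 1 w

/-- The standard normal distribution function. -/
noncomputable def stdCdf (w : ℝ) : ℝ := cdf (gaussianReal 0 1) w

lemma stdPdf_eq (w : ℝ) : stdPdf w = (√(2 * Real.pi))⁻¹ * Real.exp (-w ^ 2 / 2) := by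
  simp [stdPdf, gaussianPDFReal]

lemma stdPdf_pos (w : ℝ) : 0 < stdPdf w := gaussianPDFReal_pos 0 1 w (by simp)

lemma continuous_stdPdf : Continuous stdPdf := by
  have : stdPdf = fun w => (√(2 * Real.pi))⁻¹ * Real.exp (-w ^ 2 / 2) := funext stdPdf_eq
  rw [this]; fun_prop

lemma hasDerivAt_stdPdf (w : ℝ) : HasDerivAt stdPdf (-w * stdPdf w) w := by
  have : stdPdf = fun w => (√(2 * Real.pi))⁻¹ * Real.exp (-w ^ 2 / 2) := funext stdPdf_eq
  rw [this]
  have h1 : HasDerivAt (fun w : ℝ => -w ^ 2 / 2) (-w) w := by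
    exact ((hasDerivAt_pow 2 w).neg.div_const 2).congr_deriv (by norm_num; ring)
  exact (h1.exp.const_mul (√(2 * Real.pi))⁻¹).congr_deriv (by ring)

lemma stdCdf_eq_integral (w : ℝ) : stdCdf w = ∫ t in Iic w, stdPdf t := by
  rw [stdCdf, cdf_eq_real, measureReal_def, gaussianReal_apply_eq_integral _ (by simp),
    ENNReal.toReal_ofReal (integral_nonneg fun _ => gaussianPDFReal_nonneg _ _ _)]
  rfl

lemma hasDerivAt_stdCdf (w : ℝ) : HasDerivAt stdCdf (stdPdf w) w := by
  have hint : Integrable stdPdf := integrable_gaussianPDFReal 0 1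
  have heq : stdCdf = fun u => stdCdf 0 + ∫ t in (0 : ℝ)..u, stdPdf t := by
    ext u
    rw [← intervalIntegral.integral_Iic_sub_Iic hint.integrableOn hint.integrableOn,
      stdCdf_eq_integral, stdCdf_eq_integral]
    ring
  rw [heq]
  exact (intervalIntegral.integral_hasDerivAt_right (hint.intervalIntegrable)
    (continuous_stdPdf.stronglyMeasurableAtFilter _ _) continuous_stdPdf.continuousAt).const_add _

lemma stdCdf_nonneg (w : ℝ) : 0 ≤ stdCdf w := cdf_nonneg _ _
lemma stdCdf_le_one (w : ℝ) : stdCdf w ≤ 1 := cdf_le_one _ _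
lemma stdCdf_mono : Monotone stdCdf := monotone_cdf _
lemma continuous_stdCdf : Continuous stdCdf :=
  continuous_iff_continuousAt.2 fun w => (hasDerivAt_stdCdf w).continuousAt

/-- Mills' inequality. -/
lemma mul_one_sub_stdCdf_le {w : ℝ} : w * (1 - stdCdf w) ≤ stdPdf w := by
  have key : ∀ b, w ≤ b → w * (stdCdf b - stdCdf w) ≤ stdPdf w := by
    intro b hb
    -- The derivative is (x - w) φ(x), non-negative to the right of w; Mills' inequality follows by
    -- letting b tend to infinity.
    have hd : ∀ x, HasDerivAt (fun b => -stdPdf b - w * stdCdf b)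
        (x * stdPdf x - w * stdPdf x) x := fun x => by
      exact ((hasDerivAt_stdPdf x).neg.sub ((hasDerivAt_stdCdf x).const_mul w)).congr_deriv
        (by ring)
    have hm : MonotoneOn (fun b => -stdPdf b - w * stdCdf b) (Ici w) := by
      refine monotoneOn_of_deriv_nonneg (convex_Ici w)
        (fun x _ => (hd x).continuousAt.continuousWithinAt)
        (fun x _ => (hd x).differentiableAt.differentiableWithinAt) fun x hx => ?_
      rw [interior_Ici] at hx
      rw [(hd x).deriv]
      nlinarith [stdPdf_pos x, mem_Ioi.1 hx]
    have := hm (mem_Ici.2 le_rfl) (mem_Ici.2 hb) hb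
    simp only at this
    nlinarith [stdPdf_pos b]
  have ht : Tendsto (fun b => w * (stdCdf b - stdCdf w)) atTop (𝓝 (w * (1 - stdCdf w))) :=
    ((tendsto_cdf_atTop (gaussianReal 0 1)).sub_const _).const_mul w
  exact le_of_tendsto ht ((eventually_ge_atTop w).mono key)

lemma neg_mul_stdCdf_le {w : ℝ} : -w * stdCdf w ≤ stdPdf w := by
  have key : ∀ b, b ≤ w → -w * (stdCdf w - stdCdf b) ≤ stdPdf w := by
    intro b hb
    have hd : ∀ x, HasDerivAt (fun b => stdPdf b + w * stdCdf b)
        (-x * stdPdf x + w * stdPdf x) x := fun x => by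
      exact (hasDerivAt_stdPdf x).add ((hasDerivAt_stdCdf x).const_mul w)
    have hm : MonotoneOn (fun b => stdPdf b + w * stdCdf b) (Iic w) := by
      refine monotoneOn_of_deriv_nonneg (convex_Iic w)
        (fun x _ => (hd x).continuousAt.continuousWithinAt)
        (fun x _ => (hd x).differentiableAt.differentiableWithinAt) fun x hx => ?_
      rw [interior_Iic] at hx
      rw [(hd x).deriv]
      nlinarith [stdPdf_pos x, mem_Iio.1 hx]
    have := hm (mem_Iic.2 hb) (mem_Iic.2 le_rfl) hb
    simp only at this
    nlinarith [stdPdf_pos b]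
  have ht : Tendsto (fun b => -w * (stdCdf w - stdCdf b)) atBot (𝓝 (-w * (stdCdf w - 0))) :=
    ((tendsto_cdf_atBot (gaussianReal 0 1)).const_sub _).const_mul _
  rw [sub_zero] at ht
  exact le_of_tendsto ht ((eventually_le_atBot w).mono key)

lemma one_fifth_le_stdPdf {w : ℝ} (hw : |w| ≤ 1) : 1 / 5 ≤ stdPdf w := by
  have hw2 : w ^ 2 ≤ 1 := by rw [← sq_abs]; nlinarith [abs_nonneg w]
  have h1 : Real.exp (-(1 / 2)) ≤ Real.exp (-w ^ 2 / 2) := Real.exp_le_exp.2 (by linarith)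
  have hpos : 0 < √(2 * Real.pi) := by positivity
  have h2 : √(2 * Real.pi) * Real.exp (1 / 2) ≤ 5 := by
    have he : Real.exp (1 / 2) ^ 2 ≤ 2.7182818286 := by
      rw [← Real.exp_nat_mul]; norm_num; linarith [Real.exp_one_lt_d9.le]
    have hs : √(2 * Real.pi) ^ 2 = 2 * Real.pi := Real.sq_sqrt (by positivity)
    refine abs_le_of_sq_le_sq' ?_ (by norm_num) |>.2
    rw [mul_pow, hs]
    nlinarith [Real.pi_lt_d2, Real.pi_pos]
  rw [stdPdf_eq]
  refine le_trans ?_ (mul_le_mul_of_nonneg_left h1 (by positivity))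
  rw [Real.exp_neg, ← mul_inv, one_div]
  exact inv_anti₀ (by positivity) h2

/-! ### Stein's equation for half-lines. -/

/-- The solution of Stein's equation for the half-line `(-∞, z)`. -/
noncomputable def steinSol (z w : ℝ) : ℝ :=
  if z ≤ w then stdCdf z * (1 - stdCdf w) / stdPdf w else stdCdf w * (1 - stdCdf z) / stdPdf w

/-- The right derivative of `steinSol z`. -/
noncomputable def steinDer (z w : ℝ) : ℝ :=
  w * steinSol z w + (if z ≤ w then 0 else 1) - stdCdf z

lemma continuous_steinSol (z : ℝ) : Continuous (steinSol z) := by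
  unfold steinSol
  have h0 : ∀ w, stdPdf w ≠ 0 := fun w => (stdPdf_pos w).ne'
  refine Continuous.if_le ?_ ?_ continuous_const continuous_id fun w hw => ?_
  · exact (continuous_const.mul (continuous_const.sub continuous_stdCdf)).div continuous_stdPdf h0
  · exact (continuous_stdCdf.mul continuous_const).div continuous_stdPdf h0
  · rw [show z = w from hw]

/-- The solution has a kink at z. Working with right derivatives gives a derivative at every point,
so mean value estimates need no exceptional point, and f' - w f = 1{w < z} - Φ(z) holds everywhere,
with the value 0 of the indicator at w = z. -/
lemma hasDerivWithinAt_steinSol (z w : ℝ) :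
    HasDerivWithinAt (steinSol z) (steinDer z w) (Ici w) w := by
  have h0 : stdPdf w ≠ 0 := (stdPdf_pos w).ne'
  by_cases hzw : z ≤ w
  · have h1 : HasDerivAt (fun w => stdCdf z * (1 - stdCdf w) / stdPdf w) (steinDer z w) w := by
      refine ((((hasDerivAt_stdCdf w).const_sub 1).const_mul (stdCdf z)).div
        (hasDerivAt_stdPdf w) h0).congr_deriv ?_
      simp only [steinDer, steinSol, if_pos hzw]
      field_simp
      ring
    refine h1.hasDerivWithinAt.congr (fun x hx => ?_) ?_
    · simp [steinSol, hzw.trans hx]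
    · simp [steinSol, hzw]
  · have h1 : HasDerivAt (fun w => stdCdf w * (1 - stdCdf z) / stdPdf w) (steinDer z w) w := by
      refine (((hasDerivAt_stdCdf w).mul_const (1 - stdCdf z)).div
        (hasDerivAt_stdPdf w) h0).congr_deriv ?_
      simp only [steinDer, steinSol, if_neg hzw]
      field_simp
      ring
    refine (h1.congr_of_eventuallyEq ?_).hasDerivWithinAt
    filter_upwards [eventually_lt_nhds (not_le.1 hzw)] with x hx
    simp [steinSol, hx]

lemma steinSol_nonneg (z w : ℝ) : 0 ≤ steinSol z w := by
  unfold steinSol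
  have := stdPdf_pos w
  split_ifs <;>
  exact div_nonneg (mul_nonneg (stdCdf_nonneg _) (sub_nonneg.2 (stdCdf_le_one _))) this.le

lemma steinSol_le_left (z w : ℝ) : steinSol z w ≤ stdCdf w / stdPdf w := by
  unfold steinSol
  have := stdPdf_pos w
  split_ifs with h <;> gcongr
  · have := stdCdf_mono h
    nlinarith [stdCdf_nonneg w, stdCdf_nonneg z, stdCdf_le_one w]
  · nlinarith [stdCdf_nonneg w, stdCdf_nonneg z]

lemma steinSol_le_right (z w : ℝ) : steinSol z w ≤ (1 - stdCdf w) / stdPdf w := by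
  unfold steinSol
  have := stdPdf_pos w
  split_ifs with h <;> gcongr
  · nlinarith [stdCdf_le_one w, stdCdf_le_one z]
  · have := stdCdf_mono (not_le.1 h).le
    nlinarith [stdCdf_le_one w, stdCdf_le_one z]

/-- Mills' inequality on the side of 0 where w lies; on the other side the sign of `steinSol`
suffices. -/
lemma abs_mul_steinSol_le (z w : ℝ) : |w * steinSol z w| ≤ 1 := by
  have hp := stdPdf_pos w
  have h0 := steinSol_nonneg z w
  rw [abs_le]
  constructor
  · have h1 : -w * stdCdf w / stdPdf w ≤ 1 := (div_le_one hp).2 neg_mul_stdCdf_le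
    rcases le_total 0 w with h | h
    · nlinarith
    · have := mul_le_mul_of_nonneg_left (steinSol_le_left z w) (neg_nonneg.2 h)
      rw [← mul_div_assoc] at this
      linarith
  · have h1 : w * (1 - stdCdf w) / stdPdf w ≤ 1 := (div_le_one hp).2 mul_one_sub_stdCdf_le
    rcases le_total 0 w with h | h
    · have := mul_le_mul_of_nonneg_left (steinSol_le_right z w) h
      rw [← mul_div_assoc] at this
      linarith
    · nlinarith

/-- On [-1, 1] the density is at least 1/5; outside, the bound on w f(w) is stronger. Any absolute
constant would do. -/
lemma abs_steinSol_le (z w : ℝ) : |steinSol z w| ≤ 5 := by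
  have h0 := steinSol_nonneg z w
  rw [abs_of_nonneg h0]
  rcases le_total |w| 1 with h | h
  · have hp := stdPdf_pos w
    refine (steinSol_le_left z w).trans ((div_le_iff₀ hp).2 ?_)
    nlinarith [one_fifth_le_stdPdf h, stdCdf_le_one w]
  · have := abs_mul_steinSol_le z w
    rw [abs_mul, abs_of_nonneg h0] at this
    nlinarith

lemma abs_steinDer_le (z w : ℝ) : |steinDer z w| ≤ 2 := by
  have h1 := abs_mul_steinSol_le z w
  have h2 : |(if z ≤ w then (0 : ℝ) else 1) - stdCdf z| ≤ 1 := by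
    have := stdCdf_nonneg z
    have := stdCdf_le_one z
    split_ifs <;> rw [abs_le] <;> constructor <;> linarith
  unfold steinDer
  rw [add_sub_assoc]
  linarith [abs_add_le (w * steinSol z w) ((if z ≤ w then (0 : ℝ) else 1) - stdCdf z)]

lemma abs_sub_le_of_right_deriv {f f' : ℝ → ℝ} {K a b : ℝ} (hf : Continuous f)
    (hf' : ∀ x, HasDerivWithinAt f (f' x) (Ici x) x)
    (hK : ∀ x ∈ uIcc a b, |f' x| ≤ K) : |f b - f a| ≤ K * |b - a| := by
  rcases le_total a b with h | h
  · rw [uIcc_of_le h] at hK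
    have := norm_image_sub_le_of_norm_deriv_right_le_segment hf.continuousOn
      (fun x _ => hf' x) (fun x hx => hK x (Ico_subset_Icc_self hx)) b (right_mem_Icc.2 h)
    rwa [abs_of_nonneg (sub_nonneg.2 h)]
  · rw [uIcc_of_ge h] at hK
    have := norm_image_sub_le_of_norm_deriv_right_le_segment hf.continuousOn
      (fun x _ => hf' x) (fun x hx => hK x (Ico_subset_Icc_self hx)) a (right_mem_Icc.2 h)
    rwa [abs_sub_comm, abs_sub_comm b, abs_of_nonneg (sub_nonneg.2 h)]

lemma abs_steinSol_sub_le (z a b : ℝ) : |steinSol z b - steinSol z a| ≤ 2 * |b - a| :=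
  abs_sub_le_of_right_deriv (continuous_steinSol z) (hasDerivWithinAt_steinSol z)
    fun x _ => abs_steinDer_le z x

/-- By Stein's equation f' is w f plus a step function. The first part is locally Lipschitz, and the
step contributes only if z separates w + s from w + t, which forces w to be close to z. -/
lemma abs_steinDer_sub_le (z w s t : ℝ) :
    |steinDer z (w + s) - steinDer z (w + t)| ≤
      (2 * |w| + 5) * (|s| + |t|) + if |w - z| ≤ max |s| |t| then 1 else 0 := by
  have h1 : |(w + s) * steinSol z (w + s) - (w + t) * steinSol z (w + t)| ≤
      (2 * |w| + 5) * (|s| + |t|) := by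
    have e : (w + s) * steinSol z (w + s) - (w + t) * steinSol z (w + t) =
      w * (steinSol z (w + s) - steinSol z (w + t)) + (s * steinSol z (w + s) -
        t * steinSol z (w + t)) := by ring
    rw [e]
    have a1 := abs_steinSol_sub_le z (w + t) (w + s)
    have a2 : |w + s - (w + t)| ≤ |s| + |t| := by
      rw [add_sub_add_left_eq_sub]; exact abs_sub _ _
    have a3 : |w * (steinSol z (w + s) - steinSol z (w + t))| ≤ |w| * (2 * (|s| + |t|)) := by
      rw [abs_mul]; gcongr; linarith
    have a4 : |s * steinSol z (w + s)| ≤ |s| * 5 := by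
      rw [abs_mul]; gcongr; exact abs_steinSol_le _ _
    have a5 : |t * steinSol z (w + t)| ≤ |t| * 5 := by
      rw [abs_mul]; gcongr; exact abs_steinSol_le _ _
    have a6 := abs_sub (s * steinSol z (w + s)) (t * steinSol z (w + t))
    have a7 := abs_add_le (w * (steinSol z (w + s) - steinSol z (w + t)))
      (s * steinSol z (w + s) - t * steinSol z (w + t))
    linarith
  have h2 : |(if z ≤ w + s then (0 : ℝ) else 1) - (if z ≤ w + t then (0 : ℝ) else 1)| ≤
      if |w - z| ≤ max |s| |t| then 1 else 0 := by
    by_cases h : |w - z| ≤ max |s| |t|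
    · rw [if_pos h]
      split_ifs <;> simp
    · rw [if_neg h]
      rw [not_le, max_lt_iff, lt_abs, lt_abs] at h
      have hs := neg_abs_le s
      have hs' := le_abs_self s
      have ht := neg_abs_le t
      have ht' := le_abs_self t
      obtain ⟨h3, h4⟩ := h
      have : (z ≤ w + s) ↔ (z ≤ w + t) := by
        constructor <;> intro h5 <;> rcases h3 with h3 | h3 <;> rcases h4 with h4 | h4 <;> linarith
      simp [this]
  have e2 : steinDer z (w + s) - steinDer z (w + t) =
      ((w + s) * steinSol z (w + s) - (w + t) * steinSol z (w + t)) +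
      ((if z ≤ w + s then (0 : ℝ) else 1) - (if z ≤ w + t then (0 : ℝ) else 1)) := by
    unfold steinDer; ring
  rw [e2]
  exact (abs_add_le _ _).trans (add_le_add h1 h2)

/-- The pointwise estimate behind the Berry-Esseen bound. -/
lemma abs_steinSol_taylor_le (z w u v : ℝ) :
    |steinSol z (w + v) - steinSol z w - v * steinDer z (w + u)| ≤
      ((2 * |w| + 5) * (|u| + |v|) + if |w - z| ≤ |u| + |v| then 1 else 0) * |v| := by
  have hc : Continuous fun t => steinSol z (w + t) - t * steinDer z (w + u) :=
    ((continuous_steinSol z).comp (continuous_const.add continuous_id)).sub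
      (continuous_id.mul continuous_const)
  have hd : ∀ t, HasDerivWithinAt (fun t => steinSol z (w + t) - t * steinDer z (w + u))
      (steinDer z (w + t) - steinDer z (w + u)) (Ici t) t := by
    intro t
    have h1 : HasDerivWithinAt (fun t => steinSol z (w + t)) (steinDer z (w + t) * 1) (Ici t) t := by
      refine HasDerivWithinAt.comp (h₂ := steinSol z) (h := fun t => w + t) t
        (hasDerivWithinAt_steinSol z (w + t))
        ((hasDerivAt_id t).const_add w).hasDerivWithinAt ?_
      intro x hx
      simpa using hx
    exact (h1.sub ((hasDerivAt_id t).mul_const (steinDer z (w + u))).hasDerivWithinAt).congr_deriv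
      (by ring)
  have := abs_sub_le_of_right_deriv (a := 0) (b := v) hc hd
    (K := (2 * |w| + 5) * (|u| + |v|) + if |w - z| ≤ |u| + |v| then 1 else 0) ?_
  · simpa [sub_right_comm] using this
  · intro t ht
    have htv : |t| ≤ |v| := by
      have := abs_sub_left_of_mem_uIcc ht
      simpa using this
    refine (abs_steinDer_sub_le z w t u).trans ?_
    have h5 : (0 : ℝ) ≤ 2 * |w| + 5 := by positivity
    have h6 : (2 * |w| + 5) * (|t| + |u|) ≤ (2 * |w| + 5) * (|u| + |v|) := by
      exact mul_le_mul_of_nonneg_left (by linarith) h5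
    refine add_le_add h6 ?_
    split_ifs with h7 h8
    · exact le_rfl
    · exact absurd (h7.trans (max_le (by linarith [abs_nonneg u]) (by linarith [abs_nonneg v]))) h8
    · norm_num
    · exact le_rfl

lemma measurable_steinDer (z : ℝ) : Measurable (steinDer z) := by
  unfold steinDer
  refine ((measurable_id.mul (continuous_steinSol z).measurable).add ?_).sub_const _
  exact Measurable.ite measurableSet_Ici measurable_const measurable_const

lemma abs_mul_stdPdf_le (w : ℝ) : |w| * stdPdf w ≤ 1 / 2 := by
  have hs : 2 ≤ √(2 * Real.pi) := by
    apply Real.le_sqrt_of_sq_le; nlinarith [Real.pi_gt_three]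
  have h1 : |w| * Real.exp (-w ^ 2 / 2) ≤ 1 := by
    have := Real.add_one_le_exp (w ^ 2 / 2)
    have h2 : |w| ≤ Real.exp (w ^ 2 / 2) := by nlinarith [sq_abs w, sq_nonneg (|w| - 1)]
    rw [neg_div, Real.exp_neg]
    exact mul_inv_le_one_of_le₀ h2 (Real.exp_pos _).le
  have h3 : (√(2 * Real.pi))⁻¹ ≤ 1 / 2 := by
    rw [one_div]; exact inv_anti₀ (by norm_num) hs
  rw [stdPdf_eq]
  calc |w| * ((√(2 * Real.pi))⁻¹ * Real.exp (-w ^ 2 / 2))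
      = (√(2 * Real.pi))⁻¹ * (|w| * Real.exp (-w ^ 2 / 2)) := by ring
    _ ≤ 1 / 2 * 1 := by gcongr
    _ = 1 / 2 := by norm_num

/-- For |r - 1| ≥ 1/2 the right side is at least 1. Otherwise all intermediate x are at least 1/2,
and |z x| φ(z x) ≤ 1/2 bounds the derivative z φ(z x) by 1, uniformly in z. -/
lemma abs_stdCdf_mul_sub_le (z r : ℝ) : |stdCdf (z * r) - stdCdf z| ≤ 2 * |r - 1| := by
  rcases le_total (1 / 2) |r - 1| with h | h
  · have := stdCdf_nonneg (z * r)
    have := stdCdf_le_one (z * r)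
    have := stdCdf_nonneg z
    have := stdCdf_le_one z
    rw [abs_le]; constructor <;> linarith
  · have := abs_sub_le_of_right_deriv (f := fun t => stdCdf (z * t)) (f' := fun t => stdPdf (z * t) * z)
      (a := 1) (b := r) (K := 1) (continuous_stdCdf.comp (continuous_const.mul continuous_id)) ?_ ?_
    · simp only [mul_one, one_mul] at this
      linarith [abs_nonneg (r - 1)]
    · intro x
      have h1 : HasDerivAt (fun t => z * t) z x := by
        simpa using (hasDerivAt_id x).const_mul z
      exact ((hasDerivAt_stdCdf (z * x)).comp x h1).hasDerivWithinAt
    · intro x hx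
      have hx1 := abs_sub_left_of_mem_uIcc hx
      have hx2 : 1 / 2 ≤ x := by linarith [neg_abs_le (x - 1)]
      have h2 := abs_mul_stdPdf_le (z * x)
      rw [abs_mul, abs_of_pos (by linarith : 0 < x)] at h2
      rw [abs_mul, abs_of_pos (stdPdf_pos _)]
      nlinarith [mul_nonneg (abs_nonneg z) (stdPdf_pos (z * x)).le]

/-! ### Truncation and the randomized concentration inequality. -/

/-- Truncation of `t` to the interval `[-b, b]`. -/
noncomputable def clamp (t b : ℝ) : ℝ := max (-b) (min t b)

lemma abs_clamp_le {t b : ℝ} (hb : 0 ≤ b) : |clamp t b| ≤ b := by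
  unfold clamp
  rw [abs_le]
  exact ⟨le_max_left _ _, max_le (by linarith) (min_le_right _ _)⟩

lemma abs_clamp_sub_clamp_le (t b b' : ℝ) : |clamp t b - clamp t b'| ≤ |b - b'| := by
  unfold clamp
  refine (abs_max_sub_max_le_max _ _ _ _).trans (max_le ?_ ?_)
  · rw [neg_sub_neg, abs_sub_comm]
  · refine (abs_min_sub_min_le_max _ _ _ _).trans (max_le ?_ le_rfl)
    simp

lemma measurable_clamp : Measurable fun p : ℝ × ℝ => clamp p.1 p.2 :=
  (measurable_snd.neg).max (measurable_fst.min measurable_snd)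

lemma clamp_mono {s t : ℝ} (b : ℝ) (h : s ≤ t) : clamp s b ≤ clamp t b := by
  unfold clamp
  gcongr

lemma mul_clamp_sub_nonneg (x s b : ℝ) : 0 ≤ x * (clamp s b - clamp (s - x) b) := by
  rcases le_total 0 x with h | h
  · exact mul_nonneg h (sub_nonneg.2 (clamp_mono b (by linarith)))
  · exact mul_nonneg_of_nonpos_of_nonpos h (sub_nonpos.2 (clamp_mono b (by linarith)))

/-- The margin δ is the point: s lies in the inner band, so moving it by x either changes the
truncation by the full |x| or carries it across the margin, changing it by at least δ. -/
lemma abs_mul_min_le_mul_clamp_sub {x s D δ : ℝ} (hδ : 0 ≤ δ) (h : |s| ≤ |D|) :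
    |x| * min δ |x| ≤ x * (clamp s (|D| + δ) - clamp (s - x) (|D| + δ)) := by
  obtain ⟨h1, h2⟩ := abs_le.1 h
  have e : clamp s (|D| + δ) = s := by
    unfold clamp
    rw [min_eq_left (by linarith), max_eq_right (by linarith)]
  rw [e]
  rcases le_total 0 x with hx | hx
  · rw [abs_of_nonneg hx]
    refine mul_le_mul_of_nonneg_left ?_ hx
    have : clamp (s - x) (|D| + δ) ≤ max (-(|D| + δ)) (s - x) := by
      unfold clamp
      exact max_le_max le_rfl (min_le_left _ _)
    rcases max_choice (-(|D| + δ)) (s - x) with h3 | h3 <;> rw [h3] at this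
    · exact (min_le_left _ _).trans (by linarith)
    · exact (min_le_right _ _).trans (by linarith)
  · rw [abs_of_nonpos hx, neg_mul, ← mul_neg]
    refine mul_le_mul_of_nonpos_left ?_ hx
    have : min (s - x) (|D| + δ) ≤ clamp (s - x) (|D| + δ) := le_max_right _ _
    rcases min_choice (s - x) (|D| + δ) with h3 | h3 <;> rw [h3] at this
    · have := min_le_right δ (-x); linarith
    · have := min_le_left δ (-x); linarith

/-- For |x| ≥ δ this is (|x| - 2δ)² ≥ 0 multiplied by |x| / (4δ). -/
lemma sq_sub_le_abs_mul_min {x δ : ℝ} (hδ : 0 < δ) :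
    x ^ 2 - |x| ^ 3 / (4 * δ) ≤ |x| * min δ |x| := by
  have h0 := abs_nonneg x
  rw [← sq_abs, sub_le_iff_le_add, ← sub_le_iff_le_add', le_div_iff₀ (by positivity)]
  rcases le_total δ |x| with h | h
  · rw [min_eq_left h]
    nlinarith [mul_nonneg h0 (sq_nonneg (|x| - 2 * δ))]
  · rw [min_eq_right h]
    have : 0 ≤ |x| ^ 3 := by positivity
    nlinarith

section Concentration

variable {Ω ι : Type*} [MeasurableSpace Ω] {P : Measure Ω} [IsProbabilityMeasure P] [Fintype ι]

lemma integral_abs_le_one {W : Ω → ℝ} (hW : MemLp W 2 P) (h1 : ∫ ω, W ω ^ 2 ∂P ≤ 1) :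
    ∫ ω, |W ω| ∂P ≤ 1 := by
  have h2 : ∫ ω, |W ω| ∂P ≤ ∫ ω, (1 + W ω ^ 2) / 2 ∂P := by
    refine integral_mono (hW.integrable (by norm_num)).abs
      (((integrable_const _).add hW.integrable_sq).div_const 2) fun ω => ?_
    have := sq_nonneg (|W ω| - 1)
    have := sq_abs (W ω)
    simp only
    nlinarith
  rw [integral_div, integral_add (integrable_const _) hW.integrable_sq] at h2
  simp at h2
  linarith

lemma integral_sum_sq {ξ : ι → Ω → ℝ} (hL : ∀ i, MemLp (ξ i) 2 P) (hind : iIndepFun ξ P)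
    (h0 : ∀ i, ∫ ω, ξ i ω ∂P = 0) :
    ∫ ω, (∑ i, ξ i ω) ^ 2 ∂P = ∑ i, ∫ ω, ξ i ω ^ 2 ∂P := by
  have hv := IndepFun.variance_sum (s := Finset.univ) (X := ξ) (μ := P) (fun i _ => hL i)
    (fun i _ j _ hij => hind.indepFun hij)
  rw [variance_of_integral_eq_zero (memLp_finsetSum' _ fun i _ => hL i).aemeasurable] at hv
  · simp only [Finset.sum_apply] at hv
    rw [hv]
    exact Finset.sum_congr rfl fun i _ => variance_of_integral_eq_zero (hL i).aemeasurable (h0 i)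
  · simp only [Finset.sum_apply]
    rw [integral_finsetSum _ fun i _ => (hL i).integrable (by norm_num)]
    simp [h0]

/-- A randomized concentration inequality for sums of independent random variables. -/
theorem concentration {ξ : ι → Ω → ℝ} (hm : ∀ i, Measurable (ξ i)) (hL : ∀ i, MemLp (ξ i) 3 P)
    (hind : iIndepFun ξ P) (h0 : ∀ i, ∫ ω, ξ i ω ∂P = 0)
    (h1 : ∑ i, ∫ ω, ξ i ω ^ 2 ∂P = 1) {γ : ℝ} (hγ : ∑ i, ∫ ω, |ξ i ω| ^ 3 ∂P = γ) (hγ0 : 0 < γ)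
    {c D : Ω → ℝ} {D' : ι → Ω → ℝ} (hc : Measurable c) (hD : MemLp D 2 P) (hDm : Measurable D)
    (hD' : ∀ i, MemLp (D' i) 2 P) (hDm' : ∀ i, Measurable (D' i))
    (hi : ∀ i, IndepFun (ξ i) (fun ω => ((∑ j, ξ j ω) - ξ i ω, c ω, D' i ω)) P) :
    P.real {ω | |(∑ i, ξ i ω) - c ω| ≤ |D ω|} ≤
      2 * γ + 2 * ∫ ω, |(∑ i, ξ i ω) * D ω| ∂P +
        2 * ∑ i, ∫ ω, |ξ i ω * (D ω - D' i ω)| ∂P := by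
  -- With this δ the cubic loss γ / (4δ) equals 1/2, which leaves half of the unit variance in E Y
  -- below.
  set δ := γ / 2 with hδ
  have hδ0 : 0 < δ := by positivity
  set W : Ω → ℝ := fun ω => ∑ i, ξ i ω with hW
  have hL2 : ∀ i, MemLp (ξ i) 2 P := fun i => (hL i).mono_exponent (by norm_num)
  have hWL : MemLp W 2 P := memLp_finsetSum _ fun i _ => hL2 i
  have hWm : Measurable W := Finset.measurable_sum _ fun i _ => hm i
  have hWsq : ∫ ω, W ω ^ 2 ∂P = 1 := by rw [integral_sum_sq hL2 hind h0, h1]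
  set A : Set Ω := {ω | |W ω - c ω| ≤ |D ω|} with hA
  have hAm : MeasurableSet A := measurableSet_le (hWm.sub hc).abs hDm.abs
  set y : ℝ → ℝ := fun x => |x| * min δ |x| with hy
  have hym : Measurable y := measurable_id.abs.mul (measurable_const.min measurable_id.abs)
  have hy0 : ∀ x, 0 ≤ y x := fun x => mul_nonneg (abs_nonneg x) (le_min hδ0.le (abs_nonneg x))
  have hyb : ∀ x, y x ≤ δ * |x| := fun x =>
    (mul_le_mul_of_nonneg_left (min_le_left _ _) (abs_nonneg x)).trans_eq (mul_comm _ _)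
  have hL3 : ∀ i, Integrable (fun ω => |ξ i ω| ^ 3 / (4 * δ)) P := fun i =>
    ((hL i).integrable_norm_pow (by norm_num)).div_const _
  set Y : Ω → ℝ := fun ω => ∑ i, y (ξ i ω) with hY
  have hyL : ∀ i, MemLp (fun ω => y (ξ i ω)) 2 P := fun i =>
    ((hL2 i).abs.const_mul δ).mono (hym.comp (hm i)).aestronglyMeasurable
      (ae_of_all _ fun ω => by
        rw [Real.norm_eq_abs, Real.norm_eq_abs, abs_of_nonneg (hy0 _)]
        exact (hyb _).trans (le_abs_self _))
  have hYL : MemLp Y 2 P := memLp_finsetSum _ fun i _ => hyL i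
  have hYI : Integrable Y P := hYL.integrable (by norm_num)
  set EY := ∫ ω, Y ω ∂P with hEY
  have hEY2 : 1 / 2 ≤ EY := by
    have e : ∑ i, ∫ ω, (ξ i ω ^ 2 - |ξ i ω| ^ 3 / (4 * δ)) ∂P = 1 / 2 := by
      have : ∀ i, ∫ ω, (ξ i ω ^ 2 - |ξ i ω| ^ 3 / (4 * δ)) ∂P =
          ∫ ω, ξ i ω ^ 2 ∂P - (∫ ω, |ξ i ω| ^ 3 ∂P) / (4 * δ) := fun i => by
        rw [integral_sub (hL2 i).integrable_sq (hL3 i), integral_div]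
      simp_rw [this]
      rw [Finset.sum_sub_distrib, ← Finset.sum_div, h1, hγ, hδ]
      field_simp
      norm_num
    rw [← e, hEY, integral_finsetSum _ fun i _ => (hyL i).integrable (by norm_num)]
    refine Finset.sum_le_sum fun i _ => integral_mono ?_ ((hyL i).integrable (by norm_num))
      fun ω => sq_sub_le_abs_mul_min hδ0
    exact (hL2 i).integrable_sq.sub (hL3 i)
  -- The summands of Y are independent and at most δ |ξ_i|, so Y concentrates around its mean even
  -- though the event A is not independent of it.
  have hVar : ∫ ω, (Y ω - EY) ^ 2 ∂P ≤ δ ^ 2 := by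
    have hv := IndepFun.variance_sum (s := Finset.univ) (X := fun i ω => y (ξ i ω)) (μ := P)
      (fun i _ => hyL i) (fun i _ j _ hij => (hind.indepFun hij).comp hym hym)
    have e1 : (∑ i, fun ω => y (ξ i ω)) = Y := by ext ω; simp [hY]
    rw [e1, variance_eq_integral hYL.aemeasurable] at hv
    rw [hEY, hv]
    calc ∑ i, Var[fun ω => y (ξ i ω); P] ≤ ∑ i, ∫ ω, δ ^ 2 * ξ i ω ^ 2 ∂P := by
          refine Finset.sum_le_sum fun i _ => (variance_le_expectation_sq
            (hyL i).aestronglyMeasurable).trans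
            (integral_mono (hyL i).integrable_sq ((hL2 i).integrable_sq.const_mul _) fun ω => ?_)
          have h2 := hyb (ξ i ω)
          have h3 := hy0 (ξ i ω)
          simp only [Pi.pow_apply]
          rw [← sq_abs (ξ i ω), ← mul_pow]
          gcongr
      _ = δ ^ 2 := by simp_rw [integral_const_mul]; rw [← Finset.mul_sum, h1, mul_one]
  -- lower bound
  have hlow : P.real A / 2 - δ ≤ ∫ ω, A.indicator Y ω ∂P := by
    have hi1 : Integrable (fun ω => A.indicator (fun _ => (1 / 2 : ℝ)) ω) P :=
      (integrable_const _).indicator hAm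
    have hi3 : Integrable (fun ω => (Y ω - EY) ^ 2 / δ) P :=
      (hYL.sub (memLp_const EY)).integrable_sq.div_const δ
    have hi2 : Integrable (fun ω => (δ + (Y ω - EY) ^ 2 / δ) / 2) P :=
      ((integrable_const _).add hi3).div_const 2
    have : ∫ ω, (A.indicator (fun _ => (1 / 2 : ℝ)) ω - (δ + (Y ω - EY) ^ 2 / δ) / 2) ∂P ≤
        ∫ ω, A.indicator Y ω ∂P := by
      refine integral_mono (hi1.sub hi2) (hYI.indicator hAm) fun ω => ?_
      -- The arithmetic-geometric mean inequality, replacing Cauchy-Schwarz for the integral of EY -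
      -- Y over A.
      have h2 : EY - Y ω ≤ (δ + (Y ω - EY) ^ 2 / δ) / 2 := by
        have : 0 ≤ (Y ω - EY + δ) ^ 2 / δ := by positivity
        have e : (Y ω - EY + δ) ^ 2 / δ = (Y ω - EY) ^ 2 / δ + 2 * (Y ω - EY) + δ := by
          field_simp; ring
        linarith
      by_cases hω : ω ∈ A
      · simp only [indicator_of_mem hω]; linarith
      · simp only [indicator_of_notMem hω]
        have : 0 ≤ (δ + (Y ω - EY) ^ 2 / δ) / 2 := by positivity
        linarith
    rw [integral_sub hi1 hi2, integral_indicator_const _ hAm, integral_div,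
      integral_add (integrable_const _) hi3, integral_const, integral_div] at this
    have h3 : (∫ ω, (Y ω - EY) ^ 2 ∂P) / δ ≤ δ := by
      rw [div_le_iff₀ hδ0, ← sq]; exact hVar
    simp only [smul_eq_mul, probReal_univ, one_mul] at this
    linarith
  -- upper bound
  set F : Ω → ℝ := fun ω => clamp (W ω - c ω) (|D ω| + δ) with hF
  set G : ι → Ω → ℝ := fun i ω => clamp (W ω - c ω - ξ i ω) (|D ω| + δ) with hG
  -- `G i` still depends on ξ_i through D. In `H i` the width uses D'_i instead, so `H i` is
  -- independent of ξ_i and E ξ_i H_i = 0; the exchange costs at most |D - D'_i|.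
  set H : ι → Ω → ℝ := fun i ω => clamp (W ω - c ω - ξ i ω) (|D' i ω| + δ) with hH
  have hb : ∀ d : ℝ, 0 ≤ |d| + δ := fun d => by positivity
  have hbL : MemLp (fun ω => |D ω| + δ) 2 P := hD.abs.add (memLp_const δ)
  have hbL' : ∀ i, MemLp (fun ω => |D' i ω| + δ) 2 P := fun i => (hD' i).abs.add (memLp_const δ)
  have hFL : MemLp F 2 P := hbL.mono
    (measurable_clamp.comp ((hWm.sub hc).prodMk (hDm.abs.add_const δ))).aestronglyMeasurable
    (ae_of_all _ fun ω => (abs_clamp_le (hb _)).trans (le_abs_self _))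
  have hGL : ∀ i, MemLp (G i) 2 P := fun i => hbL.mono
    (measurable_clamp.comp (((hWm.sub hc).sub (hm i)).prodMk
      (hDm.abs.add_const δ))).aestronglyMeasurable
    (ae_of_all _ fun ω => (abs_clamp_le (hb _)).trans (le_abs_self _))
  have hHL : ∀ i, MemLp (H i) 2 P := fun i => (hbL' i).mono
    (measurable_clamp.comp (((hWm.sub hc).sub (hm i)).prodMk
      ((hDm' i).abs.add_const δ))).aestronglyMeasurable
    (ae_of_all _ fun ω => (abs_clamp_le (hb _)).trans (le_abs_self _))
  have hHz : ∀ i, ∫ ω, ξ i ω * H i ω ∂P = 0 := fun i => by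
    have hme : Measurable fun p : ℝ × ℝ × ℝ => clamp (p.1 - p.2.1) (|p.2.2| + δ) :=
      measurable_clamp.comp ((measurable_fst.sub (measurable_fst.comp measurable_snd)).prodMk
        ((measurable_snd.comp measurable_snd).abs.add_const δ))
    have h2 := (hi i).comp measurable_id hme
    have e : H i = (fun p : ℝ × ℝ × ℝ => clamp (p.1 - p.2.1) (|p.2.2| + δ)) ∘
        fun ω => ((∑ j, ξ j ω) - ξ i ω, c ω, D' i ω) := by
      ext ω
      simp only [hH, hW, Function.comp]
      rw [sub_right_comm]
    rw [← e] at h2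
    have := IndepFun.integral_fun_mul_eq_mul_integral h2 (hL2 i).aestronglyMeasurable
      (hHL i).aestronglyMeasurable
    simp only [Function.comp, id] at this
    rw [this, h0, zero_mul]
  have hup : ∫ ω, A.indicator Y ω ∂P ≤ ∫ ω, |W ω * D ω| ∂P + δ +
      ∑ i, ∫ ω, |ξ i ω * (D ω - D' i ω)| ∂P := by
    have hiWD : Integrable (fun ω => |W ω * D ω|) P := (hWL.integrable_mul hD).abs
    have hiW : Integrable (fun ω => δ * |W ω|) P :=
      (hWL.integrable (by norm_num)).abs.const_mul δ
    have hiS : ∀ i, Integrable (fun ω => |ξ i ω * (D ω - D' i ω)|) P := fun i =>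
      ((hL2 i).integrable_mul (hD.sub (hD' i))).abs
    have hiH : ∀ i, Integrable (fun ω => ξ i ω * H i ω) P := fun i =>
      (hL2 i).integrable_mul (hHL i)
    have hpt : ∀ ω, A.indicator Y ω ≤ |W ω * D ω| + δ * |W ω| +
        ∑ i, (|ξ i ω * (D ω - D' i ω)| - ξ i ω * H i ω) := by
      intro ω
      -- The truncation is monotone, so each term on the right is non-negative off A; on A it
      -- dominates the corresponding term of Y.
      have s1 : A.indicator Y ω ≤ ∑ i, ξ i ω * (F ω - G i ω) := by
        by_cases hω : ω ∈ A
        · rw [indicator_of_mem hω]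
          exact Finset.sum_le_sum fun i _ => abs_mul_min_le_mul_clamp_sub hδ0.le hω
        · rw [indicator_of_notMem hω]
          exact Finset.sum_nonneg fun i _ => mul_clamp_sub_nonneg _ _ _
      have s2 : ∑ i, ξ i ω * (F ω - G i ω) = W ω * F ω - ∑ i, ξ i ω * G i ω := by
        simp only [hW, mul_sub, Finset.sum_sub_distrib, Finset.sum_mul]
      have s3 : W ω * F ω ≤ |W ω * D ω| + δ * |W ω| := by
        refine (le_abs_self _).trans ?_
        rw [abs_mul, abs_mul]
        have := abs_clamp_le (t := W ω - c ω) (hb (D ω))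
        nlinarith [abs_nonneg (W ω)]
      have s4 : -∑ i, ξ i ω * G i ω ≤ ∑ i, (|ξ i ω * (D ω - D' i ω)| - ξ i ω * H i ω) := by
        rw [← Finset.sum_neg_distrib]
        refine Finset.sum_le_sum fun i _ => ?_
        have s5 : |G i ω - H i ω| ≤ |D ω - D' i ω| := by
          refine (abs_clamp_sub_clamp_le _ _ _).trans ?_
          rw [add_sub_add_right_eq_sub]
          exact abs_abs_sub_abs_le _ _
        have s6 : -(ξ i ω * (G i ω - H i ω)) ≤ |ξ i ω * (D ω - D' i ω)| := by
          refine (neg_le_abs _).trans ?_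
          rw [abs_mul, abs_mul]
          gcongr
        linarith
      linarith
    have hi1 : Integrable (fun ω => |W ω * D ω| + δ * |W ω|) P := hiWD.add hiW
    have hi2 : ∀ i, Integrable (fun ω => |ξ i ω * (D ω - D' i ω)| - ξ i ω * H i ω) P :=
      fun i => (hiS i).sub (hiH i)
    have hi3 : Integrable (fun ω => ∑ i, (|ξ i ω * (D ω - D' i ω)| - ξ i ω * H i ω)) P :=
      integrable_finsetSum _ fun i _ => hi2 i
    refine (integral_mono (hYI.indicator hAm) (hi1.add hi3) hpt).trans ?_
    rw [integral_add' hi1 hi3, integral_add hiWD hiW, integral_finsetSum _ fun i _ => hi2 i,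
      integral_const_mul]
    have h2 : δ * ∫ ω, |W ω| ∂P ≤ δ := by
      nlinarith [integral_abs_le_one hWL hWsq.le]
    have h3 : ∑ i, ∫ ω, (|ξ i ω * (D ω - D' i ω)| - ξ i ω * H i ω) ∂P =
        ∑ i, ∫ ω, |ξ i ω * (D ω - D' i ω)| ∂P :=
      Finset.sum_congr rfl fun i _ => by rw [integral_sub (hiS i) (hiH i), hHz, sub_zero]
    linarith
  linarith

end Concentration

/-! ### The Berry-Esseen theorem by Stein's method. -/

section BerryEsseen

/-- This is the contribution of one summand to E f'(W) - E W f(W), with W = w + u, η the law of the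
remaining sum w and ρ the law of the summand u. Taking v as an independent copy of u writes E u² E
f'(W) as E v² f'(w + u); since E v = 0, v f(w) may be subtracted and a Taylor remainder appears. Its
indicator part is paid for by the concentration of η near z. -/
lemma abs_stein_step_le {η ρ : Measure ℝ} [IsProbabilityMeasure η] [IsProbabilityMeasure ρ]
    {z K κ : ℝ} (hρ : MemLp id 3 ρ) (h0 : ∫ u, u ∂ρ = 0) (hη : Integrable id η)
    (hη1 : ∫ w, |w| ∂η ≤ 1) (hK : ∀ s, 0 ≤ s → η.real {w | |w - z| ≤ s} ≤ κ + K * s)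
    (hK0 : 0 ≤ K) :
    |(∫ u, u ^ 2 ∂ρ) * ∫ p, steinDer z (p.1 + p.2) ∂(η.prod ρ) -
        ∫ p, p.2 * steinSol z (p.1 + p.2) ∂(η.prod ρ)| ≤
      3 * (7 + K) * ∫ u, |u| ^ 3 ∂ρ + κ * ∫ u, u ^ 2 ∂ρ := by
  have hρ2 : MemLp id 2 ρ := hρ.mono_exponent (by norm_num)
  have hi1 : Integrable (fun u : ℝ => u) ρ := hρ.integrable (by norm_num)
  have hi2 : Integrable (fun u : ℝ => u ^ 2) ρ := hρ2.integrable_sq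
  have hi3 : Integrable (fun u : ℝ => |u| ^ 3) ρ := hρ.integrable_norm_pow (by norm_num)
  have mD := measurable_steinDer z
  have mS := (continuous_steinSol z).measurable
  set T := η.prod (ρ.prod ρ) with hT
  have hDI : Integrable (fun p : ℝ × ℝ => steinDer z (p.1 + p.2)) (η.prod ρ) :=
    (integrable_const (2 : ℝ)).mono (mD.comp (by fun_prop)).aestronglyMeasurable
      (ae_of_all _ fun p => by simpa using abs_steinDer_le z _)
  have e1 : (∫ u, u ^ 2 ∂ρ) * ∫ p, steinDer z (p.1 + p.2) ∂(η.prod ρ) =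
      ∫ q, q.2.2 ^ 2 * steinDer z (q.1 + q.2.1) ∂T := by
    rw [mul_comm, ← integral_prod_mul (fun p : ℝ × ℝ => steinDer z (p.1 + p.2))
      (fun u : ℝ => u ^ 2)]
    rw [hT, ← (measurePreserving_prodAssoc η ρ ρ).integral_comp'
      (g := fun q : ℝ × ℝ × ℝ => q.2.2 ^ 2 * steinDer z (q.1 + q.2.1))]
    exact integral_congr_ae (ae_of_all _ fun p => mul_comm _ _)
  have e2 : ∫ p, p.2 * steinSol z (p.1 + p.2) ∂(η.prod ρ) =
      ∫ q, q.2.2 * steinSol z (q.1 + q.2.2) ∂T := by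
    have mp : MeasurePreserving (Prod.map id Prod.snd : ℝ × ℝ × ℝ → ℝ × ℝ) T (η.prod ρ) :=
      (MeasurePreserving.id η).prod measurePreserving_snd
    rw [← mp.map_eq, integral_map mp.measurable.aemeasurable
      (Measurable.aestronglyMeasurable (by fun_prop))]
    rfl
  have e3 : ∫ q, q.2.2 * steinSol z q.1 ∂T = 0 := by
    have := integral_prod_mul (μ := η) (ν := ρ.prod ρ) (steinSol z) (fun q => q.2)
    have h2 : ∫ q : ℝ × ℝ, q.2 ∂(ρ.prod ρ) = 0 := by
      rw [integral_fun_snd (fun u : ℝ => u), h0, smul_zero]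
    rw [h2, mul_zero] at this
    rw [← this]
    exact integral_congr_ae (ae_of_all _ fun p => mul_comm _ _)
  have j1 : Integrable (fun q : ℝ × ℝ × ℝ => q.2.2) T := (hi1.comp_snd ρ).comp_snd η
  have j2 : Integrable (fun q : ℝ × ℝ × ℝ => q.2.2 ^ 2) T := (hi2.comp_snd ρ).comp_snd η
  have i1 : Integrable (fun q : ℝ × ℝ × ℝ => q.2.2 ^ 2 * steinDer z (q.1 + q.2.1)) T :=
    j2.mul_bdd (c := 2) (mD.comp (by fun_prop)).aestronglyMeasurable
      (ae_of_all _ fun q => abs_steinDer_le z _)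
  have i2 : Integrable (fun q : ℝ × ℝ × ℝ => q.2.2 * steinSol z (q.1 + q.2.2)) T :=
    j1.mul_bdd (c := 5) (mS.comp (by fun_prop)).aestronglyMeasurable
      (ae_of_all _ fun q => abs_steinSol_le z _)
  have i3 : Integrable (fun q : ℝ × ℝ × ℝ => q.2.2 * steinSol z q.1) T :=
    j1.mul_bdd (c := 5) (mS.comp (by fun_prop)).aestronglyMeasurable
      (ae_of_all _ fun q => abs_steinSol_le z _)
  have e4 : (∫ u, u ^ 2 ∂ρ) * ∫ p, steinDer z (p.1 + p.2) ∂(η.prod ρ) -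
        ∫ p, p.2 * steinSol z (p.1 + p.2) ∂(η.prod ρ) =
      ∫ q, -(q.2.2 * (steinSol z (q.1 + q.2.2) - steinSol z q.1 -
        q.2.2 * steinDer z (q.1 + q.2.1))) ∂T := by
    have : ∀ q : ℝ × ℝ × ℝ, -(q.2.2 * (steinSol z (q.1 + q.2.2) - steinSol z q.1 -
        q.2.2 * steinDer z (q.1 + q.2.1))) = q.2.2 ^ 2 * steinDer z (q.1 + q.2.1) -
        (q.2.2 * steinSol z (q.1 + q.2.2) - q.2.2 * steinSol z q.1) := fun q => by ring
    simp_rw [this]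
    rw [integral_sub i1 (i2.sub' i3), integral_sub i2 i3, e1, e2, e3, sub_zero]
  -- Integrated over two copies of the same law, this gives three times the third absolute moment.
  have hcube : ∀ u v : ℝ, v ^ 2 * (|u| + |v|) ≤ |u| ^ 3 + 2 * |v| ^ 3 := fun u v => by
    rw [← sq_abs v]
    have hu := abs_nonneg u
    have hv := abs_nonneg v
    rcases le_total |u| |v| with h | h
    · have : |v| ^ 2 * |u| ≤ |v| ^ 2 * |v| := by gcongr
      have : 0 ≤ |u| ^ 3 := by positivity
      nlinarith
    · have : |v| ^ 2 * |u| ≤ |u| ^ 2 * |u| := by gcongr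
      have : 0 ≤ |v| ^ 3 := by positivity
      nlinarith
  have k1 : Integrable (fun p : ℝ × ℝ => |p.1| ^ 3 + 2 * |p.2| ^ 3) (ρ.prod ρ) :=
    (hi3.comp_fst ρ).add ((hi3.comp_snd ρ).const_mul 2)
  have k2 : Integrable (fun p : ℝ × ℝ => p.2 ^ 2 * (|p.1| + |p.2|)) (ρ.prod ρ) :=
    k1.mono (Measurable.aestronglyMeasurable (by fun_prop)) (ae_of_all _ fun p => by
      rw [Real.norm_eq_abs, Real.norm_eq_abs, abs_of_nonneg (by positivity)]
      exact (hcube _ _).trans (le_abs_self _))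
  have k3 : Integrable (fun w : ℝ => 2 * |w| + 5) η := (hη.abs.const_mul 2).add (integrable_const _)
  have b1 : Integrable (fun q : ℝ × ℝ × ℝ =>
      q.2.2 ^ 2 * ((2 * |q.1| + 5) * (|q.2.1| + |q.2.2|))) T := by
    refine (k3.mul_prod k2).congr (ae_of_all _ fun q => ?_)
    simp only; ring
  have mE : MeasurableSet {q : ℝ × ℝ × ℝ | |q.1 - z| ≤ |q.2.1| + |q.2.2|} :=
    measurableSet_le (by fun_prop) (by fun_prop)
  have b2 : Integrable (fun q : ℝ × ℝ × ℝ => q.2.2 ^ 2 *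
      {q : ℝ × ℝ × ℝ | |q.1 - z| ≤ |q.2.1| + |q.2.2|}.indicator 1 q) T :=
    j2.mul_bdd (c := 1) ((measurable_const.indicator mE).aestronglyMeasurable)
      (ae_of_all _ fun q => by
        by_cases h : q ∈ {q : ℝ × ℝ × ℝ | |q.1 - z| ≤ |q.2.1| + |q.2.2|} <;> simp [h])
  have c1 : ∫ q, q.2.2 ^ 2 * ((2 * |q.1| + 5) * (|q.2.1| + |q.2.2|)) ∂T ≤
      7 * ∫ p, p.2 ^ 2 * (|p.1| + |p.2|) ∂(ρ.prod ρ) := by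
    have e : ∫ q, q.2.2 ^ 2 * ((2 * |q.1| + 5) * (|q.2.1| + |q.2.2|)) ∂T =
        (∫ w, (2 * |w| + 5) ∂η) * ∫ p, p.2 ^ 2 * (|p.1| + |p.2|) ∂(ρ.prod ρ) := by
      rw [← integral_prod_mul]
      refine integral_congr_ae (ae_of_all _ fun q => ?_)
      simp only; ring
    have e5 : ∫ w, (2 * |w| + 5) ∂η = 2 * ∫ w, |w| ∂η + 5 := by
      have hη2 : Integrable (fun w : ℝ => 2 * |w|) η := hη.abs.const_mul 2
      rw [integral_add hη2 (integrable_const _), integral_const_mul]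
      simp
    rw [e, e5]
    refine mul_le_mul_of_nonneg_right (by linarith) (integral_nonneg fun p => ?_)
    simp only [Pi.zero_apply]; positivity
  have c2 : ∫ q, q.2.2 ^ 2 * {q : ℝ × ℝ × ℝ | |q.1 - z| ≤ |q.2.1| + |q.2.2|}.indicator 1 q ∂T ≤
      κ * ∫ u, u ^ 2 ∂ρ + K * ∫ p, p.2 ^ 2 * (|p.1| + |p.2|) ∂(ρ.prod ρ) := by
    have e : κ * ∫ u, u ^ 2 ∂ρ + K * ∫ p, p.2 ^ 2 * (|p.1| + |p.2|) ∂(ρ.prod ρ) =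
        ∫ p, (κ * p.2 ^ 2 + K * (p.2 ^ 2 * (|p.1| + |p.2|))) ∂(ρ.prod ρ) := by
      rw [integral_add ((hi2.comp_snd ρ).const_mul κ) (k2.const_mul K), integral_const_mul,
        integral_const_mul, integral_fun_snd (fun u : ℝ => u ^ 2)]
      simp
    rw [e, hT, integral_prod_symm _ b2]
    refine integral_mono b2.integral_prod_right
      (((hi2.comp_snd ρ).const_mul κ).add (k2.const_mul K)) fun p => ?_
    simp only
    rw [integral_const_mul]
    have : ∫ w, {q : ℝ × ℝ × ℝ | |q.1 - z| ≤ |q.2.1| + |q.2.2|}.indicator (1 : ℝ × ℝ × ℝ → ℝ)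
        (w, p) ∂η = η.real {w | |w - z| ≤ |p.1| + |p.2|} := by
      rw [← integral_indicator_one (measurableSet_le (by fun_prop) (by fun_prop))]
      rfl
    rw [this]
    have := hK (|p.1| + |p.2|) (by positivity)
    nlinarith [mul_le_mul_of_nonneg_left this (sq_nonneg p.2)]
  have c3 : ∫ p, p.2 ^ 2 * (|p.1| + |p.2|) ∂(ρ.prod ρ) ≤ 3 * ∫ u, |u| ^ 3 ∂ρ := by
    refine (integral_mono k2 k1 fun p => hcube p.1 p.2).trans_eq ?_
    rw [integral_add (hi3.comp_fst ρ) ((hi3.comp_snd ρ).const_mul 2), integral_const_mul,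
      integral_fun_fst (fun u : ℝ => |u| ^ 3), integral_fun_snd (fun u : ℝ => |u| ^ 3)]
    simp; ring
  rw [e4]
  refine (abs_integral_le_integral_abs).trans ?_
  refine (integral_mono_of_nonneg (ae_of_all _ fun _ => abs_nonneg _) (b1.add b2)
    (ae_of_all _ fun q => ?_)).trans ?_
  · simp only [abs_neg, Pi.add_apply]
    rw [abs_mul]
    have h1 := mul_le_mul_of_nonneg_left (abs_steinSol_taylor_le z q.1 q.2.1 q.2.2)
      (abs_nonneg q.2.2)
    refine h1.trans_eq ?_
    have : (if |q.1 - z| ≤ |q.2.1| + |q.2.2| then (1 : ℝ) else 0) =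
      {q : ℝ × ℝ × ℝ | |q.1 - z| ≤ |q.2.1| + |q.2.2|}.indicator 1 q := by
      simp [indicator_apply]
    rw [this, ← sq_abs q.2.2]
    ring
  · rw [integral_add' b1 b2]
    nlinarith [mul_le_mul_of_nonneg_left c3 (by linarith : 0 ≤ 7 + K)]

variable {Ω ι : Type*} [MeasurableSpace Ω] {P : Measure Ω} [IsProbabilityMeasure P] [Fintype ι]

/-- With a = n^(-1/2), so that E u² = a², one has E|u| ≤ a and a³ ≤ E|u|³, while n a³ = a. Both
inequalities come from tangents at |u| = a instead of Hölder's inequality. -/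
lemma sq_le_of_cube {ρ : Measure ℝ} [IsProbabilityMeasure ρ] (hρ : MemLp id 3 ρ) {n : ℝ}
    (hn : 0 < n) (h1 : n * ∫ u, u ^ 2 ∂ρ = 1) :
    ∫ u, |u| ∂ρ ≤ n * ∫ u, |u| ^ 3 ∂ρ := by
  have hi1 : Integrable (fun u : ℝ => |u|) ρ := (hρ.integrable (by norm_num)).abs
  have hi2 : Integrable (fun u : ℝ => u ^ 2) ρ := (hρ.mono_exponent (by norm_num)).integrable_sq
  have hi3 : Integrable (fun u : ℝ => |u| ^ 3) ρ := hρ.integrable_norm_pow (by norm_num)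
  have h2 : ∫ u, u ^ 2 ∂ρ = 1 / n := by field_simp; linarith
  set a := √n⁻¹ with ha
  have ha2 : a ^ 2 = 1 / n := by rw [ha, Real.sq_sqrt (by positivity), one_div]
  have ha0 : 0 < a := by positivity
  have hna : n = 1 / a ^ 2 := by rw [ha2]; simp
  have k1 : ∫ u, |u| ∂ρ ≤ a := by
    have : ∫ u, |u| ∂ρ ≤ ∫ u, (u ^ 2 / a + a) / 2 ∂ρ := by
      refine integral_mono hi1 (((hi2.div_const a).add (integrable_const a)).div_const 2)
        fun u => ?_
      have : 0 ≤ (|u| - a) ^ 2 / a := by positivity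
      have e : (|u| - a) ^ 2 / a = u ^ 2 / a + a - 2 * |u| := by
        rw [← sq_abs u]; field_simp; ring
      simp only
      linarith
    rw [integral_div, integral_add (hi2.div_const a) (integrable_const a), integral_div, h2,
      ← ha2] at this
    have e : a ^ 2 / a = a := by field_simp
    simp [e] at this
    linarith
  have k2 : a ^ 3 ≤ ∫ u, |u| ^ 3 ∂ρ := by
    have : ∫ u, (3 / 2 * a * u ^ 2 - a ^ 3 / 2) ∂ρ ≤ ∫ u, |u| ^ 3 ∂ρ := by
      refine integral_mono ((hi2.const_mul _).sub (integrable_const _)) hi3 fun u => ?_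
      have : 0 ≤ (|u| - a) ^ 2 * (|u| + a / 2) := by positivity
      simp only
      rw [← sq_abs u]
      nlinarith
    rw [integral_sub (hi2.const_mul _) (integrable_const _), integral_const_mul, h2, ← ha2] at this
    simp at this
    nlinarith
  refine k1.trans ?_
  rw [hna, div_mul_eq_mul_div, one_mul, le_div_iff₀ (by positivity)]
  nlinarith

/-- The Berry-Esseen theorem for sums of independent identically distributed variables. -/
theorem berry_esseen {ξ : ι → Ω → ℝ} {ρ : Measure ℝ} [IsProbabilityMeasure ρ]
    (hm : ∀ i, Measurable (ξ i)) (hind : iIndepFun ξ P) (hlaw : ∀ i, P.map (ξ i) = ρ)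
    (hρ : MemLp id 3 ρ) (h0 : ∫ u, u ∂ρ = 0) (h1 : Fintype.card ι * ∫ u, u ^ 2 ∂ρ = 1)
    {γ : ℝ} (hγ : Fintype.card ι * ∫ u, |u| ^ 3 ∂ρ = γ) (hγ0 : 0 < γ) (z : ℝ) :
    |P.real {ω | ∑ i, ξ i ω ≤ z} - stdCdf z| ≤ 47 * γ := by
  classical
  set W : Ω → ℝ := fun ω => ∑ i, ξ i ω with hW
  set V : ι → Ω → ℝ := fun i ω => W ω - ξ i ω with hV
  have hmp : ∀ i, MeasurePreserving (ξ i) P ρ := fun i => ⟨hm i, hlaw i⟩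
  have hL : ∀ i, MemLp (ξ i) 3 P := fun i => hρ.comp_measurePreserving (hmp i)
  have hL2 : ∀ i, MemLp (ξ i) 2 P := fun i => (hL i).mono_exponent (by norm_num)
  have hρ1 : Integrable id ρ := hρ.integrable (by norm_num)
  have tr : ∀ (f : ℝ → ℝ), Measurable f → ∀ i, ∫ ω, f (ξ i ω) ∂P = ∫ u, f u ∂ρ := fun f hf i => by
    rw [← hlaw i, integral_map (hm i).aemeasurable hf.aestronglyMeasurable]
  have g0 : ∀ i, ∫ ω, ξ i ω ∂P = 0 := fun i => (tr id measurable_id i).trans h0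
  have g1 : ∑ i, ∫ ω, ξ i ω ^ 2 ∂P = 1 := by
    rw [Finset.sum_congr rfl fun i _ => tr (fun u => u ^ 2) (by fun_prop) i]
    simpa using h1
  have g3 : ∑ i, ∫ ω, |ξ i ω| ^ 3 ∂P = γ := by
    rw [Finset.sum_congr rfl fun i _ => tr (fun u => |u| ^ 3) (by fun_prop) i]
    simpa using hγ
  have hn : (0 : ℝ) < Fintype.card ι := by
    rcases (Nat.cast_nonneg (α := ℝ) (Fintype.card ι)).lt_or_eq with h | h
    · exact h
    · rw [← h] at h1; simp at h1
  have hWm : Measurable W := Finset.measurable_sum _ fun i _ => hm i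
  have hWL : MemLp W 2 P := memLp_finsetSum _ fun i _ => hL2 i
  have hVm : ∀ i, Measurable (V i) := fun i => hWm.sub (hm i)
  have hVL : ∀ i, MemLp (V i) 2 P := fun i => hWL.sub (hL2 i)
  have hWsq : ∫ ω, W ω ^ 2 ∂P = 1 := by rw [integral_sum_sq hL2 hind g0, g1]
  have hVe : ∀ i, V i = ∑ j ∈ Finset.univ.erase i, ξ j := by
    intro i
    ext ω
    simp only [hV, hW, Finset.sum_apply]
    rw [← Finset.add_sum_erase _ _ (Finset.mem_univ i), add_sub_cancel_left]
  have hVi : ∀ i, IndepFun (V i) (ξ i) P := fun i => by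
    have := hind.indepFun_finsetSum_of_notMem hm (s := Finset.univ.erase i) (i := i) (by simp)
    rw [hVe]
    exact this
  -- concentration for the full sum
  have conc : ∀ c s, 0 ≤ s → P.real {ω | |W ω - c| ≤ s} ≤ 2 * γ + 2 * s := by
    intro c s hs
    have := concentration hm hL hind g0 g1 g3 hγ0 (c := fun _ => c) (D := fun _ => s)
      (D' := fun _ _ => s) measurable_const (memLp_const s) measurable_const
      (fun _ => memLp_const s) (fun _ => measurable_const) (fun i =>
        (hVi i).symm.comp measurable_id (measurable_id.prodMk measurable_const))
    simp only [sub_self, mul_zero, abs_zero, integral_const, smul_zero, Finset.sum_const_zero,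
      add_zero, abs_of_nonneg hs] at this
    refine this.trans ?_
    have h2 : ∫ ω, |(∑ i, ξ i ω) * s| ∂P ≤ s := by
      simp_rw [abs_mul, abs_of_nonneg hs]
      rw [integral_mul_const]
      nlinarith [integral_abs_le_one hWL hWsq.le]
    linarith
  -- Markov's inequality, since E|ξ_i| ≤ γ by `sq_le_of_cube`.
  have hsmall : ∀ i, 1 / 2 ≤ P.real {ω | |ξ i ω| ≤ 2 * γ} := by
    intro i
    have h2 := mul_meas_ge_le_integral_of_nonneg (μ := P) (f := fun ω => |ξ i ω|)
      (ae_of_all _ fun _ => abs_nonneg _) ((hL i).integrable (by norm_num)).abs (2 * γ)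
    rw [tr (fun u => |u|) (by fun_prop) i] at h2
    have h3 := h2.trans ((sq_le_of_cube hρ hn h1).trans_eq hγ)
    have h4 : P.real {ω | 2 * γ ≤ |ξ i ω|} ≤ 1 / 2 := by
      by_contra hcon
      rw [not_le] at hcon
      nlinarith
    have h5 : (1 : ℝ) ≤ P.real {ω | |ξ i ω| ≤ 2 * γ} + P.real {ω | 2 * γ ≤ |ξ i ω|} := by
      rw [← probReal_univ (μ := P)]
      refine (measureReal_mono ?_).trans (measureReal_union_le _ _)
      intro ω _
      rcases le_total |ξ i ω| (2 * γ) with h | h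
      · exact Or.inl h
      · exact Or.inr h
    linarith
  -- The sum without ξ_i inherits concentration from W: independently of V_i, the summand is at most
  -- 2γ in absolute value with probability at least 1/2. Hence twice the bound 2γ + 2(s + 2γ).
  have concV : ∀ i c s, 0 ≤ s → P.real {ω | |V i ω - c| ≤ s} ≤ 12 * γ + 4 * s := by
    intro i c s hs
    have h2 : P.real ({ω | |V i ω - c| ≤ s} ∩ {ω | |ξ i ω| ≤ 2 * γ}) =
        P.real {ω | |V i ω - c| ≤ s} * P.real {ω | |ξ i ω| ≤ 2 * γ} := by
      have := (hVi i).measure_inter_preimage_eq_mul {v | |v - c| ≤ s} {u | |u| ≤ 2 * γ}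
        (measurableSet_le (by fun_prop) (by fun_prop))
        (measurableSet_le (by fun_prop) (by fun_prop))
      simp only [measureReal_def]
      rw [← ENNReal.toReal_mul]
      exact congrArg _ this
    have h3 : P.real ({ω | |V i ω - c| ≤ s} ∩ {ω | |ξ i ω| ≤ 2 * γ}) ≤
        P.real {ω | |W ω - c| ≤ s + 2 * γ} := by
      refine measureReal_mono ?_
      rintro ω ⟨ha, hb⟩
      simp only [mem_ofPred_eq] at *
      have : W ω - c = (V i ω - c) + ξ i ω := by simp only [hV]; ring
      rw [this]
      exact (abs_add_le _ _).trans (add_le_add ha hb)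
    have h4 := conc c (s + 2 * γ) (by positivity)
    have h5 := hsmall i
    have h6 : 0 ≤ P.real {ω | |V i ω - c| ≤ s} := measureReal_nonneg
    nlinarith
  -- the law of the sum as a convolution
  set η : ι → Measure ℝ := fun i => P.map (V i) with hη
  have hηp : ∀ i, IsProbabilityMeasure (η i) := fun i =>
    Measure.isProbabilityMeasure_map (hVm i).aemeasurable
  have hpair : ∀ i, MeasurePreserving (fun ω => (V i ω, ξ i ω)) P ((η i).prod ρ) := fun i =>
    ⟨(hVm i).prodMk (hm i), by
      rw [(indepFun_iff_map_prod_eq_prod_map_map (hVm i).aemeasurable (hm i).aemeasurable).1 (hVi i),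
        hlaw i]⟩
  have trp : ∀ i (f : ℝ × ℝ → ℝ), Measurable f →
      ∫ p, f p ∂((η i).prod ρ) = ∫ ω, f (V i ω, ξ i ω) ∂P := fun i f hf => by
    rw [← (hpair i).map_eq, integral_map (hpair i).measurable.aemeasurable hf.aestronglyMeasurable]
  have mD := measurable_steinDer z
  have mS := (continuous_steinSol z).measurable
  have hVsq : ∀ i, ∫ ω, |V i ω| ∂P ≤ 1 := fun i => by
    refine integral_abs_le_one (hVL i) ?_
    have hsub : iIndepFun (fun j : (Finset.univ.erase i : Finset ι) => ξ j) P :=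
      hind.precomp Subtype.val_injective
    have := integral_sum_sq (fun j : (Finset.univ.erase i : Finset ι) => hL2 j) hsub (fun j => g0 j)
    have e : ∀ ω, V i ω = ∑ j : (Finset.univ.erase i : Finset ι), ξ j ω := fun ω => by
      rw [Finset.sum_coe_sort (Finset.univ.erase i) fun j => ξ j ω]
      simp only [hV, hW]
      rw [← Finset.add_sum_erase _ _ (Finset.mem_univ i), add_sub_cancel_left]
    simp_rw [e]
    rw [this, Finset.sum_coe_sort (Finset.univ.erase i) fun j => ∫ ω, ξ j ω ^ 2 ∂P, ← g1]
    exact Finset.sum_le_sum_of_subset_of_nonneg (Finset.subset_univ _)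
      fun j _ _ => integral_nonneg fun ω => sq_nonneg _
  have step : ∀ i, |(∫ u, u ^ 2 ∂ρ) * ∫ ω, steinDer z (W ω) ∂P - ∫ ω, ξ i ω * steinSol z (W ω) ∂P| ≤
      33 * ∫ u, |u| ^ 3 ∂ρ + 12 * γ * ∫ u, u ^ 2 ∂ρ := by
    intro i
    have := abs_stein_step_le (η := η i) (z := z) (K := 4) (κ := 12 * γ) hρ h0 ?_ ?_ ?_ (by norm_num)
    · rw [trp i (fun p => steinDer z (p.1 + p.2)) (mD.comp (by fun_prop)),
        trp i (fun p => p.2 * steinSol z (p.1 + p.2))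
          (measurable_snd.mul (mS.comp (by fun_prop)))] at this
      have e : ∀ ω, V i ω + ξ i ω = W ω := fun ω => by simp [hV]
      simp only [e] at this
      norm_num at this
      exact this
    · exact (integrable_map_measure aestronglyMeasurable_id (hVm i).aemeasurable).2
        ((hVL i).integrable (by norm_num))
    · rw [integral_map (hVm i).aemeasurable (Measurable.aestronglyMeasurable (by fun_prop))]
      exact hVsq i
    · intro s hs
      rw [map_measureReal_apply (hVm i) (measurableSet_le (by fun_prop) (by fun_prop))]
      exact concV i z s hs
  have hiD : Integrable (fun ω => steinDer z (W ω)) P :=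
    (integrable_const (2 : ℝ)).mono (mD.comp hWm).aestronglyMeasurable
      (ae_of_all _ fun p => by simpa using abs_steinDer_le z _)
  have hiS : ∀ i, Integrable (fun ω => ξ i ω * steinSol z (W ω)) P := fun i =>
    ((hL2 i).integrable (by norm_num)).mul_bdd (c := 5) (mS.comp hWm).aestronglyMeasurable
      (ae_of_all _ fun q => abs_steinSol_le z _)
  -- The variances add up to 1, so E f'(W) splits evenly over the summands. The constant is 33 + 12.
  have tot : |∫ ω, steinDer z (W ω) ∂P - ∫ ω, W ω * steinSol z (W ω) ∂P| ≤ 45 * γ := by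
    have e1 : ∫ ω, W ω * steinSol z (W ω) ∂P = ∑ i, ∫ ω, ξ i ω * steinSol z (W ω) ∂P := by
      rw [← integral_finsetSum _ fun i _ => hiS i]
      simp only [hW, Finset.sum_mul]
    have e2 : ∫ ω, steinDer z (W ω) ∂P = ∑ _i : ι, (∫ u, u ^ 2 ∂ρ) * ∫ ω, steinDer z (W ω) ∂P := by
      rw [Finset.sum_const, nsmul_eq_mul, ← mul_assoc]
      simp [h1]
    rw [e1, e2, ← Finset.sum_sub_distrib]
    refine (Finset.abs_sum_le_sum_abs _ _).trans ((Finset.sum_le_sum fun i _ => step i).trans_eq ?_)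
    rw [Finset.sum_const, nsmul_eq_mul, Finset.card_univ]
    linear_combination 33 * hγ + 12 * γ * h1
  have hlt : |P.real {ω | W ω < z} - stdCdf z| ≤ 45 * γ := by
    have hiWS : Integrable (fun ω => W ω * steinSol z (W ω)) P :=
      (hWL.integrable (by norm_num)).mul_bdd (c := 5) (mS.comp hWm).aestronglyMeasurable
        (ae_of_all _ fun q => abs_steinSol_le z _)
    have hms : MeasurableSet {ω | W ω < z} := measurableSet_lt hWm measurable_const
    rw [← integral_sub hiD hiWS] at tot
    have e : ∫ ω, (steinDer z (W ω) - W ω * steinSol z (W ω)) ∂P =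
        ∫ ω, ({ω | W ω < z}.indicator 1 ω - stdCdf z) ∂P := by
      refine integral_congr_ae (ae_of_all _ fun ω => ?_)
      simp only [steinDer, indicator_apply, mem_ofPred_eq, Pi.one_apply]
      by_cases h : z ≤ W ω
      · rw [if_pos h, if_neg (not_lt.2 h)]; ring
      · rw [if_neg h, if_pos (not_le.1 h)]; ring
    have hi1 : Integrable ({ω | W ω < z}.indicator (1 : Ω → ℝ)) P :=
      (integrable_const (1 : ℝ)).indicator hms
    rw [e, integral_sub hi1 (integrable_const _),
      integral_indicator_one hms] at tot
    simpa using tot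
  -- Stein's equation was solved for the open half-line; a possible atom at z adds the last 2γ.
  have heq := conc z 0 le_rfl
  have h6 : P.real {ω | W ω ≤ z} ≤ P.real {ω | W ω < z} + P.real {ω | |W ω - z| ≤ 0} := by
    refine (measureReal_mono ?_).trans (measureReal_union_le _ _)
    intro ω hω
    rcases lt_or_eq_of_le (show W ω ≤ z from hω) with h | h
    · exact Or.inl h
    · right; simp [h]
  have h7 : P.real {ω | W ω < z} ≤ P.real {ω | W ω ≤ z} :=
    measureReal_mono fun ω hω => le_of_lt (show W ω < z from hω)
  rw [abs_le] at hlt ⊢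
  constructor <;> linarith [hlt.1, hlt.2]

end BerryEsseen

/-! ### Covariances of a symmetric kernel at overlapping index sets. -/

section ProductSpace

variable {M : Type*} [MeasurableSpace M] (μ : Measure M) [IsProbabilityMeasure μ]

lemma integral_comp_measurePreserving {α β : Type*} [MeasurableSpace α] [MeasurableSpace β]
    {ν : Measure α} {ν' : Measure β} {f : α → β} (hf : MeasurePreserving f ν ν') {g : β → ℝ}
    (hg : Measurable g) : ∫ x, g (f x) ∂ν = ∫ y, g y ∂ν' := by
  rw [← hf.map_eq, integral_map hf.measurable.aemeasurable hg.aestronglyMeasurable]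

lemma iIndepFun_eval {κ : Type*} [Fintype κ] :
    iIndepFun (fun (k : κ) (x : κ → M) => x k) (Measure.pi fun _ : κ => μ) :=
  iIndepFun_pi (X := fun _ x => x) fun _ => aemeasurable_id

lemma measurePreserving_comp_injective {κ κ' : Type*} [Fintype κ] [Fintype κ'] {σ : κ' → κ}
    (hσ : Function.Injective σ) :
    MeasurePreserving (fun (x : κ → M) (j : κ') => x (σ j)) (Measure.pi fun _ => μ)
      (Measure.pi fun _ => μ) := by
  refine ⟨by fun_prop, ?_⟩
  have h := (iIndepFun_eval μ (κ := κ)).precomp hσ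
  rw [iIndepFun_iff_map_fun_eq_pi_map (fun i => (measurable_pi_apply _).aemeasurable)] at h
  rw [h]
  congr
  ext i : 1
  exact (measurePreserving_eval (fun _ : κ => μ) (σ i)).map_eq

lemma measurePreserving_prodMk_comp {κ A B : Type*} [Fintype κ] [Fintype A] [Fintype B]
    {σ : A → κ} {τ : B → κ} (hσ : Function.Injective (Sum.elim σ τ)) :
    MeasurePreserving (fun x : κ → M => ((fun a => x (σ a)), fun b => x (τ b)))
      (Measure.pi fun _ => μ) ((Measure.pi fun _ => μ).prod (Measure.pi fun _ => μ)) :=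
  (measurePreserving_sumPiEquivProdPi (X := fun _ : A ⊕ B => M) fun _ => μ).comp
    (measurePreserving_comp_injective μ hσ)

lemma measurePreserving_triple {A B : Type*} [Fintype A] [Fintype B] :
    MeasurePreserving (fun x : A ⊕ (B ⊕ B) → M =>
        ((fun a => x (.inl a)), (fun b => x (.inr (.inl b))), fun b => x (.inr (.inr b))))
      (Measure.pi fun _ => μ)
      ((Measure.pi fun _ => μ).prod ((Measure.pi fun _ => μ).prod (Measure.pi fun _ => μ))) :=
  ((MeasurePreserving.id _).prod
    (measurePreserving_sumPiEquivProdPi (X := fun _ : B ⊕ B => M) fun _ => μ)).comp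
    (measurePreserving_sumPiEquivProdPi (X := fun _ : A ⊕ (B ⊕ B) => M) fun _ => μ)

/-- Given a, the two factors are independent with the same law, so the product integrates to the
square of the conditional mean. All non-negativity of covariances used later comes from this. -/
lemma integral_mul_condIndep {α β : Type*} [MeasurableSpace α] [MeasurableSpace β]
    {ν : Measure α} {ν' : Measure β} [IsProbabilityMeasure ν] [IsProbabilityMeasure ν']
    {F : α × β → ℝ} (hF : MemLp F 2 (ν.prod ν')) :
    ∫ q, F (q.1, q.2.1) * F (q.1, q.2.2) ∂(ν.prod (ν'.prod ν')) =
      ∫ a, (∫ b, F (a, b) ∂ν') ^ 2 ∂ν := by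
  have m1 : MeasurePreserving (fun q : α × β × β => (q.1, q.2.1)) (ν.prod (ν'.prod ν'))
      (ν.prod ν') := (MeasurePreserving.id ν).prod measurePreserving_fst
  have m2 : MeasurePreserving (fun q : α × β × β => (q.1, q.2.2)) (ν.prod (ν'.prod ν'))
      (ν.prod ν') := (MeasurePreserving.id ν).prod measurePreserving_snd
  have hi : Integrable (fun q : α × β × β => F (q.1, q.2.1) * F (q.1, q.2.2))
      (ν.prod (ν'.prod ν')) :=
    (hF.comp_measurePreserving m1).integrable_mul (hF.comp_measurePreserving m2)
  rw [integral_prod _ hi]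
  refine integral_congr_ae (ae_of_all _ fun a => ?_)
  simp only
  rw [integral_prod_mul (fun b => F (a, b)) (fun b => F (a, b)), sq]

/-- Assemble a point of `κ → M` from its coordinates with and without the property `p`. -/
def assemble {κ : Type*} (p : κ → Prop) [DecidablePred p] (y : {j // ¬p j} → M)
    (b : {j // p j} → M) (j : κ) : M :=
  if hj : p j then b ⟨j, hj⟩ else y ⟨j, hj⟩

variable {μ}

/-- The second moment of the partial integral of `h` over the coordinates with property `p`. -/
noncomputable def partialSq (μ : Measure M) {m : ℕ} (h : (Fin m → M) → ℝ) (p : Fin m → Prop)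
    [DecidablePred p] : ℝ :=
  ∫ y, (∫ b, h (assemble p y b) ∂Measure.pi fun _ : {j // p j} => μ) ^ 2
    ∂Measure.pi fun _ : {j // ¬p j} => μ

lemma measurePreserving_assemble {m : ℕ} (p : Fin m → Prop) [DecidablePred p] :
    MeasurePreserving (fun q : ({j // ¬p j} → M) × ({j // p j} → M) => assemble p q.1 q.2)
      ((Measure.pi fun _ => μ).prod (Measure.pi fun _ => μ)) (Measure.pi fun _ => μ) :=
  ((measurePreserving_piEquivPiSubtypeProd (fun _ : Fin m => μ) p).symm).comp
    Measure.measurePreserving_swap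

/-- The hypotheses say that the two index maps agree off p and share no other value, so the
variables involved are a common block and two disjoint private blocks. -/
lemma integral_comp_mul_comp_eq_partialSq {κ : Type*} [Fintype κ] {m : ℕ} {h : (Fin m → M) → ℝ}
    (hL : MemLp h 2 (Measure.pi fun _ => μ)) (hhm : Measurable h) (p : Fin m → Prop)
    [DecidablePred p] {I J : Fin m → κ} (hI : Function.Injective I) (hJ : Function.Injective J)
    (h1 : ∀ j, ¬p j → I j = J j) (h2 : ∀ i j, I i = J j → i = j ∧ ¬p i) :
    ∫ x, h (fun j => x (I j)) * h (fun j => x (J j)) ∂(Measure.pi fun _ : κ => μ) =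
      partialSq μ h p := by
  have hF : MemLp (fun q : ({j // ¬p j} → M) × ({j // p j} → M) => h (assemble p q.1 q.2)) 2
      ((Measure.pi fun _ => μ).prod (Measure.pi fun _ => μ)) :=
    hL.comp_measurePreserving (measurePreserving_assemble p)
  have hmF : Measurable fun q : ({j // ¬p j} → M) × ({j // p j} → M) =>
      h (assemble p q.1 q.2) := hhm.comp (measurePreserving_assemble (μ := μ) p).measurable
  rw [partialSq, ← integral_mul_condIndep hF]
  set σ : {j // ¬p j} ⊕ ({j // p j} ⊕ {j // p j}) → κ :=
    Sum.elim (fun j => I j) (Sum.elim (fun j => I j) fun j => J j) with hσ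
  have hinj : Function.Injective σ := by
    rintro (⟨a, ha⟩ | ⟨a, ha⟩ | ⟨a, ha⟩) (⟨b, hb⟩ | ⟨b, hb⟩ | ⟨b, hb⟩) hab <;>
      simp only [hσ, Sum.elim_inl, Sum.elim_inr] at hab
    · simpa using hI hab
    · exact absurd (hI hab ▸ hb) ha
    · exact absurd hb ((h2 _ _ hab).1 ▸ ha)
    · exact absurd (hI hab ▸ ha) hb
    · simpa using hI hab
    · exact absurd ha (h2 _ _ hab).2
    · exact absurd ha ((h2 _ _ hab.symm).1 ▸ hb)
    · exact absurd hb (h2 _ _ hab.symm).2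
    · simpa using hJ hab
  have mp := (measurePreserving_triple μ (A := {j // ¬p j}) (B := {j // p j})).comp
    (measurePreserving_comp_injective μ hinj)
  rw [← mp.map_eq, integral_map mp.measurable.aemeasurable]
  · refine integral_congr_ae (ae_of_all _ fun x => ?_)
    simp only [Function.comp, hσ, Sum.elim_inl, Sum.elim_inr]
    congr 1 <;> congr 1 <;> ext j <;> unfold assemble <;> split_ifs with hj
    · rfl
    · rfl
    · rfl
    · simp [h1 j hj]
  · exact ((hmF.comp (by fun_prop)).mul (hmF.comp (by fun_prop))).aestronglyMeasurable

/-- One enumeration of the common values by the positions off p is pulled back through I and through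
J, and each resulting partial injection is extended to a permutation. For symmetric kernels this
reduces any overlap to the aligned one. -/
lemma exists_perm_align {κ : Type*} [DecidableEq κ] {m : ℕ} {I J : Fin m → κ}
    (hI : Function.Injective I) (hJ : Function.Injective J) (p : Fin m → Prop) [DecidablePred p]
    (hc : (Finset.univ.image I ∩ Finset.univ.image J).card = Fintype.card {j // ¬p j}) :
    ∃ π₁ π₂ : Equiv.Perm (Fin m), (∀ j, ¬p j → I (π₁ j) = J (π₂ j)) ∧
      ∀ i j, I (π₁ i) = J (π₂ j) → i = j ∧ ¬p i := by
  classical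
  have key : ∀ {K : Fin m → κ}, Function.Injective K →
      (Finset.univ.image I ∩ Finset.univ.image J) ⊆ Finset.univ.image K →
      ∃ e : {j // K j ∈ Finset.univ.image I ∩ Finset.univ.image J} ≃
        {k // k ∈ Finset.univ.image I ∩ Finset.univ.image J}, ∀ j, (e j : κ) = K j := by
    intro K hK hs
    refine ⟨Equiv.ofBijective (fun j => ⟨K j, j.2⟩) ⟨fun a b hab => ?_, fun k => ?_⟩, fun j => rfl⟩
    · exact Subtype.ext (hK (congrArg Subtype.val hab))
    · obtain ⟨j, -, hj⟩ := Finset.mem_image.1 (hs k.2)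
      exact ⟨⟨j, hj ▸ k.2⟩, Subtype.ext hj⟩
  obtain ⟨eI, heI⟩ := key hI Finset.inter_subset_left
  obtain ⟨eJ, heJ⟩ := key hJ Finset.inter_subset_right
  have e0 : {j // ¬p j} ≃ {k // k ∈ Finset.univ.image I ∩ Finset.univ.image J} :=
    Fintype.equivOfCardEq (by rw [← hc, Fintype.card_coe])
  have q1 : ∀ j (hj : ¬p j), I ((e0.trans eI.symm).extendSubtype j) = e0 ⟨j, hj⟩ := fun j hj => by
    rw [Equiv.extendSubtype_apply_of_mem (e0.trans eI.symm) j hj, ← heI]; simp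
  have q2 : ∀ j (hj : ¬p j), J ((e0.trans eJ.symm).extendSubtype j) = e0 ⟨j, hj⟩ := fun j hj => by
    rw [Equiv.extendSubtype_apply_of_mem (e0.trans eJ.symm) j hj, ← heJ]; simp
  refine ⟨(e0.trans eI.symm).extendSubtype, (e0.trans eJ.symm).extendSubtype, fun j hj => ?_,
    fun i j hij => ?_⟩
  · rw [q1 j hj, q2 j hj]
  · have hmem : I ((e0.trans eI.symm).extendSubtype i) ∈
        Finset.univ.image I ∩ Finset.univ.image J :=
      Finset.mem_inter.2 ⟨Finset.mem_image_of_mem _ (Finset.mem_univ _),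
        hij ▸ Finset.mem_image_of_mem _ (Finset.mem_univ _)⟩
    have hi : ¬p i := fun hp =>
      (Equiv.extendSubtype_not_mem (e0.trans eI.symm) i (not_not.2 hp)) hmem
    have hj : ¬p j := fun hp =>
      (Equiv.extendSubtype_not_mem (e0.trans eJ.symm) j (not_not.2 hp)) (hij ▸ hmem)
    refine ⟨?_, hi⟩
    rw [q1 i hi, q2 j hj] at hij
    simpa using e0.injective (Subtype.ext hij)

/-- The covariance of `h(X_I)` and `h(X_J)` depends only on the size of `I ∩ J`. -/
lemma integral_comp_mul_comp_eq {κ : Type*} [Fintype κ] [DecidableEq κ] {m : ℕ}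
    {h : (Fin m → M) → ℝ} (hL : MemLp h 2 (Measure.pi fun _ => μ)) (hhm : Measurable h)
    (hs : IsSymmetricKernel h) (p : Fin m → Prop)
    [DecidablePred p] {I J : Fin m → κ} (hI : Function.Injective I) (hJ : Function.Injective J)
    (hc : (Finset.univ.image I ∩ Finset.univ.image J).card = Fintype.card {j // ¬p j}) :
    ∫ x, h (fun j => x (I j)) * h (fun j => x (J j)) ∂(Measure.pi fun _ : κ => μ) =
      partialSq μ h p := by
  obtain ⟨π₁, π₂, h1, h2⟩ := exists_perm_align hI hJ p hc
  rw [← integral_comp_mul_comp_eq_partialSq hL hhm p (hI.comp π₁.injective) (hJ.comp π₂.injective)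
    h1 h2]
  refine integral_congr_ae (ae_of_all _ fun x => ?_)
  simp only [Function.comp]
  rw [hs π₁ (fun j => x (I j)), hs π₂ (fun j => x (J j))]

/-- The covariance of `h(X_I)` and `h(X_J)` for index sets with `c` common elements. -/
noncomputable def overlapCov (μ : Measure M) {m : ℕ} (h : (Fin m → M) → ℝ) (c : ℕ) : ℝ :=
  partialSq μ h fun j : Fin m => c ≤ j.val

lemma card_not_le {m c : ℕ} (hc : c ≤ m) : Fintype.card {j : Fin m // ¬c ≤ j.val} = c := by
  have e : {j : Fin m // ¬c ≤ j.val} ≃ Fin c :=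
    { toFun := fun j => ⟨j.1.1, not_le.1 j.2⟩
      invFun := fun j => ⟨⟨j.1, j.2.trans_le hc⟩, not_le.2 j.2⟩
      left_inv := fun _ => rfl
      right_inv := fun _ => rfl }
  rw [Fintype.card_congr e, Fintype.card_fin]

lemma integral_comp_mul_comp {κ : Type*} [Fintype κ] [DecidableEq κ] {m : ℕ}
    {h : (Fin m → M) → ℝ} (hL : MemLp h 2 (Measure.pi fun _ => μ)) (hhm : Measurable h)
    (hs : IsSymmetricKernel h) {I J : Fin m → κ} (hI : Function.Injective I)
    (hJ : Function.Injective J) :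
    ∫ x, h (fun j => x (I j)) * h (fun j => x (J j)) ∂(Measure.pi fun _ : κ => μ) =
      overlapCov μ h (Finset.univ.image I ∩ Finset.univ.image J).card := by
  refine integral_comp_mul_comp_eq hL hhm hs _ hI hJ (card_not_le ?_).symm
  refine (Finset.card_le_card Finset.inter_subset_left).trans ?_
  exact Finset.card_image_le.trans (by simp)

/-- The choice of the c shared positions is immaterial: two index maps into two copies of `Fin m`
that meet exactly off p realize the overlap c. -/
lemma overlapCov_eq_partialSq {m c : ℕ}
    {h : (Fin m → M) → ℝ} (hL : MemLp h 2 (Measure.pi fun _ => μ)) (hhm : Measurable h)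
    (hs : IsSymmetricKernel h) (p : Fin m → Prop) [DecidablePred p]
    (hc : Fintype.card {j // ¬p j} = c) : overlapCov μ h c = partialSq μ h p := by
  set J : Fin m → Fin m ⊕ Fin m := fun j => if p j then .inr j else .inl j with hJ
  have hJi : Function.Injective J := by
    intro a b hab
    simp only [hJ] at hab
    split_ifs at hab <;> simpa using hab
  have hcard : (Finset.univ.image (Sum.inl : Fin m → Fin m ⊕ Fin m) ∩ Finset.univ.image J).card =
      Fintype.card {j // ¬p j} := by
    have : Finset.univ.image (Sum.inl : Fin m → Fin m ⊕ Fin m) ∩ Finset.univ.image J =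
        (Finset.univ.filter fun j => ¬p j).image Sum.inl := by
      ext x
      simp only [Finset.mem_inter, Finset.mem_image, Finset.mem_univ, true_and, Finset.mem_filter,
        hJ]
      constructor
      · rintro ⟨⟨a, rfl⟩, b, hb⟩
        split_ifs at hb with h1
        obtain rfl : b = a := by simpa using hb
        exact ⟨b, h1, rfl⟩
      · rintro ⟨a, ha, rfl⟩
        exact ⟨⟨a, rfl⟩, a, by simp [ha]⟩
    rw [this, Finset.card_image_of_injective _ Sum.inl_injective, Fintype.card_subtype]
  rw [← integral_comp_mul_comp_eq hL hhm hs p Sum.inl_injective hJi hcard,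
    integral_comp_mul_comp hL hhm hs Sum.inl_injective hJi, hcard, hc]

lemma overlapCov_self {m : ℕ} {h : (Fin m → M) → ℝ} (hL : MemLp h 2 (Measure.pi fun _ => μ))
    (hhm : Measurable h) (hs : IsSymmetricKernel h) :
    overlapCov μ h m = ∫ x, h x ^ 2 ∂(Measure.pi fun _ => μ) := by
  have := integral_comp_mul_comp hL hhm hs (κ := Fin m) (I := id) (J := id) Function.injective_id
    Function.injective_id
  simp only [Finset.image_id, Finset.inter_self, Finset.card_univ, Fintype.card_fin, id] at this
  rw [← this]
  exact integral_congr_ae (ae_of_all _ fun x => (sq (h x)).symm)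

lemma overlapCov_zero {m : ℕ} {h : (Fin m → M) → ℝ} (hhm : Measurable h)
    (h0 : ∫ x, h x ∂(Measure.pi fun _ => μ) = 0) : overlapCov μ h 0 = 0 := by
  have hi : ∀ y, ∫ b, h (assemble (fun j : Fin m => 0 ≤ j.val) y b)
      ∂(Measure.pi fun _ : {j : Fin m // 0 ≤ j.val} => μ) = 0 := by
    intro y
    have mp := measurePreserving_comp_injective μ
      (σ := fun j : Fin m => (⟨j, Nat.zero_le _⟩ : {j : Fin m // 0 ≤ j.val}))
      fun a b hab => congrArg Subtype.val hab
    rw [← h0, ← integral_comp_measurePreserving mp hhm]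
    refine integral_congr_ae (ae_of_all _ fun b => congrArg h (funext fun j => ?_))
    exact dif_pos (Nat.zero_le _)
  simp [overlapCov, partialSq, hi]

lemma measurable_firstProj {m : ℕ} {h : (Fin m → M) → ℝ} (hhm : Measurable h) :
    Measurable (firstProj h μ) := by
  refine (StronglyMeasurable.integral_prod_right ?_).measurable
  refine (hhm.comp (measurable_pi_lambda _ fun j => ?_)).stronglyMeasurable
  split_ifs with hj <;> fun_prop

lemma overlapCov_one {m : ℕ} (hm : 1 ≤ m) {h : (Fin m → M) → ℝ}
    (hL : MemLp h 2 (Measure.pi fun _ => μ)) (hhm : Measurable h)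
    (hs : IsSymmetricKernel h) : overlapCov μ h 1 = ∫ x, firstProj h μ x ^ 2 ∂μ := by
  have hsub : ∀ j : {j : Fin m // ¬(j.val ≠ 0)}, j = ⟨⟨0, hm⟩, by simp⟩ := fun j => by
    obtain ⟨⟨j, hj⟩, h1⟩ := j
    simp only [ne_eq, not_not] at h1
    subst h1; rfl
  have hcard : Fintype.card {j : Fin m // ¬(j.val ≠ 0)} = 1 :=
    Fintype.card_eq_one_iff.2 ⟨_, hsub⟩
  rw [overlapCov_eq_partialSq hL hhm hs (fun j : Fin m => j.val ≠ 0) hcard, partialSq]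
  have mp := measurePreserving_eval (fun _ : {j : Fin m // ¬(j.val ≠ 0)} => μ) ⟨⟨0, hm⟩, by simp⟩
  rw [← integral_comp_measurePreserving mp ((measurable_firstProj hhm).pow_const 2)]
  refine integral_congr_ae (ae_of_all _ fun y => ?_)
  simp only [firstProj, Function.eval]
  congr 3
  ext b
  congr 1
  ext j
  unfold assemble
  split_ifs with hj
  · rfl
  · rw [hsub ⟨j, hj⟩]

end ProductSpace

/-! ### Counting overlaps of index sets. -/

section Counting

lemma sum_idx_eq_sum_powersetCard {m n : ℕ} (f : Finset (Fin n) → ℝ) :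
    ∑ I : Idx m n, f (Finset.univ.image I) =
      ∑ s ∈ (Finset.univ : Finset (Fin n)).powersetCard m, f s := by
  refine Finset.sum_bij' (fun I _ => Finset.univ.image I)
    (fun s hs => s.orderEmbOfFin (Finset.mem_powersetCard.1 hs).2) ?_ ?_ ?_ ?_ ?_
  · intro I _
    rw [Finset.mem_powersetCard]
    exact ⟨Finset.subset_univ _, by rw [Finset.card_image_of_injective _ I.injective]; simp⟩
  · intro s _; exact Finset.mem_univ _
  · intro I _
    symm
    exact Finset.orderEmbOfFin_unique' _ fun x => Finset.mem_image_of_mem _ (Finset.mem_univ _)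
  · intro s hs
    rw [← Finset.coe_inj]
    simp
  · intro I _; rfl

lemma card_idx (m n : ℕ) : Fintype.card (Idx m n) = n.choose m := by
  have := sum_idx_eq_sum_powersetCard (m := m) (n := n) fun _ => 1
  simp only [Finset.sum_const, Finset.card_univ, nsmul_eq_mul, mul_one,
    Finset.card_powersetCard, Fintype.card_fin] at this
  exact_mod_cast this

lemma card_image_idx {m n : ℕ} (I : Idx m n) : (Finset.univ.image I).card = m := by
  rw [Finset.card_image_of_injective _ I.injective]; simp

/-- Double counting of the pairs (t, J), where t is a d-element set contained in both index sets. -/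
lemma sum_choose_overlap {m n d : ℕ} (hd : d ≤ m) (I : Idx m n) :
    ∑ J : Idx m n, ((Finset.univ.image I ∩ Finset.univ.image J).card.choose d : ℝ) =
      m.choose d * (n - d).choose (m - d) := by
  rw [sum_idx_eq_sum_powersetCard fun s => ((Finset.univ.image I ∩ s).card.choose d : ℝ)]
  have e : ∀ s : Finset (Fin n), ((Finset.univ.image I ∩ s).card.choose d : ℝ) =
      ∑ t ∈ (Finset.univ.image I).powersetCard d, if t ⊆ s then 1 else 0 := fun s => by
    rw [← Finset.card_powersetCard, ← Finset.sum_filter, Finset.sum_const, nsmul_eq_mul, mul_one]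
    congr 2
    ext t
    simp only [Finset.mem_powersetCard, Finset.mem_filter, Finset.subset_inter_iff]
    tauto
  simp_rw [e]
  rw [Finset.sum_comm]
  have e2 : ∀ t ∈ (Finset.univ.image I).powersetCard d,
      ∑ s ∈ (Finset.univ : Finset (Fin n)).powersetCard m, (if t ⊆ s then (1 : ℝ) else 0) =
        (n - d).choose (m - d) := fun t ht => by
    have ht2 := (Finset.mem_powersetCard.1 ht).2
    rw [← Finset.sum_filter, Finset.sum_const, nsmul_eq_mul, mul_one,
      Finset.card_filter_powersetCard_subset _ _ _ (Finset.subset_univ _) (ht2.trans_le hd), ht2]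
    simp
  rw [Finset.sum_congr rfl e2, Finset.sum_const, nsmul_eq_mul, Finset.card_powersetCard,
    card_image_idx]

/-- Raising d by one multiplies the left side by (m - d)/(n - d), which is at most m/n. -/
lemma choose_sub_sub_le {m n : ℕ} (hmn : m ≤ n) {d : ℕ} (hd : d ≤ m) :
    ((n - d).choose (m - d) : ℝ) ≤ n.choose m * ((m : ℝ) / n) ^ d := by
  induction d with
  | zero => simp
  | succ d ih =>
    have ih := ih (by omega)
    obtain ⟨a, ha⟩ : ∃ a, m - d = a + 1 := ⟨m - d - 1, by omega⟩
    obtain ⟨b, hb⟩ : ∃ b, n - d = b + 1 := ⟨n - d - 1, by omega⟩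
    have ha' : m - (d + 1) = a := by omega
    have hb' : n - (d + 1) = b := by omega
    rw [ha', hb']
    rw [ha, hb] at ih
    have h1 : ((b : ℝ) + 1) * b.choose a = (b + 1).choose (a + 1) * (a + 1) := by
      exact_mod_cast Nat.add_one_mul_choose_eq b a
    have hn0 : (0 : ℝ) < n := by
      have : 0 < n := by omega
      exact_mod_cast this
    have h2 : ((a : ℝ) + 1) * n ≤ m * (b + 1) := by
      have ha2 : (a : ℝ) + 1 = m - d := by
        have : a + 1 + d = m := by omega
        have : (a : ℝ) + 1 + d = m := by exact_mod_cast this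
        linarith
      have hb2 : (b : ℝ) + 1 = n - d := by
        have : b + 1 + d = n := by omega
        have : (b : ℝ) + 1 + d = n := by exact_mod_cast this
        linarith
      rw [ha2, hb2]
      have : (m : ℝ) ≤ n := by exact_mod_cast hmn
      nlinarith [(Nat.cast_nonneg d : (0 : ℝ) ≤ d)]
    have h3 : (b.choose a : ℝ) ≤ (b + 1).choose (a + 1) * (m / n) := by
      rw [← mul_div_assoc, le_div_iff₀ hn0]
      have hb1 : (0 : ℝ) < b + 1 := by positivity
      refine le_of_mul_le_mul_left ?_ hb1
      calc ((b : ℝ) + 1) * (b.choose a * n) = ((b + 1).choose (a + 1) : ℝ) * ((a + 1) * n) := by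
            rw [← mul_assoc, h1]; ring
        _ ≤ ((b + 1).choose (a + 1) : ℝ) * (m * (b + 1)) := by gcongr
        _ = _ := by ring
    calc (b.choose a : ℝ) ≤ (b + 1).choose (a + 1) * (m / n) := h3
      _ ≤ n.choose m * ((m : ℝ) / n) ^ d * (m / n) := by gcongr
      _ = _ := by ring

/-- The assumption m < n/2 is needed here: the geometric decay of q^d absorbs the factor d, which
the influence carries. -/
lemma natCast_mul_pow_le {q : ℝ} (hq0 : 0 ≤ q) (hq : q ≤ 1 / 2) {d : ℕ} (hd : 2 ≤ d) :
    (d : ℝ) * q ^ d ≤ 2 * q ^ 2 := by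
  obtain ⟨e, rfl⟩ := Nat.exists_eq_add_of_le hd
  have h1 : ((2 + e : ℕ) : ℝ) ≤ 2 * 2 ^ e := by
    have : e + 1 ≤ 2 ^ e := Nat.lt_two_pow_self
    have h2 : 2 + e ≤ 2 * 2 ^ e := by omega
    exact_mod_cast h2
  calc ((2 + e : ℕ) : ℝ) * q ^ (2 + e) ≤ (2 * 2 ^ e) * (q ^ 2 * (1 / 2) ^ e) := by
        rw [pow_add]; gcongr
    _ = 2 * q ^ 2 * (2 * (1 / 2)) ^ e := by rw [mul_pow]; ring
    _ = 2 * q ^ 2 := by norm_num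

/-- Sums over pairs of index sets of functions of the overlap size whose forward differences
at `0` are non-negative. -/
lemma sum_overlap_le {m n : ℕ} (hm : 2 ≤ m) (hmn : (m : ℝ) < n / 2) {ζ : ℕ → ℝ} (h0 : ζ 0 = 0)
    (h1 : ζ 1 = 0) (hpos : ∀ d ≤ m, 0 ≤ (fwdDiff 1)^[d] ζ 0) :
    ∑ I : Idx m n, ∑ J : Idx m n, ζ (Finset.univ.image I ∩ Finset.univ.image J).card ≤
      (n.choose m : ℝ) ^ 2 * ((m : ℝ) / n) ^ 2 * ζ m ∧
    ∑ I : Idx m n, ∑ J : Idx m n,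
        ((Finset.univ.image I ∩ Finset.univ.image J).card : ℝ) *
          (ζ (Finset.univ.image I ∩ Finset.univ.image J).card -
            ζ ((Finset.univ.image I ∩ Finset.univ.image J).card - 1)) ≤
      2 * (n.choose m : ℝ) ^ 2 * ((m : ℝ) / n) ^ 2 * ζ m := by
  set s : ℕ → ℝ := fun d => (fwdDiff 1)^[d] ζ 0 with hs
  have hm0 : (0 : ℝ) < m := by exact_mod_cast (by omega : 0 < m)
  have hn0 : (0 : ℝ) < n := by linarith
  have hmn' : m ≤ n := by
    have : (m : ℝ) ≤ n := by linarith
    exact_mod_cast this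
  set q : ℝ := (m : ℝ) / n with hq
  have hq0 : 0 ≤ q := by positivity
  have hq2 : q ≤ 1 / 2 := by rw [hq, div_le_iff₀ hn0]; linarith
  have hs0 : s 0 = 0 := h0
  have hs1 : s 1 = 0 := by simp [hs, fwdDiff, h0, h1]
  -- Newton's forward difference formula. Extending the range up to m makes it the same for all c,
  -- since the additional binomial coefficients vanish.
  have hζ : ∀ c ≤ m, ζ c = ∑ k ∈ Finset.range (m + 1), (c.choose k : ℝ) * s k := by
    intro c hc
    have := shift_eq_sum_fwdDiff_iter (h := 1) ζ c 0
    simp only [zero_add, smul_eq_mul, mul_one, nsmul_eq_mul] at this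
    rw [this]
    refine Finset.sum_subset (Finset.range_subset_range.2 (by omega)) fun k _ hk => ?_
    rw [Finset.mem_range] at hk
    rw [Nat.choose_eq_zero_of_lt (by omega)]
    simp
  have hov : ∀ I J : Idx m n, (Finset.univ.image I ∩ Finset.univ.image J).card ≤ m := fun I J =>
    (Finset.card_le_card Finset.inter_subset_left).trans (card_image_idx I).le
  have hcount : ∀ k ≤ m, ∑ I : Idx m n, ∑ J : Idx m n,
      ((Finset.univ.image I ∩ Finset.univ.image J).card.choose k : ℝ) =
        n.choose m * (m.choose k * (n - k).choose (m - k)) := fun k hk => by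
    rw [Finset.sum_congr rfl fun I _ => sum_choose_overlap hk I, Finset.sum_const, Finset.card_univ,
      card_idx, nsmul_eq_mul]
  -- The weight 1 serves the second moment and the weight k the influence. Terms with k < 2 vanish,
  -- which is the source of the factor q².
  have gen : ∀ (w : ℕ → ℝ) (b : ℝ), (∀ k, 0 ≤ w k) → (∀ k, 2 ≤ k → w k * q ^ k ≤ b * q ^ 2) →
      ∑ I : Idx m n, ∑ J : Idx m n, ∑ k ∈ Finset.range (m + 1),
        w k * ((Finset.univ.image I ∩ Finset.univ.image J).card.choose k * s k) ≤
        b * (n.choose m : ℝ) ^ 2 * q ^ 2 * ζ m := by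
    intro w b hw hb
    have e : ∑ I : Idx m n, ∑ J : Idx m n, ∑ k ∈ Finset.range (m + 1),
        w k * ((Finset.univ.image I ∩ Finset.univ.image J).card.choose k * s k) =
        ∑ k ∈ Finset.range (m + 1), w k * s k *
          (n.choose m * (m.choose k * (n - k).choose (m - k))) := by
      rw [Finset.sum_congr rfl fun I _ => Finset.sum_comm, Finset.sum_comm]
      refine Finset.sum_congr rfl fun k hk => ?_
      rw [← hcount k (by simpa [Nat.lt_succ_iff] using hk), Finset.mul_sum]
      refine Finset.sum_congr rfl fun I _ => ?_
      rw [Finset.mul_sum]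
      exact Finset.sum_congr rfl fun J _ => by ring
    rw [e, hζ m le_rfl, Finset.mul_sum]
    refine Finset.sum_le_sum fun k hk => ?_
    have hk' : k ≤ m := by simpa [Nat.lt_succ_iff] using hk
    have hsk : 0 ≤ s k := hpos k hk'
    rcases Nat.lt_or_ge k 2 with h2 | h2
    · have : s k = 0 := by interval_cases k <;> assumption
      simp [this]
    · calc w k * s k * (n.choose m * (m.choose k * (n - k).choose (m - k)))
          ≤ w k * s k * (n.choose m * (m.choose k * (n.choose m * q ^ k))) := by
            have := hw k
            gcongr
            exact choose_sub_sub_le hmn' hk'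
        _ = (w k * q ^ k) * (s k * (n.choose m : ℝ) ^ 2 * m.choose k) := by ring
        _ ≤ (b * q ^ 2) * (s k * (n.choose m : ℝ) ^ 2 * m.choose k) := by
            refine mul_le_mul_of_nonneg_right (hb k h2) ?_
            positivity
        _ = _ := by ring
  constructor
  · have := gen (fun _ => 1) 1 (fun _ => zero_le_one) (fun k hk => by
      rw [one_mul, one_mul]
      exact pow_le_pow_of_le_one hq0 (by linarith) hk)
    simp only [one_mul] at this
    refine le_trans (le_of_eq ?_) this
    exact Finset.sum_congr rfl fun I _ => Finset.sum_congr rfl fun J _ => hζ _ (hov I J)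
  · have := gen (fun k => k) 2 (fun _ => Nat.cast_nonneg _) fun k hk => natCast_mul_pow_le hq0 hq2 hk
    refine le_trans (le_of_eq ?_) this
    refine Finset.sum_congr rfl fun I _ => Finset.sum_congr rfl fun J _ => ?_
    set c := (Finset.univ.image I ∩ Finset.univ.image J).card with hc
    have hcm : c ≤ m := hov I J
    rw [hζ c hcm, hζ (c - 1) (by omega), ← Finset.sum_sub_distrib, Finset.mul_sum]
    refine Finset.sum_congr rfl fun k _ => ?_
    -- For c = 0 the truncated c - 1 is harmless, because the difference is multiplied by c.
    rcases Nat.eq_zero_or_pos c with h | h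
    · rw [h]
      rcases Nat.eq_zero_or_pos k with h' | h'
      · simp [h']
      · rw [Nat.choose_eq_zero_of_lt h']; simp
    · obtain ⟨a, ha⟩ : ∃ a, c = a + 1 := ⟨c - 1, by omega⟩
      rw [ha, Nat.add_sub_cancel]
      rcases Nat.eq_zero_or_pos k with h' | h'
      · simp [h']
      · obtain ⟨b, rfl⟩ : ∃ b, k = b + 1 := ⟨k - 1, by omega⟩
        -- Pascal's rule and absorption: c (C(c,k) - C(c-1,k)) = c C(c-1,k-1) = k C(c,k).
        have e1 : ((a + 1).choose (b + 1) : ℝ) = a.choose b + a.choose (b + 1) := by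
          exact_mod_cast Nat.choose_succ_succ a b
        have e2 : ((a : ℝ) + 1) * a.choose b = (a + 1).choose (b + 1) * (b + 1) := by
          exact_mod_cast Nat.add_one_mul_choose_eq a b
        push_cast
        linear_combination ((a : ℝ) + 1) * s (b + 1) * e1 + s (b + 1) * e2

end Counting

/-! ### Non-negativity of the forward differences of the overlap covariances. -/

section Positivity

variable {M : Type*} [MeasurableSpace M] {μ : Measure M} [IsProbabilityMeasure μ]

/-- Every position off p has two copies, and s or t selects one of them; positions in p get private
variables. The index maps then share exactly the positions where the selections agree. -/
lemma card_image_inter_choice {m : ℕ} (p : Fin m → Prop) [DecidablePred p]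
    (s t : Finset {j // ¬p j}) :
    let I : Fin m → ({j // ¬p j} × Bool) ⊕ ({j // p j} ⊕ {j // p j}) := fun j =>
      if hj : p j then .inr (.inl ⟨j, hj⟩) else .inl (⟨j, hj⟩, decide (⟨j, hj⟩ ∈ s))
    let J : Fin m → ({j // ¬p j} × Bool) ⊕ ({j // p j} ⊕ {j // p j}) := fun j =>
      if hj : p j then .inr (.inr ⟨j, hj⟩) else .inl (⟨j, hj⟩, decide (⟨j, hj⟩ ∈ t))
    Function.Injective I ∧ Function.Injective J ∧
    (Finset.univ.image I ∩ Finset.univ.image J).card =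
      Fintype.card {j // ¬p j} - (symmDiff s t).card := by
  intro I J
  have hI : Function.Injective I := by
    intro a b hab
    simp only [I] at hab
    split_ifs at hab <;> simp at hab
    · exact hab
    · exact hab.1
  have hJ : Function.Injective J := by
    intro a b hab
    simp only [J] at hab
    split_ifs at hab <;> simp at hab
    · exact hab
    · exact hab.1
  refine ⟨hI, hJ, ?_⟩
  have e : Finset.univ.image I ∩ Finset.univ.image J =
      (symmDiff s t)ᶜ.image fun j => Sum.inl (j, decide (j ∈ s)) := by
    ext x
    simp only [Finset.mem_inter, Finset.mem_image, Finset.mem_univ, true_and, Finset.mem_compl,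
      Finset.mem_symmDiff]
    constructor
    · rintro ⟨⟨a, rfl⟩, b, hb⟩
      simp only [I, J] at hb ⊢
      by_cases h1 : p a
      · by_cases h2 : p b <;> simp [h1, h2] at hb
      · by_cases h2 : p b
        · simp [h1, h2] at hb
        · rw [dif_neg h1, dif_neg h2, Sum.inl.injEq, Prod.mk.injEq, Subtype.mk.injEq] at hb
          obtain ⟨rfl, hb⟩ := hb
          refine ⟨⟨b, h1⟩, ?_, by simp [h1]⟩
          rw [decide_eq_decide] at hb
          tauto
    · rintro ⟨a, ha, rfl⟩
      refine ⟨⟨a, by simp [I, a.2]⟩, a, ?_⟩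
      simp only [J, dif_neg a.2]
      congr 2
      rw [decide_eq_decide]
      tauto
  rw [e, Finset.card_image_of_injective, Finset.card_compl]
  intro a b hab
  simpa using (Prod.mk.inj (Sum.inl.inj hab)).1

/-- With two independent copies of each of the first d arguments, F is the alternating sum of h over
all selections. The second moment of its conditional mean given these copies is 2^d times the sum in
question. The sum is the variance of the d-th Hoeffding component, obtained without constructing
that component. -/
lemma alternating_sum_overlapCov_nonneg {m d : ℕ} (hd : d ≤ m) {h : (Fin m → M) → ℝ}
    (hL : MemLp h 2 (Measure.pi fun _ => μ)) (hhm : Measurable h) (hs : IsSymmetricKernel h) :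
    0 ≤ ∑ k ∈ Finset.range (d + 1), (-1 : ℝ) ^ k * d.choose k * overlapCov μ h (d - k) := by
  set p : Fin m → Prop := fun j => d ≤ j.val with hp
  set I : Finset {j // ¬p j} → Fin m → ({j // ¬p j} × Bool) ⊕ ({j // p j} ⊕ {j // p j}) :=
    fun s j => if hj : p j then .inr (.inl ⟨j, hj⟩) else .inl (⟨j, hj⟩, decide (⟨j, hj⟩ ∈ s))
    with hI
  set J : Finset {j // ¬p j} → Fin m → ({j // ¬p j} × Bool) ⊕ ({j // p j} ⊕ {j // p j}) :=
    fun s j => if hj : p j then .inr (.inr ⟨j, hj⟩) else .inl (⟨j, hj⟩, decide (⟨j, hj⟩ ∈ s))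
    with hJ
  have hcard : Fintype.card {j // ¬p j} = d := card_not_le hd
  have mpA : ∀ s : Finset {j // ¬p j}, MeasurePreserving
      (fun q : ({j // ¬p j} × Bool → M) × ({j // p j} → M) =>
        assemble p (fun j => q.1 (j, decide (j ∈ s))) q.2)
      ((Measure.pi fun _ => μ).prod (Measure.pi fun _ => μ)) (Measure.pi fun _ => μ) := fun s =>
    (measurePreserving_assemble p).comp ((measurePreserving_comp_injective μ
      (σ := fun j : {j // ¬p j} => (j, decide (j ∈ s)))
      fun a b hab => (Prod.mk.inj hab).1).prod (MeasurePreserving.id _))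
  set F : ({j // ¬p j} × Bool → M) × ({j // p j} → M) → ℝ := fun q =>
    ∑ s : Finset {j // ¬p j}, (-1) ^ s.card * h (assemble p (fun j => q.1 (j, decide (j ∈ s))) q.2)
    with hF
  have hFL : MemLp F 2 ((Measure.pi fun _ => μ).prod (Measure.pi fun _ => μ)) :=
    memLp_finsetSum _ fun s _ => (hL.comp_measurePreserving (mpA s)).const_mul _
  have hFm : Measurable F := Finset.measurable_sum _ fun s _ =>
    (hhm.comp (mpA s).measurable).const_mul _
  have h1 := integral_mul_condIndep hFL
  have h2 : 0 ≤ ∫ a, (∫ b, F (a, b) ∂(Measure.pi fun _ : {j // p j} => μ)) ^ 2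
      ∂(Measure.pi fun _ : {j // ¬p j} × Bool => μ) := integral_nonneg fun a => sq_nonneg _
  have hFF : Measurable fun q : ({j // ¬p j} × Bool → M) × ({j // p j} → M) × ({j // p j} → M) =>
      F (q.1, q.2.1) * F (q.1, q.2.2) := (hFm.comp (by fun_prop)).mul (hFm.comp (by fun_prop))
  rw [← h1, ← integral_comp_measurePreserving (measurePreserving_triple μ) hFF] at h2
  have e1 : ∀ x : ({j // ¬p j} × Bool) ⊕ ({j // p j} ⊕ {j // p j}) → M,
      F ((fun a => x (.inl a)), fun b => x (.inr (.inl b))) *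
        F ((fun a => x (.inl a)), fun b => x (.inr (.inr b))) =
      ∑ s : Finset {j // ¬p j}, ∑ t : Finset {j // ¬p j}, ((-1) ^ s.card * (-1) ^ t.card) *
        (h (fun j => x (I s j)) * h (fun j => x (J t j))) := by
    intro x
    have a1 : ∀ s, assemble p (fun j => x (.inl (j, decide (j ∈ s))))
        (fun b => x (.inr (.inl b))) = fun j => x (I s j) := fun s => by
      ext j; unfold assemble; simp only [hI]; split_ifs <;> rfl
    have a2 : ∀ s, assemble p (fun j => x (.inl (j, decide (j ∈ s))))
        (fun b => x (.inr (.inr b))) = fun j => x (J s j) := fun s => by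
      ext j; unfold assemble; simp only [hJ]; split_ifs <;> rfl
    simp only [hF, a1, a2]
    rw [Finset.sum_mul_sum]
    exact Finset.sum_congr rfl fun s _ => Finset.sum_congr rfl fun t _ => by ring
  rw [integral_congr_ae (ae_of_all _ e1)] at h2
  have hII : ∀ s, MemLp (fun x : ({j // ¬p j} × Bool) ⊕ ({j // p j} ⊕ {j // p j}) → M =>
      h (fun j => x (I s j))) 2 (Measure.pi fun _ => μ) := fun s =>
    hL.comp_measurePreserving (measurePreserving_comp_injective μ (card_image_inter_choice p s s).1)
  have hJJ : ∀ s, MemLp (fun x : ({j // ¬p j} × Bool) ⊕ ({j // p j} ⊕ {j // p j}) → M =>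
      h (fun j => x (J s j))) 2 (Measure.pi fun _ => μ) := fun s =>
    hL.comp_measurePreserving
      (measurePreserving_comp_injective μ (card_image_inter_choice p s s).2.1)
  have hint : ∀ s t, Integrable (fun x : ({j // ¬p j} × Bool) ⊕ ({j // p j} ⊕ {j // p j}) → M =>
      ((-1 : ℝ) ^ s.card * (-1) ^ t.card) *
        (h (fun j => x (I s j)) * h (fun j => x (J t j)))) (Measure.pi fun _ => μ) := fun s t =>
    ((hII s).integrable_mul (hJJ t)).const_mul _
  rw [integral_finsetSum _ fun s _ => integrable_finsetSum _ fun t _ => hint s t] at h2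
  have e2 : ∀ s : Finset {j // ¬p j}, ∫ x : ({j // ¬p j} × Bool) ⊕ ({j // p j} ⊕ {j // p j}) → M,
      (∑ t : Finset {j // ¬p j}, ((-1 : ℝ) ^ s.card * (-1) ^ t.card) *
        (h (fun j => x (I s j)) * h (fun j => x (J t j)))) ∂(Measure.pi fun _ => μ) =
      ∑ k ∈ Finset.range (d + 1), (-1 : ℝ) ^ k * d.choose k * overlapCov μ h (d - k) := by
    intro s
    rw [integral_finsetSum _ fun t _ => hint s t]
    have e3 : ∀ t : Finset {j // ¬p j},
        ∫ x : ({j // ¬p j} × Bool) ⊕ ({j // p j} ⊕ {j // p j}) → M, ((-1 : ℝ) ^ s.card *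
        (-1) ^ t.card) * (h (fun j => x (I s j)) * h (fun j => x (J t j)))
          ∂(Measure.pi fun _ => μ) =
        (-1) ^ (symmDiff s t).card * overlapCov μ h (d - (symmDiff s t).card) := by
      intro t
      obtain ⟨c1, c2, c3⟩ := card_image_inter_choice p s t
      rw [integral_const_mul, integral_comp_mul_comp hL hhm hs c1 c2, c3, hcard, ← pow_add]
      congr 1
      -- The sign depends only on the parity of the size of the symmetric difference.
      have : s.card + t.card = (symmDiff s t).card + 2 * (s ∩ t).card := by
        have b1 := Finset.card_sdiff_add_card_inter s t
        have b2 := Finset.card_sdiff_add_card_inter t s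
        have b3 : (symmDiff s t).card = (s \ t).card + (t \ s).card :=
          Finset.card_union_of_disjoint disjoint_sdiff_sdiff
        rw [Finset.inter_comm t s] at b2
        omega
      rw [this, pow_add, pow_mul]
      simp
    simp_rw [e3]
    -- Symmetric difference with s is an involution, so the inner sum does not depend on s.
    rw [Fintype.sum_equiv (Equiv.ofBijective (fun t => symmDiff s t)
      (Function.Involutive.bijective fun t => symmDiff_symmDiff_cancel_left s t))
      (fun t => (-1 : ℝ) ^ (symmDiff s t).card * overlapCov μ h (d - (symmDiff s t).card))
      (fun t => (-1 : ℝ) ^ t.card * overlapCov μ h (d - t.card)) fun t => rfl]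
    have := Finset.sum_powerset_apply_card (fun k => (-1 : ℝ) ^ k * overlapCov μ h (d - k))
      (x := (Finset.univ : Finset {j // ¬p j}))
    rw [Finset.powerset_univ, Finset.card_univ, hcard] at this
    rw [this]
    exact Finset.sum_congr rfl fun k _ => by rw [nsmul_eq_mul]; ring
  rw [Finset.sum_congr rfl fun s _ => e2 s, Finset.sum_const, nsmul_eq_mul] at h2
  refine (mul_nonneg_iff_of_pos_left ?_).1 h2
  rw [Finset.card_univ]
  exact_mod_cast Fintype.card_pos

lemma fwdDiff_overlapCov_nonneg {m d : ℕ} (hd : d ≤ m) {h : (Fin m → M) → ℝ}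
    (hL : MemLp h 2 (Measure.pi fun _ => μ)) (hhm : Measurable h) (hs : IsSymmetricKernel h) :
    0 ≤ (fwdDiff 1)^[d] (overlapCov μ h) 0 := by
  have := alternating_sum_overlapCov_nonneg hd hL hhm hs
  rw [fwdDiff_iter_eq_sum_shift, ← Finset.sum_range_reflect]
  refine this.trans_eq (Finset.sum_congr rfl fun k hk => ?_)
  have hk' : k ≤ d := by simpa [Nat.lt_succ_iff] using hk
  have e : d + 1 - 1 - k = d - k := by omega
  have e2 : d - (d - k) = k := by omega
  rw [e, Nat.choose_symm hk', e2]
  simp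

end Positivity

/-! ### The Hájek projection and its remainder kernel. -/

section HajekRemainder

variable {M : Type*} [MeasurableSpace M] {μ : Measure M} [IsProbabilityMeasure μ]

lemma measurePreserving_insert_first {m : ℕ} (hm : 0 < m) :
    MeasurePreserving (fun (q : M × ({j : Fin m // j.val ≠ 0} → M)) (j : Fin m) =>
      if hj : j.val ≠ 0 then q.2 ⟨j, hj⟩ else q.1)
      (μ.prod (Measure.pi fun _ => μ)) (Measure.pi fun _ => μ) := by
  let u : Unique {j : Fin m // ¬(j.val ≠ 0)} :=
    { default := ⟨⟨0, hm⟩, by simp⟩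
      uniq := fun j => by
        obtain ⟨⟨j, hj⟩, h1⟩ := j
        simp only [ne_eq, not_not] at h1
        subst h1; rfl }
  have hu : MeasurePreserving (MeasurableEquiv.funUnique {j : Fin m // ¬(j.val ≠ 0)} M)
      (Measure.pi fun _ => μ) μ := by
    convert measurePreserving_funUnique μ {j : Fin m // ¬(j.val ≠ 0)}
  have h1 := (measurePreserving_assemble (μ := μ) fun j : Fin m => j.val ≠ 0).comp
    (hu.symm.prod
      (MeasurePreserving.id (Measure.pi fun _ : {j : Fin m // j.val ≠ 0} => μ)))
  refine (congrArg (fun f => MeasurePreserving f _ _) ?_).mp h1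
  ext q j
  simp only [Function.comp, Prod.map, assemble, id]
  split_ifs <;> rfl

lemma integral_mul_eval_zero {m : ℕ} (hm : 0 < m) {h : (Fin m → M) → ℝ}
    (hL : MemLp h 2 (Measure.pi fun _ => μ)) (hhm : Measurable h) {k : M → ℝ} (hk : MemLp k 2 μ)
    (hkm : Measurable k) :
    ∫ x, h x * k (x ⟨0, hm⟩) ∂(Measure.pi fun _ => μ) = ∫ x, firstProj h μ x * k x ∂μ := by
  have mp := measurePreserving_insert_first (μ := μ) hm
  have mpe := measurePreserving_eval (fun _ : Fin m => μ) ⟨0, hm⟩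
  have hint : Integrable (fun x : Fin m → M => h x * k (x ⟨0, hm⟩)) (Measure.pi fun _ => μ) :=
    hL.integrable_mul (hk.comp_measurePreserving mpe)
  have hmeas : Measurable fun x : Fin m → M => h x * k (x ⟨0, hm⟩) :=
    hhm.mul (hkm.comp (by fun_prop))
  rw [← integral_comp_measurePreserving mp hmeas]
  rw [integral_prod]
  swap
  · exact mp.integrable_comp_of_integrable hint
  refine integral_congr_ae (ae_of_all _ fun x => ?_)
  simp only [ne_eq, not_true_eq_false, dite_false]
  rw [integral_mul_const]
  rfl

lemma integral_firstProj {m : ℕ} (hm : 0 < m) {h : (Fin m → M) → ℝ}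
    (hL : MemLp h 2 (Measure.pi fun _ => μ)) (hhm : Measurable h) :
    ∫ x, firstProj h μ x ∂μ = ∫ x, h x ∂(Measure.pi fun _ => μ) := by
  have := integral_mul_eval_zero hm hL hhm (k := fun _ => 1) (memLp_const 1) measurable_const
  simpa using this.symm

/-- Symmetry of h moves the coordinate j to the first position, where Fubini's theorem produces the
projection. -/
lemma integral_mul_eval {m : ℕ} {h : (Fin m → M) → ℝ}
    (hL : MemLp h 2 (Measure.pi fun _ => μ)) (hhm : Measurable h) (hs : IsSymmetricKernel h)
    {k : M → ℝ} (hk : MemLp k 2 μ) (hkm : Measurable k) (j : Fin m) :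
    ∫ x, h x * k (x j) ∂(Measure.pi fun _ => μ) = ∫ x, firstProj h μ x * k x ∂μ := by
  have hm : 0 < m := j.pos
  have hmeas : Measurable fun x : Fin m → M => h x * k (x ⟨0, hm⟩) :=
    hhm.mul (hkm.comp (by fun_prop))
  rw [← integral_mul_eval_zero hm hL hhm hk hkm,
    ← integral_comp_measurePreserving (measurePreserving_comp_injective μ
      (Equiv.swap j ⟨0, hm⟩).injective) hmeas]
  refine integral_congr_ae (ae_of_all _ fun x => ?_)
  simp only [Equiv.swap_apply_right]
  rw [hs (Equiv.swap j ⟨0, hm⟩) x]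

/-- The part of a kernel left after removing its Hájek projection. -/
noncomputable def hajekRem (μ : Measure M) {m : ℕ} (h : (Fin m → M) → ℝ) (x : Fin m → M) : ℝ :=
  h x - ∑ j, firstProj h μ (x j)

variable {m : ℕ} {h : (Fin m → M) → ℝ}

lemma measurable_hajekRem (hhm : Measurable h) : Measurable (hajekRem μ h) :=
  hhm.sub (Finset.measurable_sum _ fun j _ =>
    (measurable_firstProj hhm).comp (measurable_pi_apply j))

omit [IsProbabilityMeasure μ] in
lemma isSymmetricKernel_hajekRem (hs : IsSymmetricKernel h) :
    IsSymmetricKernel (hajekRem μ h) := fun π x => by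
  unfold hajekRem
  rw [hs π x, Equiv.sum_comp π fun j => firstProj h μ (x j)]

lemma memLp_firstProj_eval (hg : MemLp (firstProj h μ) 2 μ) (j : Fin m) :
    MemLp (fun x : Fin m → M => firstProj h μ (x j)) 2 (Measure.pi fun _ => μ) :=
  hg.comp_measurePreserving (measurePreserving_eval (fun _ : Fin m => μ) j)

lemma memLp_hajekRem (hL : MemLp h 2 (Measure.pi fun _ => μ)) (hg : MemLp (firstProj h μ) 2 μ) :
    MemLp (hajekRem μ h) 2 (Measure.pi fun _ => μ) :=
  hL.sub (memLp_finsetSum _ fun j _ => memLp_firstProj_eval hg j)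

lemma integral_firstProj_eval (hhm : Measurable h) (j : Fin m) :
    ∫ x : Fin m → M, firstProj h μ (x j) ∂(Measure.pi fun _ => μ) = ∫ x, firstProj h μ x ∂μ :=
  integral_comp_measurePreserving (measurePreserving_eval (fun _ : Fin m => μ) j)
    (measurable_firstProj hhm)

lemma integral_hajekRem (hm : 0 < m) (hL : MemLp h 2 (Measure.pi fun _ => μ)) (hhm : Measurable h)
    (hg : MemLp (firstProj h μ) 2 μ) (h0 : ∫ x, h x ∂(Measure.pi fun _ => μ) = 0) :
    ∫ x, hajekRem μ h x ∂(Measure.pi fun _ => μ) = 0 := by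
  have hi : ∀ j : Fin m, Integrable (fun x : Fin m → M => firstProj h μ (x j))
      (Measure.pi fun _ => μ) := fun j => (memLp_firstProj_eval hg j).integrable (by norm_num)
  unfold hajekRem
  rw [integral_sub (hL.integrable (by norm_num)) (integrable_finsetSum _ fun j _ => hi j),
    integral_finsetSum _ fun j _ => hi j, h0]
  simp [integral_firstProj_eval hhm, integral_firstProj hm hL hhm, h0]

/-- Averaging over the other coordinates keeps g(x) from the first one and kills the remaining
terms, as g is centred. The argument runs at those x whose section of h is integrable, hence almost
everywhere. -/
lemma firstProj_hajekRem (hm : 0 < m) (hL : MemLp h 2 (Measure.pi fun _ => μ))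
    (hhm : Measurable h) (hg : MemLp (firstProj h μ) 2 μ)
    (h0 : ∫ x, h x ∂(Measure.pi fun _ => μ) = 0) :
    ∀ᵐ x ∂μ, firstProj (hajekRem μ h) μ x = 0 := by
  have mp := measurePreserving_insert_first (μ := μ) hm
  have hint := mp.integrable_comp_of_integrable (hL.integrable (by norm_num))
  have hgi : Integrable (firstProj h μ) μ := hg.integrable (by norm_num)
  filter_upwards [hint.prod_right_ae] with x hx
  have e : ∀ y : {j : Fin m // j.val ≠ 0} → M,
      hajekRem μ h (fun j => if hj : j.val ≠ 0 then y ⟨j, hj⟩ else x) =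
      h (fun j => if hj : j.val ≠ 0 then y ⟨j, hj⟩ else x) -
        ∑ j : Fin m, firstProj h μ (if hj : j.val ≠ 0 then y ⟨j, hj⟩ else x) := fun y => rfl
  have hI : ∀ j : Fin m, Integrable (fun y : {j : Fin m // j.val ≠ 0} → M =>
      firstProj h μ (if hj : j.val ≠ 0 then y ⟨j, hj⟩ else x)) (Measure.pi fun _ => μ) := by
    intro j
    by_cases hj : j.val ≠ 0
    · simp only [hj, not_false_eq_true, dite_true, ne_eq]
      exact (measurePreserving_eval (fun _ : {j : Fin m // j.val ≠ 0} => μ)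
        ⟨j, hj⟩).integrable_comp_of_integrable hgi
    · simp only [hj, dite_false]
      exact integrable_const _
  have hv : ∀ j : Fin m, ∫ y : {j : Fin m // j.val ≠ 0} → M,
      firstProj h μ (if hj : j.val ≠ 0 then y ⟨j, hj⟩ else x) ∂(Measure.pi fun _ => μ) =
      if j = ⟨0, hm⟩ then firstProj h μ x else 0 := by
    intro j
    by_cases hj : j.val ≠ 0
    · have hj' : j ≠ ⟨0, hm⟩ := fun hh => hj (by rw [hh])
      simp only [hj, not_false_eq_true, dite_true, ne_eq, if_neg hj']
      exact (integral_comp_measurePreserving (measurePreserving_eval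
        (fun _ : {j : Fin m // j.val ≠ 0} => μ) ⟨j, hj⟩) (measurable_firstProj hhm)).trans
        ((integral_firstProj hm hL hhm).trans h0)
    · have hj' : j = ⟨0, hm⟩ := Fin.ext (not_not.1 hj)
      simp [hj']
  have hx' : Integrable (fun y : {j : Fin m // j.val ≠ 0} → M =>
      h (fun j => if hj : j.val ≠ 0 then y ⟨j, hj⟩ else x)) (Measure.pi fun _ => μ) := hx
  rw [firstProj]
  simp_rw [e]
  rw [integral_sub hx' (integrable_finsetSum _ fun j _ => hI j),
    integral_finsetSum _ fun j _ => hI j]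
  simp_rw [hv]
  rw [Finset.sum_ite_eq' Finset.univ]
  simp [firstProj]

/-- Pythagoras: the remainder is orthogonal to every function of one coordinate, and E h g(X_j) = E
g². -/
lemma integral_hajekRem_sq (hm : 0 < m) (hL : MemLp h 2 (Measure.pi fun _ => μ))
    (hhm : Measurable h) (hs : IsSymmetricKernel h) (hg : MemLp (firstProj h μ) 2 μ)
    (h0 : ∫ x, h x ∂(Measure.pi fun _ => μ) = 0) :
    ∫ x, hajekRem μ h x ^ 2 ∂(Measure.pi fun _ => μ) =
      ∫ x, h x ^ 2 ∂(Measure.pi fun _ => μ) - m * ∫ x, firstProj h μ x ^ 2 ∂μ := by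
  have hgm := measurable_firstProj (μ := μ) hhm
  have hge := fun j => memLp_firstProj_eval hg j
  have hLr := memLp_hajekRem hL hg
  have hrg : ∀ j : Fin m, ∫ x, hajekRem μ h x * firstProj h μ (x j) ∂(Measure.pi fun _ => μ) = 0 :=
    fun j => by
      rw [integral_mul_eval hLr (measurable_hajekRem hhm) (isSymmetricKernel_hajekRem hs) hg hgm j]
      refine integral_eq_zero_of_ae ?_
      filter_upwards [firstProj_hajekRem hm hL hhm hg h0] with x hx
      simp [hx]
  have hhg : ∀ j : Fin m, ∫ x, h x * firstProj h μ (x j) ∂(Measure.pi fun _ => μ) =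
      ∫ x, firstProj h μ x ^ 2 ∂μ := fun j => by
    rw [integral_mul_eval hL hhm hs hg hgm j]
    exact integral_congr_ae (ae_of_all _ fun x => (sq _).symm)
  have e : ∀ x, hajekRem μ h x ^ 2 = h x ^ 2 - ∑ j, h x * firstProj h μ (x j) -
      ∑ j, hajekRem μ h x * firstProj h μ (x j) := fun x => by
    rw [← Finset.mul_sum, ← Finset.mul_sum]
    unfold hajekRem
    ring
  have i1 : ∀ j, Integrable (fun x => h x * firstProj h μ (x j)) (Measure.pi fun _ => μ) :=
    fun j => hL.integrable_mul (hge j)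
  have i2 : ∀ j, Integrable (fun x => hajekRem μ h x * firstProj h μ (x j))
      (Measure.pi fun _ => μ) := fun j => hLr.integrable_mul (hge j)
  have s1 := integrable_finsetSum Finset.univ fun j _ => i1 j
  have s2 := integrable_finsetSum Finset.univ fun j _ => i2 j
  simp_rw [e]
  have s3 : Integrable (fun x => h x ^ 2 - ∑ j, h x * firstProj h μ (x j))
      (Measure.pi fun _ => μ) := hL.integrable_sq.sub s1
  rw [integral_sub s3 s2, integral_sub hL.integrable_sq s1,
    integral_finsetSum _ fun j _ => i1 j, integral_finsetSum _ fun j _ => i2 j]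
  simp [hrg, hhg]

end HajekRemainder

/-! ### Replacing one observation in a complete sum. -/

section Influence

variable {M : Type*} [MeasurableSpace M] {μ : Measure M} [IsProbabilityMeasure μ] {m n : ℕ}

/-- The sum of the kernel `h` over all increasing index tuples. -/
noncomputable def kernelSum (h : (Fin m → M) → ℝ) (n : ℕ) (y : Fin n → M) : ℝ :=
  ∑ I : Idx m n, h fun j => y (I j)

/-- Replacement of the `k`-th observation by the additional one. -/
def replace (k : Fin n) (x : Option (Fin n) → M) (i : Fin n) : M :=
  x (Equiv.swap none (some k) (some i))

/-- The proper observations. -/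
def keep (x : Option (Fin n) → M) (i : Fin n) : M := x (some i)

/-- Replacement is reading the data through an injective reindexing, so `keep` and `replace` fall
under the same moment formula. The coordinate `none` is a single spare observation serving all k. -/
lemma swap_some_injective (k : Fin n) :
    Function.Injective fun i : Fin n => Equiv.swap none (some k) (some i) :=
  (Equiv.injective _).comp (Option.some_injective _)

lemma measurePreserving_replace (k : Fin n) :
    MeasurePreserving (replace k : (Option (Fin n) → M) → Fin n → M) (Measure.pi fun _ => μ)
      (Measure.pi fun _ => μ) :=
  measurePreserving_comp_injective μ (swap_some_injective k)

lemma measurePreserving_keep :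
    MeasurePreserving (keep : (Option (Fin n) → M) → Fin n → M) (Measure.pi fun _ => μ)
      (Measure.pi fun _ => μ) :=
  measurePreserving_comp_injective μ (Option.some_injective _)

lemma measurePreserving_idx (I : Idx m n) :
    MeasurePreserving (fun (y : Fin n → M) (j : Fin m) => y (I j)) (Measure.pi fun _ => μ)
      (Measure.pi fun _ => μ) :=
  measurePreserving_comp_injective μ I.injective

lemma memLp_kernelSum {h : (Fin m → M) → ℝ} (hL : MemLp h 2 (Measure.pi fun _ => μ)) :
    MemLp (kernelSum h n) 2 (Measure.pi fun _ => μ) :=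
  memLp_finsetSum _ fun I _ => hL.comp_measurePreserving (measurePreserving_idx I)

lemma measurable_kernelSum {h : (Fin m → M) → ℝ} (hhm : Measurable h) :
    Measurable (kernelSum h n) :=
  Finset.measurable_sum _ fun _ _ => hhm.comp (by fun_prop)

lemma integral_kernelSum_mul {κ : Type*} [Fintype κ] [DecidableEq κ] {h : (Fin m → M) → ℝ}
    (hL : MemLp h 2 (Measure.pi fun _ => μ)) (hhm : Measurable h) (hs : IsSymmetricKernel h)
    {σ τ : Fin n → κ} (hσ : Function.Injective σ) (hτ : Function.Injective τ) :
    ∫ x : κ → M, kernelSum h n (fun i => x (σ i)) * kernelSum h n (fun i => x (τ i))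
        ∂(Measure.pi fun _ => μ) =
      ∑ I : Idx m n, ∑ J : Idx m n, overlapCov μ h
        (Finset.univ.image (σ ∘ I) ∩ Finset.univ.image (τ ∘ J)).card := by
  have hI : ∀ {ρ : Fin n → κ}, Function.Injective ρ → ∀ I : Idx m n,
      MemLp (fun x : κ → M => h fun j => x (ρ (I j))) 2 (Measure.pi fun _ => μ) :=
    fun hρ I => hL.comp_measurePreserving
      (measurePreserving_comp_injective μ (hρ.comp I.injective))
  have hint : ∀ I J : Idx m n, Integrable (fun x : κ → M =>
      h (fun j => x (σ (I j))) * h (fun j => x (τ (J j)))) (Measure.pi fun _ => μ) := fun I J =>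
    (hI hσ I).integrable_mul (hI hτ J)
  simp only [kernelSum, Finset.sum_mul_sum]
  rw [integral_finsetSum _ fun I _ => integrable_finsetSum _ fun J _ => hint I J]
  refine Finset.sum_congr rfl fun I _ => ?_
  rw [integral_finsetSum _ fun J _ => hint I J]
  refine Finset.sum_congr rfl fun J _ => ?_
  exact integral_comp_mul_comp hL hhm hs (hσ.comp I.injective) (hτ.comp J.injective)

lemma card_image_comp_inter {κ : Type*} [DecidableEq κ] {σ : Fin n → κ}
    (hσ : Function.Injective σ) (I J : Idx m n) :
    (Finset.univ.image (σ ∘ I) ∩ Finset.univ.image (σ ∘ J)).card =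
      (Finset.univ.image I ∩ Finset.univ.image J).card := by
  rw [← Finset.image_image, ← Finset.image_image, ← Finset.image_inter _ _ hσ,
    Finset.card_image_of_injective _ hσ]

/-- Replacement exchanges k for the spare index in the second set. The first set never contains the
spare index, so exactly k is lost from the overlap, if it was there. -/
lemma card_image_swap_inter (k : Fin n) (I J : Idx m n) :
    (Finset.univ.image (some ∘ I) ∩
        Finset.univ.image ((fun i => Equiv.swap none (some k) (some i)) ∘ J)).card =
      ((Finset.univ.image I ∩ Finset.univ.image J).erase k).card := by
  rw [← Finset.card_image_of_injective _ (Option.some_injective (Fin n))]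
  congr 1
  ext x
  simp only [Finset.mem_inter, Finset.mem_image, Finset.mem_univ, true_and, Function.comp,
    Finset.mem_erase]
  constructor
  · rintro ⟨⟨a, rfl⟩, b, hb⟩
    by_cases hk : J b = k
    · rw [hk, Equiv.swap_apply_right] at hb
      cases hb
    · rw [Equiv.swap_apply_of_ne_of_ne (by simp) (by simpa using hk)] at hb
      have hb' : J b = I a := by simpa using hb
      exact ⟨I a, ⟨hb' ▸ hk, ⟨a, rfl⟩, b, hb'⟩, rfl⟩
  · rintro ⟨y, ⟨hk, ⟨a, ha⟩, b, hb⟩, rfl⟩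
    refine ⟨⟨a, by rw [ha]⟩, b, ?_⟩
    rw [hb, Equiv.swap_apply_of_ne_of_ne (by simp) (by simpa using hk)]

lemma integral_kernelSum_sq {h : (Fin m → M) → ℝ}
    (hL : MemLp h 2 (Measure.pi fun _ => μ)) (hhm : Measurable h) (hs : IsSymmetricKernel h)
    {κ : Type*} [Fintype κ] {σ : Fin n → κ} (hσ : Function.Injective σ) :
    ∫ x : κ → M, kernelSum h n (fun i => x (σ i)) ^ 2 ∂(Measure.pi fun _ => μ) =
      ∑ I : Idx m n, ∑ J : Idx m n, overlapCov μ h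
        (Finset.univ.image I ∩ Finset.univ.image J).card := by
  classical
  simp_rw [sq]
  rw [integral_kernelSum_mul hL hhm hs hσ hσ]
  simp_rw [card_image_comp_inter hσ]

/-- The total influence of the observations on a complete sum. -/
lemma sum_integral_sub_replace_sq {h : (Fin m → M) → ℝ}
    (hL : MemLp h 2 (Measure.pi fun _ => μ)) (hhm : Measurable h) (hs : IsSymmetricKernel h) :
    ∑ k : Fin n, ∫ x : Option (Fin n) → M,
        (kernelSum h n (keep x) - kernelSum h n (replace k x)) ^ 2 ∂(Measure.pi fun _ => μ) =
      2 * ∑ I : Idx m n, ∑ J : Idx m n,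
        ((Finset.univ.image I ∩ Finset.univ.image J).card : ℝ) *
          (overlapCov μ h (Finset.univ.image I ∩ Finset.univ.image J).card -
            overlapCov μ h ((Finset.univ.image I ∩ Finset.univ.image J).card - 1)) := by
  have hk : ∀ k : Fin n, ∫ x : Option (Fin n) → M,
        (kernelSum h n (keep x) - kernelSum h n (replace k x)) ^ 2 ∂(Measure.pi fun _ => μ) =
      2 * ∑ I : Idx m n, ∑ J : Idx m n, (if k ∈ Finset.univ.image I ∩ Finset.univ.image J then
        (overlapCov μ h (Finset.univ.image I ∩ Finset.univ.image J).card -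
            overlapCov μ h ((Finset.univ.image I ∩ Finset.univ.image J).card - 1)) else 0) := by
    intro k
    have l1 : MemLp (fun x : Option (Fin n) → M => kernelSum h n (keep x)) 2
        (Measure.pi fun _ => μ) := (memLp_kernelSum hL).comp_measurePreserving measurePreserving_keep
    have l2 : MemLp (fun x : Option (Fin n) → M => kernelSum h n (replace k x)) 2
        (Measure.pi fun _ => μ) :=
      (memLp_kernelSum hL).comp_measurePreserving (measurePreserving_replace k)
    -- The two squares have the same mean; the cross term loses one unit of overlap for the pairs
    -- with k in both sets. Summed over k, each pair counts as often as its overlap size.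
    have e : ∀ x : Option (Fin n) → M,
        (kernelSum h n (keep x) - kernelSum h n (replace k x)) ^ 2 =
        kernelSum h n (keep x) ^ 2 + kernelSum h n (replace k x) ^ 2 -
          2 * (kernelSum h n (keep x) * kernelSum h n (replace k x)) := fun x => by ring
    have i3 : Integrable (fun x : Option (Fin n) → M =>
        2 * (kernelSum h n (keep x) * kernelSum h n (replace k x))) (Measure.pi fun _ => μ) :=
      (l1.integrable_mul l2).const_mul 2
    have i12 : Integrable (fun x : Option (Fin n) → M =>
        kernelSum h n (keep x) ^ 2 + kernelSum h n (replace k x) ^ 2) (Measure.pi fun _ => μ) :=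
      l1.integrable_sq.add l2.integrable_sq
    simp_rw [e]
    rw [integral_sub i12 i3, integral_add l1.integrable_sq l2.integrable_sq, integral_const_mul]
    have q1 := integral_kernelSum_sq hL hhm hs (Option.some_injective (Fin n))
    have q2 := integral_kernelSum_sq hL hhm hs (swap_some_injective k)
    have q3 := integral_kernelSum_mul hL hhm hs (Option.some_injective (Fin n))
      (swap_some_injective k)
    have q1' : ∫ x : Option (Fin n) → M, kernelSum h n (keep x) ^ 2 ∂(Measure.pi fun _ => μ) = _ := q1
    have q2' : ∫ x : Option (Fin n) → M, kernelSum h n (replace k x) ^ 2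
      ∂(Measure.pi fun _ => μ) = _ := q2
    have q3' : ∫ x : Option (Fin n) → M, kernelSum h n (keep x) * kernelSum h n (replace k x)
      ∂(Measure.pi fun _ => μ) = _ := q3
    rw [q1', q2', q3', ← two_mul, ← mul_sub, ← Finset.sum_sub_distrib]
    congr 1
    refine Finset.sum_congr rfl fun I _ => ?_
    rw [← Finset.sum_sub_distrib]
    refine Finset.sum_congr rfl fun J _ => ?_
    rw [card_image_swap_inter]
    split_ifs with hmem
    · rw [Finset.card_erase_of_mem hmem]
    · rw [Finset.erase_eq_of_notMem hmem, sub_self]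
  simp_rw [hk]
  rw [← Finset.mul_sum, Finset.sum_comm]
  congr 1
  refine Finset.sum_congr rfl fun I _ => ?_
  rw [Finset.sum_comm]
  refine Finset.sum_congr rfl fun J _ => ?_
  rw [← Finset.sum_filter, Finset.sum_const, nsmul_eq_mul, Finset.filter_univ_mem]

/-- Second moments and total influence of the degenerate part of a complete U-statistic. -/
lemma kernelSum_hajekRem_bounds (hm : 2 ≤ m) (hmn : (m : ℝ) < n / 2) {h : (Fin m → M) → ℝ}
    (hL : MemLp h 2 (Measure.pi fun _ => μ)) (hhm : Measurable h) (hs : IsSymmetricKernel h)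
    (hg : MemLp (firstProj h μ) 2 μ) (h0 : ∫ x, h x ∂(Measure.pi fun _ => μ) = 0) :
    ∫ x : Option (Fin n) → M, kernelSum (hajekRem μ h) n (keep x) ^ 2 ∂(Measure.pi fun _ => μ) ≤
      (n.choose m : ℝ) ^ 2 * ((m : ℝ) / n) ^ 2 *
        ∫ x, hajekRem μ h x ^ 2 ∂(Measure.pi fun _ => μ) ∧
    ∑ k : Fin n, ∫ x : Option (Fin n) → M, (kernelSum (hajekRem μ h) n (keep x) -
        kernelSum (hajekRem μ h) n (replace k x)) ^ 2 ∂(Measure.pi fun _ => μ) ≤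
      4 * ((n.choose m : ℝ) ^ 2 * ((m : ℝ) / n) ^ 2 *
        ∫ x, hajekRem μ h x ^ 2 ∂(Measure.pi fun _ => μ)) := by
  have rL := memLp_hajekRem hL hg
  have rm := measurable_hajekRem (μ := μ) hhm
  have rs := isSymmetricKernel_hajekRem (μ := μ) hs
  have z0 := overlapCov_zero rm (integral_hajekRem (by omega) hL hhm hg h0)
  have z1 : overlapCov μ (hajekRem μ h) 1 = 0 := by
    rw [overlapCov_one (by omega) rL rm rs]
    refine integral_eq_zero_of_ae ?_
    filter_upwards [firstProj_hajekRem (by omega) hL hhm hg h0] with x hx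
    simp [hx]
  obtain ⟨b1, b2⟩ := sum_overlap_le hm hmn z0 z1 fun d hd => fwdDiff_overlapCov_nonneg hd rL rm rs
  rw [overlapCov_self rL rm rs] at b1 b2
  refine ⟨(integral_kernelSum_sq rL rm rs (Option.some_injective (Fin n))).trans_le b1, ?_⟩
  rw [sum_integral_sub_replace_sq rL rm rs]
  linarith

end Influence

/-! ### Second moments and influence of the sampling noise. -/

section Sampling

/-- The sampling factors are orthogonal and independent of the coefficients, so cross terms vanish
however dependent the coefficients are among themselves. -/
lemma integral_sq_sum_orthogonal {α β ι : Type*} [MeasurableSpace α] [MeasurableSpace β]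
    [Fintype ι] {P : Measure α} {ν : Measure β} [IsProbabilityMeasure P] [IsProbabilityMeasure ν]
    {a : ι → α → ℝ} {b : ι → β → ℝ} (ha : ∀ i, MemLp (a i) 2 P) (hb : ∀ i, MemLp (b i) 2 ν)
    {v : ℝ} (hv : ∀ i, ∫ z, b i z ^ 2 ∂ν = v) (ho : ∀ i j, i ≠ j → ∫ z, b i z * b j z ∂ν = 0) :
    ∫ q, (∑ i, b i q.2 * a i q.1) ^ 2 ∂(P.prod ν) = v * ∑ i, ∫ x, a i x ^ 2 ∂P := by
  have e : ∀ q : α × β, (∑ i, b i q.2 * a i q.1) ^ 2 =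
      ∑ i, ∑ j, (a i q.1 * a j q.1) * (b i q.2 * b j q.2) := fun q => by
    rw [sq, Finset.sum_mul_sum]
    exact Finset.sum_congr rfl fun i _ => Finset.sum_congr rfl fun j _ => by ring
  have hint : ∀ i j, Integrable (fun q : α × β => (a i q.1 * a j q.1) * (b i q.2 * b j q.2))
      (P.prod ν) := fun i j =>
    ((ha i).integrable_mul (ha j)).mul_prod ((hb i).integrable_mul (hb j))
  simp_rw [e]
  rw [integral_finsetSum _ fun i _ => integrable_finsetSum _ fun j _ => hint i j, Finset.mul_sum]
  refine Finset.sum_congr rfl fun i _ => ?_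
  rw [integral_finsetSum _ fun j _ => hint i j, Finset.sum_eq_single i]
  · rw [integral_prod_mul (fun x => a i x * a i x) (fun z => b i z * b i z), mul_comm, ← hv i]
    simp_rw [sq]
  · intro j _ hij
    rw [integral_prod_mul (fun x => a i x * a j x) (fun z => b i z * b j z), ho i j hij.symm,
      mul_zero]
  · simp

end Sampling

lemma sum_integral_abs_mul_le {Ω ι : Type*} [MeasurableSpace Ω] {P : Measure Ω} [Fintype ι]
    {f g : ι → Ω → ℝ} (hf : ∀ i, MemLp (f i) 2 P) (hg : ∀ i, MemLp (g i) 2 P) {V : ℝ}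
    (h1 : ∑ i, ∫ ω, f i ω ^ 2 ∂P ≤ 1) (hV : ∑ i, ∫ ω, g i ω ^ 2 ∂P ≤ V) :
    ∑ i, ∫ ω, |f i ω * g i ω| ∂P ≤ √V := by
  have hV0 : 0 ≤ V := (Finset.sum_nonneg fun i _ => integral_nonneg fun ω => sq_nonneg _).trans hV
  refine le_of_forall_pos_le_add fun ε hε => ?_
  -- Weighted arithmetic-geometric means with the weight √V would give Cauchy-Schwarz directly; the
  -- ε avoids division by zero when V = 0.
  set t := √V + ε with ht
  have ht0 : 0 < t := by positivity
  have hVt : V / t ≤ √V := by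
    rw [div_le_iff₀ ht0]
    nlinarith [Real.mul_self_sqrt hV0, Real.sqrt_nonneg V]
  have hi : ∀ i, ∫ ω, |f i ω * g i ω| ∂P ≤
      (t * ∫ ω, f i ω ^ 2 ∂P + (∫ ω, g i ω ^ 2 ∂P) / t) / 2 := fun i => by
    have i1 := (hf i).integrable_sq.const_mul t
    have i2 := (hg i).integrable_sq.div_const t
    rw [← integral_const_mul, ← integral_div, ← integral_add i1 i2, ← integral_div]
    refine integral_mono ((hf i).integrable_mul (hg i)).abs ((i1.add i2).div_const 2) fun ω => ?_
    have h2 : 0 ≤ (t * |f i ω| - |g i ω|) ^ 2 / t := by positivity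
    have e : (t * |f i ω| - |g i ω|) ^ 2 / t =
        t * f i ω ^ 2 + g i ω ^ 2 / t - 2 * (|f i ω| * |g i ω|) := by
      rw [← sq_abs (f i ω), ← sq_abs (g i ω)]; field_simp; ring
    simp only [abs_mul]
    linarith
  calc ∑ i, ∫ ω, |f i ω * g i ω| ∂P
      ≤ ∑ i, (t * ∫ ω, f i ω ^ 2 ∂P + (∫ ω, g i ω ^ 2 ∂P) / t) / 2 :=
        Finset.sum_le_sum fun i _ => hi i
    _ = (t * ∑ i, ∫ ω, f i ω ^ 2 ∂P + (∑ i, ∫ ω, g i ω ^ 2 ∂P) / t) / 2 := by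
        rw [← Finset.sum_div, Finset.sum_add_distrib, ← Finset.mul_sum, ← Finset.sum_div]
    _ ≤ (t * 1 + V / t) / 2 := by gcongr
    _ ≤ √V + ε := by linarith

lemma indepFun_of_measurePreserving_prod {Ω α β : Type*} [MeasurableSpace Ω] [MeasurableSpace α]
    [MeasurableSpace β] {P : Measure Ω} [IsProbabilityMeasure P] {ν : Measure α} {ν' : Measure β}
    [IsProbabilityMeasure ν] [IsProbabilityMeasure ν'] {f : Ω → α} {g : Ω → β}
    (h : MeasurePreserving (fun ω => (f ω, g ω)) P (ν.prod ν')) : IndepFun f g P := by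
  have hf : MeasurePreserving f P ν := measurePreserving_fst.comp h
  have hg : MeasurePreserving g P ν' := measurePreserving_snd.comp h
  rw [indepFun_iff_map_prod_eq_prod_map_map hf.measurable.aemeasurable hg.measurable.aemeasurable,
    h.map_eq, hf.map_eq, hg.map_eq]

section Sampling

variable {M : Type*} [MeasurableSpace M] {μ : Measure M} [IsProbabilityMeasure μ] {m n : ℕ}
  {ν : Measure (Idx m n → ℝ)} [IsProbabilityMeasure ν] {p : ℝ}

/-- The observation `k` is independent of the other coordinates and of the sampling variables. -/
lemma indepFun_eval_rest (k : Fin n) :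
    IndepFun (fun q : (Option (Fin n) → M) × (Idx m n → ℝ) => q.1 (some k))
      (fun q => ((fun j : {j : Option (Fin n) // j ≠ some k} => q.1 j), q.2))
      ((Measure.pi fun _ => μ).prod ν) := by
  have hinj : Function.Injective (Sum.elim (fun _ : Unit => some k)
      (Subtype.val : {j : Option (Fin n) // j ≠ some k} → Option (Fin n))) := by
    rintro (⟨⟩ | ⟨a, ha⟩) (⟨⟩ | ⟨b, hb⟩) hab
    · rfl
    · exact absurd hab.symm hb
    · exact absurd hab ha
    · simpa using hab
  have h1 := ((measurePreserving_prodMk_comp μ hinj).prod (MeasurePreserving.id ν))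
  have h2 := (measurePreserving_prodAssoc _ _ _).comp h1
  have h3 : IndepFun (fun (q : (Option (Fin n) → M) × (Idx m n → ℝ)) (_ : Unit) => q.1 (some k))
      (fun q => ((fun j : {j : Option (Fin n) // j ≠ some k} => q.1 j), q.2))
      ((Measure.pi fun _ => μ).prod ν) := indepFun_of_measurePreserving_prod h2
  exact h3.comp (φ := fun u : Unit → M => u ()) (measurable_pi_apply ()) measurable_id

/-- The centred sampling part of the incomplete sum. -/
noncomputable def samplingSum (p : ℝ) (h : (Fin m → M) → ℝ) (y : Fin n → M)
    (w : Idx m n → ℝ) : ℝ :=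
  ∑ I, (w I - p) * h fun j => y (I j)

lemma integral_samplingSum_sq {h : (Fin m → M) → ℝ} (hL : MemLp h 2 (Measure.pi fun _ => μ))
    (hhm : Measurable h) (hb : ∀ I, MemLp (fun w : Idx m n → ℝ => w I - p) 2 ν)
    (hv : ∀ I : Idx m n, ∫ w, (w I - p) ^ 2 ∂ν = p * (1 - p))
    (ho : ∀ I J : Idx m n, I ≠ J → ∫ w, (w I - p) * (w J - p) ∂ν = 0) :
    ∫ q : (Option (Fin n) → M) × (Idx m n → ℝ), samplingSum p h (keep q.1) q.2 ^ 2
        ∂((Measure.pi fun _ => μ).prod ν) =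
      p * (1 - p) * (n.choose m * ∫ x, h x ^ 2 ∂(Measure.pi fun _ => μ)) := by
  have mp : ∀ I : Idx m n, MeasurePreserving (fun (x : Option (Fin n) → M) j => keep x (I j))
      (Measure.pi fun _ => μ) (Measure.pi fun _ => μ) := fun I =>
    (measurePreserving_idx I).comp measurePreserving_keep
  have := integral_sq_sum_orthogonal (P := Measure.pi fun _ : Option (Fin n) => μ)
    (a := fun I x => h fun j => keep x (I j)) (fun I => hL.comp_measurePreserving (mp I)) hb hv ho
  refine this.trans ?_
  rw [Finset.sum_congr rfl fun I _ =>
    integral_comp_measurePreserving (mp I) (hhm.pow_const 2), Finset.sum_const, Finset.card_univ,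
    card_idx, nsmul_eq_mul]

/-- Only index sets containing k are affected, each by at most 4 E h² since (a - b)² ≤ 2a² + 2b².
Every index set has m elements, whence the factor 4m. -/
lemma sum_integral_samplingSum_sub_sq_le {h : (Fin m → M) → ℝ}
    (hL : MemLp h 2 (Measure.pi fun _ => μ))
    (hhm : Measurable h) (hb : ∀ I, MemLp (fun w : Idx m n → ℝ => w I - p) 2 ν)
    (hv : ∀ I : Idx m n, ∫ w, (w I - p) ^ 2 ∂ν = p * (1 - p))
    (ho : ∀ I J : Idx m n, I ≠ J → ∫ w, (w I - p) * (w J - p) ∂ν = 0) (hp : 0 ≤ p * (1 - p)) :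
    ∑ k, ∫ q : (Option (Fin n) → M) × (Idx m n → ℝ),
        (samplingSum p h (keep q.1) q.2 - samplingSum p h (replace k q.1) q.2) ^ 2
        ∂((Measure.pi fun _ => μ).prod ν) ≤
      4 * m * (p * (1 - p) * (n.choose m * ∫ x, h x ^ 2 ∂(Measure.pi fun _ => μ))) := by
  have mp : ∀ I : Idx m n, MeasurePreserving (fun (x : Option (Fin n) → M) j => keep x (I j))
      (Measure.pi fun _ => μ) (Measure.pi fun _ => μ) := fun I =>
    (measurePreserving_idx I).comp measurePreserving_keep
  have mp' : ∀ (k : Fin n) (I : Idx m n), MeasurePreserving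
      (fun (x : Option (Fin n) → M) j => replace k x (I j))
      (Measure.pi fun _ => μ) (Measure.pi fun _ => μ) := fun k I =>
    (measurePreserving_idx I).comp (measurePreserving_replace k)
  set s := ∫ x, h x ^ 2 ∂(Measure.pi fun _ => μ) with hs
  have l1 : ∀ I : Idx m n, MemLp (fun x : Option (Fin n) → M => h fun j => keep x (I j)) 2
      (Measure.pi fun _ => μ) := fun I => hL.comp_measurePreserving (mp I)
  have l2 : ∀ (k : Fin n) (I : Idx m n), MemLp (fun x : Option (Fin n) → M =>
      h fun j => replace k x (I j)) 2 (Measure.pi fun _ => μ) := fun k I =>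
    hL.comp_measurePreserving (mp' k I)
  have hk : ∀ k : Fin n, ∫ q : (Option (Fin n) → M) × (Idx m n → ℝ),
        (samplingSum p h (keep q.1) q.2 - samplingSum p h (replace k q.1) q.2) ^ 2
        ∂((Measure.pi fun _ => μ).prod ν) ≤
      p * (1 - p) * ∑ I : Idx m n, if k ∈ Finset.univ.image I then 4 * s else 0 := by
    intro k
    have := integral_sq_sum_orthogonal (P := Measure.pi fun _ : Option (Fin n) => μ)
      (a := fun I x => (h fun j => keep x (I j)) - h fun j => replace k x (I j))
      (fun I => (l1 I).sub (l2 k I)) hb hv ho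
    have e : ∀ q : (Option (Fin n) → M) × (Idx m n → ℝ),
        samplingSum p h (keep q.1) q.2 - samplingSum p h (replace k q.1) q.2 =
        ∑ I, (q.2 I - p) * ((h fun j => keep q.1 (I j)) - h fun j => replace k q.1 (I j)) :=
      fun q => by simp only [samplingSum, mul_sub, Finset.sum_sub_distrib]
    simp_rw [e]
    rw [this]
    refine mul_le_mul_of_nonneg_left (Finset.sum_le_sum fun I _ => ?_) hp
    split_ifs with hmem
    · have h3 : ∫ x : Option (Fin n) → M,
          ((h fun j => keep x (I j)) - h fun j => replace k x (I j)) ^ 2 ∂(Measure.pi fun _ => μ) ≤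
          ∫ x : Option (Fin n) → M, (2 * (h fun j => keep x (I j)) ^ 2 +
            2 * (h fun j => replace k x (I j)) ^ 2) ∂(Measure.pi fun _ => μ) := by
        refine integral_mono ((l1 I).sub (l2 k I)).integrable_sq
          (((l1 I).integrable_sq.const_mul 2).add ((l2 k I).integrable_sq.const_mul 2)) fun x => ?_
        simp only
        nlinarith [sq_nonneg ((h fun j => keep x (I j)) + h fun j => replace k x (I j))]
      rw [integral_add ((l1 I).integrable_sq.const_mul 2) ((l2 k I).integrable_sq.const_mul 2),
        integral_const_mul, integral_const_mul,
        integral_comp_measurePreserving (mp I) (hhm.pow_const 2),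
        integral_comp_measurePreserving (mp' k I) (hhm.pow_const 2)] at h3
      linarith
    · refine (integral_eq_zero_of_ae (ae_of_all _ fun x => ?_)).le
      have : ∀ j, replace k x (I j) = keep x (I j) := fun j => by
        have : I j ≠ k := fun hh => hmem (Finset.mem_image.2 ⟨j, Finset.mem_univ _, hh⟩)
        rw [replace, keep, Equiv.swap_apply_of_ne_of_ne (by simp) (by simpa using this)]
      simp [this]
  refine (Finset.sum_le_sum fun k _ => hk k).trans_eq ?_
  rw [← Finset.mul_sum, Finset.sum_comm]
  have e : ∀ I : Idx m n, (∑ k : Fin n, if k ∈ Finset.univ.image I then 4 * s else 0) =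
      m * (4 * s) := fun I => by
    rw [← Finset.sum_filter, Finset.sum_const, Finset.filter_univ_mem, card_image_idx, nsmul_eq_mul]
  rw [Finset.sum_congr rfl fun I _ => e I, Finset.sum_const, Finset.card_univ, card_idx,
    nsmul_eq_mul]
  ring

/-- Each index lies in C(n-1, m-1) = C(n, m) m/n of the index sets. -/
lemma sum_idx_sum_eval (hm : 0 < m) (hmn : m ≤ n) (f : Fin n → ℝ) :
    ∑ I : Idx m n, ∑ j, f (I j) = n.choose m * ((m : ℝ) / n) * ∑ i, f i := by
  have e1 : ∀ I : Idx m n, ∑ j, f (I j) = ∑ i, if i ∈ Finset.univ.image I then f i else 0 :=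
    fun I => by
      rw [← Finset.sum_filter, Finset.filter_univ_mem,
        Finset.sum_image fun a _ b _ hab => I.injective hab]
  simp_rw [e1]
  rw [Finset.sum_comm, Finset.mul_sum]
  refine Finset.sum_congr rfl fun i _ => ?_
  rw [sum_idx_eq_sum_powersetCard fun s => if i ∈ s then f i else 0, ← Finset.sum_filter,
    Finset.sum_const, nsmul_eq_mul]
  have e2 : ((Finset.univ : Finset (Fin n)).powersetCard m).filter (fun s => i ∈ s) =
      ((Finset.univ : Finset (Fin n)).powersetCard m).filter (fun s => {i} ⊆ s) := by
    simp
  rw [e2, Finset.card_filter_powersetCard_subset _ _ _ (Finset.subset_univ _) (by rw [Finset.card_singleton]; exact hm)]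
  congr 1
  obtain ⟨a, rfl⟩ : ∃ a, m = a + 1 := ⟨m - 1, by omega⟩
  obtain ⟨b, rfl⟩ : ∃ b, n = b + 1 := ⟨n - 1, by omega⟩
  have h1 : ((b : ℝ) + 1) * b.choose a = (b + 1).choose (a + 1) * (a + 1) := by
    exact_mod_cast Nat.add_one_mul_choose_eq b a
  have h2 : (b : ℝ) + 1 ≠ 0 := by positivity
  simp only [Finset.card_univ, Fintype.card_fin, Finset.card_singleton, Nat.add_sub_cancel]
  push_cast
  field_simp
  linarith

end Sampling

/-! ### Bernoulli variables. -/

section Bernoulli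

variable {Ω : Type*} [MeasurableSpace Ω] {P : Measure Ω} [IsProbabilityMeasure P]

lemma ae_eq_zero_or_one {Y : Ω → ℝ} (hY : Measurable Y) {p : ℝ} (h1 : P.real {ω | Y ω = 1} = p)
    (h0 : P.real {ω | Y ω = 0} = 1 - p) : ∀ᵐ ω ∂P, Y ω = 0 ∨ Y ω = 1 := by
  have m0 : MeasurableSet {ω | Y ω = 0} := hY (measurableSet_singleton 0)
  have m1 : MeasurableSet {ω | Y ω = 1} := hY (measurableSet_singleton 1)
  have hd : Disjoint {ω | Y ω = 0} {ω | Y ω = 1} := by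
    rw [Set.disjoint_left]
    intro ω ha hb
    have ha' : Y ω = 0 := ha
    have hb' : Y ω = 1 := hb
    rw [ha'] at hb'; norm_num at hb'
  have hu : P.real ({ω | Y ω = 0} ∪ {ω | Y ω = 1}) = 1 := by
    rw [measureReal_union hd m1, h0, h1]; ring
  have hu' : P ({ω | Y ω = 0} ∪ {ω | Y ω = 1}) = 1 := by
    rw [measureReal_def] at hu
    exact (ENNReal.toReal_eq_one_iff _).1 hu
  exact (prob_compl_eq_zero_iff (m0.union m1)).2 hu'

lemma integral_comp_bernoulli {Y : Ω → ℝ} (hY : Measurable Y) {p : ℝ}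
    (h1 : P.real {ω | Y ω = 1} = p) (h0 : P.real {ω | Y ω = 0} = 1 - p) (f : ℝ → ℝ) :
    ∫ ω, f (Y ω) ∂P = (1 - p) * f 0 + p * f 1 := by
  have m0 : MeasurableSet {ω | Y ω = 0} := hY (measurableSet_singleton 0)
  have m1 : MeasurableSet {ω | Y ω = 1} := hY (measurableSet_singleton 1)
  have e : (fun ω => f (Y ω)) =ᵐ[P] fun ω => {ω | Y ω = 0}.indicator (fun _ => f 0) ω +
      {ω | Y ω = 1}.indicator (fun _ => f 1) ω := by
    filter_upwards [ae_eq_zero_or_one hY h1 h0] with ω hω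
    rcases hω with h | h <;> simp [h]
  rw [integral_congr_ae e, integral_add ((integrable_const _).indicator m0)
    ((integrable_const _).indicator m1), integral_indicator_const _ m0,
    integral_indicator_const _ m1, h0, h1, smul_eq_mul, smul_eq_mul]

end Bernoulli

/-! ### The linear part, the remainder and the concentration bound. -/

section Core

variable {M : Type*} [MeasurableSpace M] {μ : Measure M} [IsProbabilityMeasure μ] {m n : ℕ}

/-- The normalized Hájek projection. -/
noncomputable def linearPart (g : M → ℝ) (s : ℝ) (y : Fin n → M) : ℝ :=
  ∑ i, g (y i) / (√n * s)

/-- The normalized difference between the incomplete sum and its Hájek projection. -/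
noncomputable def remainder (μ : Measure M) (h : (Fin m → M) → ℝ) (s N : ℝ) (y : Fin n → M)
    (w : Idx m n → ℝ) : ℝ :=
  √n / (m * s * n.choose m) * kernelSum (hajekRem μ h) n y +
    √n / (m * s * N) * samplingSum (N / n.choose m) h y w

-- The incomplete sum is its centred sampling part plus p times the complete sum, and the complete
-- sum splits into its Hájek projection and the degenerate part. The factor 1/N, not 1/N̂, makes the
-- identity exact; the ratio N̂/N enters only through the threshold.
omit [IsProbabilityMeasure μ] in
lemma linearPart_add_remainder (hm : 0 < m) (hmn : m ≤ n) (h : (Fin m → M) → ℝ) {s N : ℝ}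
    (hs : 0 < s) (hN : 0 < N) (y : Fin n → M) (w : Idx m n → ℝ) :
    linearPart (firstProj h μ) s y + remainder μ h s N y w =
      √n / (m * s * N) * ∑ I, w I * h fun j => y (I j) := by
  have hn : 0 < n := by omega
  have hn' : (0 : ℝ) < n := by exact_mod_cast hn
  have hm' : (0 : ℝ) < m := by exact_mod_cast hm
  have hC : (0 : ℝ) < n.choose m := by exact_mod_cast Nat.choose_pos hmn
  have hsq : √(n : ℝ) * √n = n := Real.mul_self_sqrt hn'.le
  have hsn : 0 < √(n : ℝ) := Real.sqrt_pos.2 hn'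
  have e1 : kernelSum (hajekRem μ h) n y = ∑ I : Idx m n, (h fun j => y (I j)) -
      n.choose m * ((m : ℝ) / n) * ∑ i, firstProj h μ (y i) := by
    rw [← sum_idx_sum_eval hm hmn fun i => firstProj h μ (y i), ← Finset.sum_sub_distrib]
    rfl
  have e2 : samplingSum (N / n.choose m) h y w = (∑ I, w I * h fun j => y (I j)) -
      N / n.choose m * ∑ I : Idx m n, h fun j => y (I j) := by
    rw [samplingSum, Finset.mul_sum, ← Finset.sum_sub_distrib]
    exact Finset.sum_congr rfl fun I _ => by ring
  rw [remainder, e1, e2, linearPart, ← Finset.sum_div]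
  generalize (∑ I, w I * h fun j => y (I j)) = a
  generalize (∑ I : Idx m n, h fun j => y (I j)) = b
  generalize ∑ i, firstProj h μ (y i) = c
  field_simp
  rw [Real.sq_sqrt hn'.le]
  ring

variable {ν : Measure (Idx m n → ℝ)} [IsProbabilityMeasure ν]

/-- The standing assumptions on the kernel and on the sampling variables. -/
structure Setting (μ : Measure M) (h : (Fin m → M) → ℝ) (ν : Measure (Idx m n → ℝ)) (N s : ℝ) :
    Prop where
  two_le : 2 ≤ m
  lt_half : (m : ℝ) < n / 2
  pos : 0 < N
  le_choose : N ≤ n.choose m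
  meas : Measurable h
  symm : IsSymmetricKernel h
  memLp : MemLp h 2 (Measure.pi fun _ => μ)
  integral_eq : ∫ x, h x ∂(Measure.pi fun _ => μ) = 0
  memLp_proj : MemLp (firstProj h μ) 3 μ
  s_pos : 0 < s
  s_sq : ∫ x, firstProj h μ x ^ 2 ∂μ = s ^ 2
  memLp_sampling : ∀ I, MemLp (fun w : Idx m n → ℝ => w I - N / n.choose m) 2 ν
  var_sampling : ∀ I : Idx m n, ∫ w, (w I - N / n.choose m) ^ 2 ∂ν =
    N / n.choose m * (1 - N / n.choose m)
  cov_sampling : ∀ I J : Idx m n, I ≠ J →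
    ∫ w, (w I - N / n.choose m) * (w J - N / n.choose m) ∂ν = 0

lemma integral_add_mul_sq_le {Ω : Type*} [MeasurableSpace Ω] {P : Measure Ω} {f g : Ω → ℝ}
    (hf : MemLp f 2 P) (hg : MemLp g 2 P) (a b : ℝ) :
    ∫ ω, (a * f ω + b * g ω) ^ 2 ∂P ≤
      2 * (a ^ 2 * ∫ ω, f ω ^ 2 ∂P) + 2 * (b ^ 2 * ∫ ω, g ω ^ 2 ∂P) := by
  have i1 : Integrable (fun ω => 2 * (a ^ 2 * f ω ^ 2)) P :=
    (hf.integrable_sq.const_mul _).const_mul _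
  have i2 : Integrable (fun ω => 2 * (b ^ 2 * g ω ^ 2)) P :=
    (hg.integrable_sq.const_mul _).const_mul _
  calc ∫ ω, (a * f ω + b * g ω) ^ 2 ∂P
      ≤ ∫ ω, (2 * (a ^ 2 * f ω ^ 2) + 2 * (b ^ 2 * g ω ^ 2)) ∂P := by
        refine integral_mono ((hf.const_mul a).add (hg.const_mul b)).integrable_sq (i1.add i2)
          fun ω => ?_
        simp only
        nlinarith [sq_nonneg (a * f ω - b * g ω)]
    _ = _ := by
        rw [integral_add i1 i2]
        simp_rw [integral_const_mul]

namespace Setting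

variable {h : (Fin m → M) → ℝ} {N s : ℝ}

omit [IsProbabilityMeasure μ] [IsProbabilityMeasure ν] in
lemma m_pos (S : Setting μ h ν N s) : (0 : ℝ) < m := by
  exact_mod_cast (by have := S.two_le; omega : 0 < m)

omit [IsProbabilityMeasure μ] [IsProbabilityMeasure ν] in
lemma n_pos (S : Setting μ h ν N s) : (0 : ℝ) < n := by
  have := S.lt_half
  have := S.m_pos
  linarith

omit [IsProbabilityMeasure μ] [IsProbabilityMeasure ν] in
lemma m_le_n (S : Setting μ h ν N s) : m ≤ n := by
  have : (m : ℝ) ≤ n := by linarith [S.lt_half, S.n_pos]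
  exact_mod_cast this

omit [IsProbabilityMeasure μ] [IsProbabilityMeasure ν] in
lemma choose_pos (S : Setting μ h ν N s) : (0 : ℝ) < n.choose m := by
  exact_mod_cast Nat.choose_pos S.m_le_n

omit [IsProbabilityMeasure ν] in
lemma memLp_proj_two (S : Setting μ h ν N s) : MemLp (firstProj h μ) 2 μ :=
  S.memLp_proj.mono_exponent (by norm_num)

omit [IsProbabilityMeasure μ] [IsProbabilityMeasure ν] in
lemma prob_le_one (S : Setting μ h ν N s) : N / n.choose m ≤ 1 :=
  (div_le_one S.choose_pos).2 S.le_choose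

omit [IsProbabilityMeasure μ] [IsProbabilityMeasure ν] in
lemma prob_nonneg (S : Setting μ h ν N s) : 0 ≤ N / n.choose m :=
  div_nonneg S.pos.le S.choose_pos.le

lemma memLp_remainder (S : Setting μ h ν N s) {f : (Option (Fin n) → M) → Fin n → M}
    (hf : MeasurePreserving f (Measure.pi fun _ => μ) (Measure.pi fun _ => μ)) :
    MemLp (fun q : (Option (Fin n) → M) × (Idx m n → ℝ) => kernelSum (hajekRem μ h) n (f q.1)) 2
      ((Measure.pi fun _ => μ).prod ν) ∧
    MemLp (fun q : (Option (Fin n) → M) × (Idx m n → ℝ) =>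
      samplingSum (N / n.choose m) h (f q.1) q.2) 2 ((Measure.pi fun _ => μ).prod ν) := by
  refine ⟨((memLp_kernelSum (memLp_hajekRem S.memLp S.memLp_proj_two)).comp_measurePreserving
    hf).comp_fst ν, memLp_finsetSum _ fun I _ => ?_⟩
  have h1 := S.memLp_sampling I
  have h2 := S.memLp.comp_measurePreserving ((measurePreserving_idx I).comp hf)
  have hm : AEStronglyMeasurable (fun q : (Option (Fin n) → M) × (Idx m n → ℝ) =>
      (q.2 I - N / n.choose m) * h fun j => f q.1 (I j)) ((Measure.pi fun _ => μ).prod ν) :=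
    (h1.comp_snd _).aestronglyMeasurable.mul (h2.comp_fst ν).aestronglyMeasurable
  rw [memLp_two_iff_integrable_sq hm]
  refine (h2.integrable_sq.mul_prod h1.integrable_sq).congr (ae_of_all _ fun q => ?_)
  simp only [Function.comp]
  ring

/-- A and B are the squares of the second and third error terms. A comes from the degenerate part of
the complete U-statistic, B from the sampling noise. -/
lemma remainder_bounds (S : Setting μ h ν N s) {A B : ℝ}
    (hA : A = (∫ x, h x ^ 2 ∂(Measure.pi fun _ => μ) - m * s ^ 2) / (n * s ^ 2))
    (hB : B = n * (1 - N / n.choose m) * (∫ x, h x ^ 2 ∂(Measure.pi fun _ => μ)) /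
      (N * m * s ^ 2)) :
    0 ≤ A ∧ 0 ≤ B ∧
    ∫ q : (Option (Fin n) → M) × (Idx m n → ℝ), remainder μ h s N (keep q.1) q.2 ^ 2
        ∂((Measure.pi fun _ => μ).prod ν) ≤ 2 * A + 2 * B ∧
    ∑ k, ∫ q : (Option (Fin n) → M) × (Idx m n → ℝ),
        (remainder μ h s N (keep q.1) q.2 - remainder μ h s N (replace k q.1) q.2) ^ 2
        ∂((Measure.pi fun _ => μ).prod ν) ≤ 8 * A + 8 * B := by
  have hm := S.m_pos
  have hn := S.n_pos
  have hC := S.choose_pos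
  have hN := S.pos
  have hs := S.s_pos
  set p := N / n.choose m with hp
  set H := ∫ x, h x ^ 2 ∂(Measure.pi fun _ => μ) with hH
  have hH0 : 0 ≤ H := integral_nonneg fun x => sq_nonneg _
  have hp1 : 0 ≤ 1 - p := sub_nonneg.2 S.prob_le_one
  have hpp : 0 ≤ p * (1 - p) := mul_nonneg S.prob_nonneg hp1
  have hsn : √(n : ℝ) ^ 2 = n := Real.sq_sqrt hn.le
  have hR : ∫ x, hajekRem μ h x ^ 2 ∂(Measure.pi fun _ => μ) = H - m * s ^ 2 := by
    rw [integral_hajekRem_sq (by have := S.two_le; omega) S.memLp S.meas S.symm S.memLp_proj_two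
      S.integral_eq, S.s_sq]
  have hR0 : 0 ≤ H - m * s ^ 2 := hR ▸ integral_nonneg fun x => sq_nonneg _
  have hA0 : 0 ≤ A := by rw [hA]; positivity
  have hB0 : 0 ≤ B := by rw [hB]; positivity
  obtain ⟨b1, b2⟩ := kernelSum_hajekRem_bounds S.two_le S.lt_half S.memLp S.meas S.symm
    S.memLp_proj_two S.integral_eq
  have b3 := integral_samplingSum_sq (ν := ν) S.memLp S.meas S.memLp_sampling S.var_sampling
    S.cov_sampling
  have b4 := sum_integral_samplingSum_sub_sq_le (ν := ν) S.memLp S.meas S.memLp_sampling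
    S.var_sampling S.cov_sampling hpp
  rw [hR] at b1 b2
  set a := √(n : ℝ) / (m * s * n.choose m) with ha
  set b := √(n : ℝ) / (m * s * N) with hb
  have a2 : a ^ 2 * ((n.choose m : ℝ) ^ 2 * ((m : ℝ) / n) ^ 2 * (H - m * s ^ 2)) = A := by
    rw [ha, hA, div_pow, hsn]; field_simp
  have b2' : m * (b ^ 2 * (p * (1 - p) * (n.choose m * H))) = B := by
    rw [hb, hB, div_pow, hsn]
    have : p * n.choose m = N := by rw [hp]; field_simp
    have e : p * (1 - p) * (n.choose m * H) = N * (1 - p) * H := by rw [← this]; ring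
    rw [e]; field_simp
  -- The second moment of the noise is only B/m; it is its influence that is of order B.
  have b5 : b ^ 2 * (p * (1 - p) * (n.choose m * H)) ≤ B := by
    rw [← b2']
    have h1 : (1 : ℝ) ≤ m := by exact_mod_cast (by have := S.two_le; omega : 1 ≤ m)
    have h2 : 0 ≤ b ^ 2 * (p * (1 - p) * (n.choose m * H)) := by positivity
    nlinarith
  obtain ⟨l1, l2⟩ := S.memLp_remainder (measurePreserving_keep (μ := μ))
  have fstI : ∀ f : (Option (Fin n) → M) → ℝ, ∫ q : (Option (Fin n) → M) × (Idx m n → ℝ), f q.1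
      ∂((Measure.pi fun _ => μ).prod ν) = ∫ x, f x ∂(Measure.pi fun _ => μ) := fun f => by
    rw [integral_fun_fst]; simp
  refine ⟨hA0, hB0, ?_, ?_⟩
  · have h1 := integral_add_mul_sq_le l1 l2 a b
    rw [b3, fstI fun x => kernelSum (hajekRem μ h) n (keep x) ^ 2] at h1
    have := mul_le_mul_of_nonneg_left b1 (sq_nonneg a)
    rw [a2] at this
    exact h1.trans (by linarith)
  · have hk : ∀ k, ∫ q : (Option (Fin n) → M) × (Idx m n → ℝ),
        (remainder μ h s N (keep q.1) q.2 - remainder μ h s N (replace k q.1) q.2) ^ 2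
        ∂((Measure.pi fun _ => μ).prod ν) ≤
        2 * (a ^ 2 * ∫ x, (kernelSum (hajekRem μ h) n (keep x) -
          kernelSum (hajekRem μ h) n (replace k x)) ^ 2 ∂(Measure.pi fun _ => μ)) +
        2 * (b ^ 2 * ∫ q : (Option (Fin n) → M) × (Idx m n → ℝ),
          (samplingSum p h (keep q.1) q.2 - samplingSum p h (replace k q.1) q.2) ^ 2
          ∂((Measure.pi fun _ => μ).prod ν)) := by
      intro k
      obtain ⟨l3, l4⟩ := S.memLp_remainder (measurePreserving_replace (μ := μ) k)
      have h1 := integral_add_mul_sq_le (l1.sub l3) (l2.sub l4) a b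
      simp only [Pi.sub_apply] at h1
      rw [fstI fun x => (kernelSum (hajekRem μ h) n (keep x) -
          kernelSum (hajekRem μ h) n (replace k x)) ^ 2] at h1
      refine le_of_eq_of_le (integral_congr_ae (ae_of_all _ fun q => ?_)) h1
      simp only [remainder]
      ring
    refine (Finset.sum_le_sum fun k _ => hk k).trans ?_
    simp_rw [← mul_assoc]
    rw [Finset.sum_add_distrib, ← Finset.mul_sum, ← Finset.mul_sum]
    have c1 := mul_le_mul_of_nonneg_left b2 (sq_nonneg a)
    have c2 := mul_le_mul_of_nonneg_left b4 (sq_nonneg b)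
    have c3 : a ^ 2 * (4 * ((n.choose m : ℝ) ^ 2 * ((m : ℝ) / n) ^ 2 * (H - m * s ^ 2))) = 4 * A := by
      rw [← a2]; ring
    have c4 : b ^ 2 * (4 * m * (p * (1 - p) * (n.choose m * H))) = 4 * B := by
      rw [← b2']; ring
    linarith

omit [IsProbabilityMeasure ν] in
lemma measurable_remainder (S : Setting μ h ν N s) :
    Measurable fun q : (Fin n → M) × (Idx m n → ℝ) => remainder μ h s N q.1 q.2 := by
  refine (((measurable_kernelSum (measurable_hajekRem S.meas)).comp measurable_fst).const_mul
    _).add (Measurable.const_mul (Finset.measurable_sum _ fun I _ => ?_) _)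
  exact Measurable.mul (by fun_prop) (S.meas.comp (by fun_prop))

omit [IsProbabilityMeasure ν] in
lemma measurable_linearPart (S : Setting μ h ν N s) :
    Measurable (linearPart (n := n) (firstProj h μ) s) :=
  Finset.measurable_sum _ fun i _ => ((measurable_firstProj S.meas).comp (by fun_prop)).div_const _

/-- The third absolute moment of the normalized projection. -/
noncomputable def lyapunov (μ : Measure M) (h : (Fin m → M) → ℝ) (n : ℕ) (s : ℝ) : ℝ :=
  (∫ x, |firstProj h μ x| ^ 3 ∂μ) / (√n * s ^ 3)

omit [IsProbabilityMeasure ν] in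
lemma summand_law (S : Setting μ h ν N s) :
    IsProbabilityMeasure (μ.map fun x => firstProj h μ x / (√n * s)) ∧
    MemLp id 3 (μ.map fun x => firstProj h μ x / (√n * s)) ∧
    ∫ u, u ∂(μ.map fun x => firstProj h μ x / (√n * s)) = 0 ∧
    n * ∫ u, u ^ 2 ∂(μ.map fun x => firstProj h μ x / (√n * s)) = 1 ∧
    n * ∫ u, |u| ^ 3 ∂(μ.map fun x => firstProj h μ x / (√n * s)) = lyapunov μ h n s ∧
    0 < lyapunov μ h n s := by
  have hn := S.n_pos
  have hs := S.s_pos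
  have hsn : 0 < √(n : ℝ) := Real.sqrt_pos.2 hn
  have hsq : √(n : ℝ) ^ 2 = n := Real.sq_sqrt hn.le
  have hgm : Measurable (firstProj h μ) := measurable_firstProj S.meas
  have hm : Measurable fun x => firstProj h μ x / (√n * s) := hgm.div_const _
  have mp : MeasurePreserving (fun x => firstProj h μ x / (√n * s)) μ
    (μ.map fun x => firstProj h μ x / (√n * s)) := ⟨hm, rfl⟩
  have e3 : n * ∫ u, |u| ^ 3 ∂(μ.map fun x => firstProj h μ x / (√n * s)) = lyapunov μ h n s := by
    rw [← integral_comp_measurePreserving mp (g := fun u => |u| ^ 3) (by fun_prop)]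
    simp_rw [abs_div, div_pow, abs_of_pos (mul_pos hsn hs)]
    rw [integral_div, lyapunov]
    field_simp
    rw [hsq]
    ring
  refine ⟨Measure.isProbabilityMeasure_map hm.aemeasurable, ?_, ?_, ?_, e3, ?_⟩
  · rw [memLp_map_measure_iff aestronglyMeasurable_id hm.aemeasurable]
    have := S.memLp_proj.const_mul (√n * s)⁻¹
    refine this.congr_norm hm.aestronglyMeasurable (ae_of_all _ fun x => ?_)
    simp only [Function.comp, id]
    rw [div_eq_inv_mul]
  · rw [← integral_comp_measurePreserving mp (g := fun u => u) measurable_id, integral_div,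
      integral_firstProj (by have := S.two_le; omega) S.memLp S.meas, S.integral_eq, zero_div]
  · rw [← integral_comp_measurePreserving mp (g := fun u => u ^ 2) (by fun_prop)]
    simp_rw [div_pow]
    rw [integral_div, S.s_sq, mul_pow, hsq]
    field_simp
  -- Positivity is needed because `concentration` divides by a multiple of this ratio; it would
  -- force g = 0 almost everywhere to have it vanish.
  · refine div_pos ?_ (by positivity)
    have hi : Integrable (fun x => |firstProj h μ x| ^ 3) μ :=
      S.memLp_proj.integrable_norm_pow (by norm_num)
    have h0 : 0 ≤ ∫ x, |firstProj h μ x| ^ 3 ∂μ := integral_nonneg fun x => by positivity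
    refine h0.lt_of_ne fun heq => ?_
    have hz := (integral_eq_zero_iff_of_nonneg (fun x => by positivity) hi).1 heq.symm
    have : ∫ x, firstProj h μ x ^ 2 ∂μ = 0 := by
      refine integral_eq_zero_of_ae ?_
      filter_upwards [hz] with x hx
      have : firstProj h μ x = 0 := by simpa using hx
      simp [this]
    rw [S.s_sq] at this
    have := pow_pos hs 2
    linarith

omit [IsProbabilityMeasure ν] in
lemma berry_esseen_linearPart (S : Setting μ h ν N s) (z : ℝ) :
    |(Measure.pi fun _ : Fin n => μ).real {y | linearPart (firstProj h μ) s y ≤ z} - stdCdf z| ≤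
      47 * lyapunov μ h n s := by
  obtain ⟨hp, h3, h0, h1, hγ, hγ0⟩ := S.summand_law
  have hm : Measurable fun x => firstProj h μ x / (√n * s) :=
    (measurable_firstProj S.meas).div_const _
  refine berry_esseen (P := Measure.pi fun _ : Fin n => μ)
    (ξ := fun i y => firstProj h μ (y i) / (√n * s)) (fun i => hm.comp (measurable_pi_apply i))
    (iIndepFun_pi (X := fun _ x => firstProj h μ x / (√n * s)) fun _ => hm.aemeasurable)
    (fun i => ?_) h3 h0 (by simpa using h1) (by simpa using hγ) hγ0 z
  exact ((⟨hm, rfl⟩ : MeasurePreserving _ μ (μ.map _)).comp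
    (measurePreserving_eval (fun _ : Fin n => μ) i)).map_eq

/-- A summand of the linear part is independent of the other summands, of the sampling variables,
and of the remainder in which the corresponding observation has been replaced. -/
lemma indepFun_summand (S : Setting μ h ν N s) {c : (Idx m n → ℝ) → ℝ} (hc : Measurable c)
    (k : Fin n) :
    IndepFun (fun q : (Option (Fin n) → M) × (Idx m n → ℝ) =>
        firstProj h μ (q.1 (some k)) / (√n * s))
      (fun q => (∑ i, firstProj h μ (q.1 (some i)) / (√n * s) -
        firstProj h μ (q.1 (some k)) / (√n * s), c q.2, remainder μ h s N (replace k q.1) q.2))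
      ((Measure.pi fun _ => μ).prod ν) := by
  have hgm : Measurable fun x => firstProj h μ x / (√n * s) :=
    (measurable_firstProj S.meas).div_const _
  have hne : ∀ i : Fin n, Equiv.swap none (some k) (some i) ≠ some k := fun i hh => by
    have h5 := (Equiv.swap none (some k)).injective
      (hh.trans (Equiv.swap_apply_left none (some k)).symm)
    cases h5
  -- The whole triple is a function of the coordinates other than k and of the samplers: the
  -- replaced data read the spare observation instead. The value at `none` in the first component is
  -- a dummy, since the sum omits k.
  set Φ : ({j : Option (Fin n) // j ≠ some k} → M) × (Idx m n → ℝ) → ℝ × ℝ × ℝ := fun r =>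
    ((∑ i ∈ Finset.univ.erase k, firstProj h μ (if hi : some i ≠ some k then r.1 ⟨some i, hi⟩
        else r.1 ⟨none, by simp⟩) / (√n * s)), c r.2,
      remainder μ h s N (fun i => r.1 ⟨Equiv.swap none (some k) (some i), hne i⟩) r.2) with hΦ
  have m1 : Measurable fun r : ({j : Option (Fin n) // j ≠ some k} → M) × (Idx m n → ℝ) =>
      ((fun i => r.1 ⟨Equiv.swap none (some k) (some i), hne i⟩ : Fin n → M), r.2) := by
    refine Measurable.prodMk (measurable_pi_lambda _ fun i => ?_) measurable_snd
    exact (measurable_pi_apply _).comp measurable_fst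
  have hΦm : Measurable Φ := by
    refine Measurable.prodMk ?_ (Measurable.prodMk (hc.comp measurable_snd)
      (S.measurable_remainder.comp m1))
    refine Finset.measurable_sum _ fun i _ => hgm.comp ?_
    split_ifs
    · exact (measurable_pi_apply _).comp measurable_fst
    · exact (measurable_pi_apply _).comp measurable_fst
  have := (indepFun_eval_rest (μ := μ) (ν := ν) (m := m) k).comp hgm hΦm
  refine (congrArg (fun f => IndepFun (fun q : (Option (Fin n) → M) × (Idx m n → ℝ) =>
    firstProj h μ (q.1 (some k)) / (√n * s)) f ((Measure.pi fun _ => μ).prod ν)) ?_).mp this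
  ext1 q
  refine Prod.ext ?_ rfl
  simp only [Function.comp, hΦ]
  rw [← Finset.add_sum_erase _ _ (Finset.mem_univ k), add_sub_cancel_left]
  refine Finset.sum_congr rfl fun i hi => ?_
  rw [dif_pos (by simpa using (Finset.mem_erase.1 hi).1)]

lemma concentration_remainder (S : Setting μ h ν N s) {A B : ℝ}
    (hA : A = (∫ x, h x ^ 2 ∂(Measure.pi fun _ => μ) - m * s ^ 2) / (n * s ^ 2))
    (hB : B = n * (1 - N / n.choose m) * (∫ x, h x ^ 2 ∂(Measure.pi fun _ => μ)) /
      (N * m * s ^ 2)) {c : (Idx m n → ℝ) → ℝ} (hc : Measurable c) :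
    ((Measure.pi fun _ : Fin n => μ).prod ν).real
        {q | |linearPart (firstProj h μ) s q.1 - c q.2| ≤ |remainder μ h s N q.1 q.2|} ≤
      2 * lyapunov μ h n s + 10 * (√A + √B) := by
  obtain ⟨hp, h3, h0, h1, hγ, hγ0⟩ := S.summand_law
  obtain ⟨hA0, hB0, d1, d2⟩ := S.remainder_bounds (ν := ν) hA hB
  have hgm : Measurable fun x => firstProj h μ x / (√n * s) :=
    (measurable_firstProj S.meas).div_const _
  set Q := (Measure.pi fun _ : Option (Fin n) => μ).prod ν with hQ
  set ξ : Fin n → (Option (Fin n) → M) × (Idx m n → ℝ) → ℝ :=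
    fun k q => firstProj h μ (q.1 (some k)) / (√n * s) with hξ
  have mpe : ∀ k : Fin n, MeasurePreserving
      (fun q : (Option (Fin n) → M) × (Idx m n → ℝ) => q.1 (some k)) Q μ := fun k =>
    (measurePreserving_eval (fun _ : Option (Fin n) => μ) (some k)).comp measurePreserving_fst
  have mps : MeasurePreserving (fun x => firstProj h μ x / (√n * s)) μ
    (μ.map fun x => firstProj h μ x / (√n * s)) := ⟨hgm, rfl⟩
  have mpξ : ∀ k, MeasurePreserving (ξ k) Q (μ.map fun x => firstProj h μ x / (√n * s)) :=
    fun k => mps.comp (mpe k)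
  have hξm : ∀ k, Measurable (ξ k) := fun k => (mpξ k).measurable
  have hξL : ∀ k, MemLp (ξ k) 3 Q := fun k => h3.comp_measurePreserving (mpξ k)
  have hξL2 : ∀ k, MemLp (ξ k) 2 Q := fun k => (hξL k).mono_exponent (by norm_num)
  have hind : iIndepFun ξ Q := by
    have hx : iIndepFun (fun (k : Fin n) (q : (Option (Fin n) → M) × (Idx m n → ℝ)) =>
        q.1 (some k)) Q := by
      rw [iIndepFun_iff_map_fun_eq_pi_map fun k => (mpe k).measurable.aemeasurable]
      have := ((measurePreserving_keep (μ := μ) (n := n)).comp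
        (measurePreserving_fst (ν := ν))).map_eq
      refine this.trans ?_
      congr
      ext k : 1
      exact (mpe k).map_eq.symm
    exact hx.comp (fun _ x => firstProj h μ x / (√n * s)) fun _ => hgm
  have g0 : ∀ k, ∫ q, ξ k q ∂Q = 0 := fun k =>
    (integral_comp_measurePreserving (mpξ k) measurable_id).trans h0
  have g1 : ∑ k, ∫ q, ξ k q ^ 2 ∂Q = 1 := by
    rw [Finset.sum_congr rfl fun k _ =>
      integral_comp_measurePreserving (mpξ k) (g := fun u => u ^ 2) (by fun_prop)]
    simpa using h1
  have g3 : ∑ k, ∫ q, |ξ k q| ^ 3 ∂Q = lyapunov μ h n s := by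
    rw [Finset.sum_congr rfl fun k _ =>
      integral_comp_measurePreserving (mpξ k) (g := fun u => |u| ^ 3) (by fun_prop)]
    simpa using hγ
  have hrm := S.measurable_remainder
  have mD : ∀ f : (Option (Fin n) → M) → Fin n → M, Measurable f →
      Measurable fun q : (Option (Fin n) → M) × (Idx m n → ℝ) =>
        remainder μ h s N (f q.1) q.2 := fun f hf =>
    hrm.comp ((hf.comp measurable_fst).prodMk measurable_snd)
  have lD : ∀ f : (Option (Fin n) → M) → Fin n → M,
      MeasurePreserving f (Measure.pi fun _ => μ) (Measure.pi fun _ => μ) →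
      MemLp (fun q : (Option (Fin n) → M) × (Idx m n → ℝ) =>
        remainder μ h s N (f q.1) q.2) 2 Q := fun f hf =>
    ((S.memLp_remainder hf).1.const_mul _).add ((S.memLp_remainder hf).2.const_mul _)
  have hkeep := measurePreserving_keep (μ := μ) (n := n)
  have hrep := fun k => measurePreserving_replace (μ := μ) (n := n) k
  have conc := concentration hξm hξL hind g0 g1 g3 hγ0 (c := fun q => c q.2)
    (D := fun q => remainder μ h s N (keep q.1) q.2)
    (D' := fun k q => remainder μ h s N (replace k q.1) q.2) (hc.comp measurable_snd)
    (lD _ hkeep) (mD _ hkeep.measurable) (fun k => lD _ (hrep k))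
    (fun k => mD _ (hrep k).measurable) fun k => S.indepFun_summand hc k
  -- The spare observation was needed only to build the replaced remainders; the event itself does
  -- not involve it.
  have mpQ : MeasurePreserving (Prod.map keep id) Q ((Measure.pi fun _ : Fin n => μ).prod ν) :=
    hkeep.prod (MeasurePreserving.id ν)
  have hset : MeasurableSet {q : (Fin n → M) × (Idx m n → ℝ) |
      |linearPart (firstProj h μ) s q.1 - c q.2| ≤ |remainder μ h s N q.1 q.2|} :=
    measurableSet_le ((S.measurable_linearPart.comp measurable_fst).sub
      (hc.comp measurable_snd)).abs hrm.abs
  rw [← mpQ.measureReal_preimage hset.nullMeasurableSet]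
  refine (le_trans (le_of_eq rfl) conc).trans ?_
  -- Cauchy-Schwarz for a single pair, as the case of a one-point index type. With `k3` and `k4` the
  -- constant 10 is 2 · 2 + 2 · 3.
  have k1 : ∫ q, |(∑ k, ξ k q) * remainder μ h s N (keep q.1) q.2| ∂Q ≤ √(2 * A + 2 * B) := by
    have := sum_integral_abs_mul_le (P := Q) (ι := Unit) (f := fun _ q => ∑ k, ξ k q)
      (g := fun _ q => remainder μ h s N (keep q.1) q.2) (V := 2 * A + 2 * B)
      (fun _ => memLp_finsetSum _ fun k _ => hξL2 k) (fun _ => lD _ hkeep)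
      (by simp [integral_sum_sq hξL2 hind g0, g1]) (by simpa using d1)
    simpa using this
  have k2 := sum_integral_abs_mul_le (P := Q) hξL2 (fun k => (lD _ hkeep).sub (lD _ (hrep k)))
    g1.le d2
  have k3 : √(2 * A + 2 * B) ≤ 2 * (√A + √B) := by
    rw [Real.sqrt_le_left (by positivity)]
    nlinarith [Real.sq_sqrt hA0, Real.sq_sqrt hB0, mul_nonneg (Real.sqrt_nonneg A) (Real.sqrt_nonneg B)]
  have k4 : √(8 * A + 8 * B) ≤ 3 * (√A + √B) := by
    rw [Real.sqrt_le_left (by positivity)]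
    nlinarith [Real.sq_sqrt hA0, Real.sq_sqrt hB0, mul_nonneg (Real.sqrt_nonneg A) (Real.sqrt_nonneg B)]
  simp only [Pi.sub_apply] at k2
  linarith

end Setting

end Core

/-! ### The random sample size and the comparison with the normal law. -/

section Normalization

variable {M : Type*} [MeasurableSpace M] {μ : Measure M} [IsProbabilityMeasure μ] {m n : ℕ}
  {ν : Measure (Idx m n → ℝ)} [IsProbabilityMeasure ν] {h : (Fin m → M) → ℝ} {N s : ℝ}

namespace Setting

/-- The variance of N̂/N is (1 - p)/N, at most 1/N. -/
lemma integral_abs_sampleRatio_sub_one (S : Setting μ h ν N s) :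
    Integrable (fun w : Idx m n → ℝ => (∑ I, w I) / N - 1) ν ∧
    ∫ w : Idx m n → ℝ, |(∑ I, w I) / N - 1| ∂ν ≤ 1 / √N := by
  have hN := S.pos
  have hC := S.choose_pos
  have e : ∀ w : Idx m n → ℝ, (∑ I, w I) / N - 1 = ∑ I, (w I - N / n.choose m) * (1 / N) :=
    fun w => by
      rw [← Finset.sum_mul, Finset.sum_sub_distrib, Finset.sum_const, Finset.card_univ, card_idx,
        nsmul_eq_mul]
      field_simp
  have hL : MemLp (fun w : Idx m n → ℝ => (∑ I, w I) / N - 1) 2 ν := by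
    simp_rw [e]
    exact memLp_finsetSum _ fun I _ => (S.memLp_sampling I).mul_const _
  have hV : ∫ w : Idx m n → ℝ, ((∑ I, w I) / N - 1) ^ 2 ∂ν ≤ 1 / N := by
    -- The coefficients are the constants 1/N; μ serves merely as some probability space to carry
    -- them.
    have := integral_sq_sum_orthogonal (P := μ) (ν := ν)
      (a := fun (_ : Idx m n) (_ : M) => 1 / N) (fun _ => memLp_const _) S.memLp_sampling
      S.var_sampling S.cov_sampling
    simp_rw [← e] at this
    rw [integral_fun_snd fun w : Idx m n → ℝ => ((∑ I, w I) / N - 1) ^ 2] at this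
    simp only [probReal_univ, integral_const, smul_eq_mul, one_mul, Finset.sum_const,
      Finset.card_univ, card_idx, nsmul_eq_mul] at this
    rw [this]
    have e2 : N / n.choose m * (1 - N / n.choose m) * (n.choose m * (1 / N) ^ 2) =
        (1 - N / n.choose m) * (1 / N) := by field_simp
    rw [e2]
    have h0 := S.prob_nonneg
    have h1 : 0 < 1 / N := by positivity
    nlinarith
  refine ⟨hL.integrable (by norm_num), ?_⟩
  have := sum_integral_abs_mul_le (P := ν) (ι := Unit) (f := fun _ _ => 1)
    (g := fun _ w => (∑ I, w I) / N - 1) (fun _ => memLp_const 1) (fun _ => hL)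
    (by simp) (by simpa using hV)
  simpa using this

omit [IsProbabilityMeasure μ] [IsProbabilityMeasure ν] in
lemma measurable_incompleteU (S : Setting μ h ν N s) :
    Measurable fun q : (Fin n → M) × (Idx m n → ℝ) => incompleteU h q.1 q.2 := by
  refine Measurable.mul (Measurable.const_div (Finset.measurable_sum _ fun I _ => by fun_prop) _)
    (Finset.measurable_sum _ fun I _ => Measurable.mul (by fun_prop) (S.meas.comp ?_))
  fun_prop

/-- Given the samplers, the threshold is fixed and the data keep their law, so the Berry-Esseen
bound holds for every section. What remains is the mean of |Φ(z r) - Φ(z)|, at most 2 E|r - 1|. -/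
lemma abs_studentized_sub_le (S : Setting μ h ν N s) (z : ℝ) :
    |((Measure.pi fun _ : Fin n => μ).prod ν).real
        {q | linearPart (firstProj h μ) s q.1 ≤ z * ((∑ I, q.2 I) / N)} - stdCdf z| ≤
      47 * lyapunov μ h n s + 2 * (1 / √N) := by
  obtain ⟨hi, hd⟩ := S.integral_abs_sampleRatio_sub_one
  set r : (Idx m n → ℝ) → ℝ := fun w => (∑ I, w I) / N with hr
  have hrm : Measurable r := (Finset.measurable_sum _ fun I _ => by fun_prop).div_const _
  have hF : MeasurableSet {q : (Fin n → M) × (Idx m n → ℝ) |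
      linearPart (firstProj h μ) s q.1 ≤ z * r q.2} :=
    measurableSet_le (S.measurable_linearPart.comp measurable_fst)
      ((hrm.comp measurable_snd).const_mul z)
  set F := {q : (Fin n → M) × (Idx m n → ℝ) | linearPart (firstProj h μ) s q.1 ≤ z * r q.2}
  set f : (Idx m n → ℝ) → ℝ := fun w =>
    (Measure.pi fun _ : Fin n => μ).real {y | linearPart (firstProj h μ) s y ≤ z * r w} with hf
  have hFi : Integrable (F.indicator (1 : (Fin n → M) × (Idx m n → ℝ) → ℝ))
      ((Measure.pi fun _ : Fin n => μ).prod ν) := (integrable_const (1 : ℝ)).indicator hF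
  have hsec : ∀ w, ∫ y, F.indicator (1 : (Fin n → M) × (Idx m n → ℝ) → ℝ) (y, w)
      ∂(Measure.pi fun _ : Fin n => μ) = f w := fun w =>
    integral_indicator_one (μ := Measure.pi fun _ : Fin n => μ)
      (measurableSet_le S.measurable_linearPart (measurable_const (a := z * r w)))
  have hQ : ((Measure.pi fun _ : Fin n => μ).prod ν).real F = ∫ w, f w ∂ν := by
    rw [← integral_indicator_one hF, integral_prod_symm _ hFi]
    simp_rw [hsec]
  have hfi : Integrable f ν := by
    have := hFi.integral_prod_right
    simp_rw [hsec] at this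
    exact this
  have hΦi : Integrable (fun w => stdCdf (z * r w)) ν := by
    refine Integrable.of_bound
      (continuous_stdCdf.measurable.comp (hrm.const_mul z)).aestronglyMeasurable 1
      (ae_of_all _ fun w => ?_)
    rw [Real.norm_eq_abs, abs_of_nonneg (stdCdf_nonneg _)]
    exact stdCdf_le_one _
  have b1 : |∫ w, (f w - stdCdf (z * r w)) ∂ν| ≤ 47 * lyapunov μ h n s := by
    have := norm_integral_le_of_norm_le_const (μ := ν) (f := fun w => f w - stdCdf (z * r w))
      (ae_of_all _ fun w => S.berry_esseen_linearPart (z * r w))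
    simpa using this
  have b2 : |∫ w, (stdCdf (z * r w) - stdCdf z) ∂ν| ≤ 2 * (1 / √N) := by
    have := norm_integral_le_of_norm_le (μ := ν) (f := fun w => stdCdf (z * r w) - stdCdf z)
      (hi.abs.const_mul 2) (ae_of_all _ fun w => abs_stdCdf_mul_sub_le z (r w))
    rw [integral_const_mul] at this
    rw [← Real.norm_eq_abs]
    linarith
  rw [integral_sub hfi hΦi] at b1
  rw [integral_sub hΦi (integrable_const _), integral_const, probReal_univ, one_smul] at b2
  rw [hQ]
  have := abs_sub_le (∫ w, f w ∂ν) (∫ w, stdCdf (z * r w) ∂ν) (stdCdf z)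
  linarith

lemma abs_incompleteU_sub_le (S : Setting μ h ν N s) {A B : ℝ}
    (hA : A = (∫ x, h x ^ 2 ∂(Measure.pi fun _ => μ) - m * s ^ 2) / (n * s ^ 2))
    (hB : B = n * (1 - N / n.choose m) * (∫ x, h x ^ 2 ∂(Measure.pi fun _ => μ)) /
      (N * m * s ^ 2)) (z : ℝ) :
    |((Measure.pi fun _ : Fin n => μ).prod ν).real
        {q | √n * incompleteU h q.1 q.2 / (m * s) ≤ z} - stdCdf z| ≤
      49 * lyapunov μ h n s + 10 * (√A + √B) + 3 * (1 / √N) := by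
  obtain ⟨hi, hd⟩ := S.integral_abs_sampleRatio_sub_one
  have hN := S.pos
  have hm := S.m_pos
  have hs := S.s_pos
  set Q := (Measure.pi fun _ : Fin n => μ).prod ν with hQ
  set E := {q : (Fin n → M) × (Idx m n → ℝ) | √n * incompleteU h q.1 q.2 / (m * s) ≤ z} with hE
  set F := {q : (Fin n → M) × (Idx m n → ℝ) |
    linearPart (firstProj h μ) s q.1 ≤ z * ((∑ I, q.2 I) / N)} with hF
  set G := {q : (Fin n → M) × (Idx m n → ℝ) |
    |linearPart (firstProj h μ) s q.1 - z * ((∑ I, q.2 I) / N)| ≤ |remainder μ h s N q.1 q.2|}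
    with hG
  -- Off R the inequality may be multiplied by N̂/N > 0. R also covers N̂ = 0, where the statistic
  -- is 0 by convention.
  set R := {q : (Fin n → M) × (Idx m n → ℝ) | (∑ I, q.2 I) / N ≤ 0} with hR
  have key : ∀ q, q ∉ R → (q ∈ E ↔ linearPart (firstProj h μ) s q.1 + remainder μ h s N q.1 q.2 ≤
      z * ((∑ I, q.2 I) / N)) := fun q hq => by
    have hr : 0 < (∑ I, q.2 I) / N := not_le.1 hq
    have hr' : 0 < ∑ I, q.2 I := by
      have := mul_pos hr hN
      rwa [div_mul_cancel₀ _ hN.ne'] at this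
    rw [linearPart_add_remainder (by have := S.two_le; omega) S.m_le_n h hs hN, hE, mem_ofPred_eq,
      ← div_le_iff₀ hr]
    have : √n * incompleteU h q.1 q.2 / (m * s) =
        √n / (m * s * N) * (∑ I, q.2 I * h fun j => q.1 (I j)) / ((∑ I, q.2 I) / N) := by
      rw [incompleteU]
      generalize (∑ I, q.2 I * h fun j => q.1 (I j)) = a
      field_simp
    rw [this]
  -- If W + D and W lie on different sides of the threshold, then W is within |D| of it.
  have sub1 : E ⊆ F ∪ (G ∪ R) := fun q hq => by
    by_cases hqR : q ∈ R
    · exact Or.inr (Or.inr hqR)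
    by_cases hqF : q ∈ F
    · exact Or.inl hqF
    refine Or.inr (Or.inl ?_)
    have h1 := (key q hqR).1 hq
    have h2 : z * ((∑ I, q.2 I) / N) < linearPart (firstProj h μ) s q.1 := not_le.1 hqF
    rw [hG, mem_ofPred_eq, abs_of_pos (sub_pos.2 h2)]
    have := neg_le_abs (remainder μ h s N q.1 q.2)
    linarith
  have sub2 : F ⊆ E ∪ (G ∪ R) := fun q hq => by
    by_cases hqR : q ∈ R
    · exact Or.inr (Or.inr hqR)
    by_cases hqE : q ∈ E
    · exact Or.inl hqE
    refine Or.inr (Or.inl ?_)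
    have h1 := not_le.1 fun hh => hqE ((key q hqR).2 hh)
    have h2 : linearPart (firstProj h μ) s q.1 ≤ z * ((∑ I, q.2 I) / N) := hq
    rw [hG, mem_ofPred_eq, abs_of_nonpos (sub_nonpos.2 h2)]
    have := le_abs_self (remainder μ h s N q.1 q.2)
    linarith
  have q1 : Q.real E ≤ Q.real F + (Q.real G + Q.real R) :=
    (measureReal_mono sub1).trans ((measureReal_union_le _ _).trans
      (add_le_add_right (measureReal_union_le _ _) _))
  have q2 : Q.real F ≤ Q.real E + (Q.real G + Q.real R) :=
    (measureReal_mono sub2).trans ((measureReal_union_le _ _).trans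
      (add_le_add_right (measureReal_union_le _ _) _))
  have hsum : Measurable fun w : Idx m n → ℝ => (∑ I, w I) / N :=
    (Finset.measurable_sum _ fun I _ => by fun_prop).div_const _
  have hGb : Q.real G ≤ 2 * lyapunov μ h n s + 10 * (√A + √B) :=
    S.concentration_remainder hA hB (c := fun w => z * ((∑ I, w I) / N)) (hsum.const_mul z)
  have hRb : Q.real R ≤ 1 / √N := by
    have e : Q.real R = ν.real {w : Idx m n → ℝ | (∑ I, w I) / N ≤ 0} :=
      (measurePreserving_snd (μ := Measure.pi fun _ : Fin n => μ) (ν := ν)).measureReal_preimage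
        (s := {w : Idx m n → ℝ | (∑ I, w I) / N ≤ 0})
        (measurableSet_le hsum measurable_const).nullMeasurableSet
    rw [e]
    refine le_trans ?_ hd
    -- On R the ratio N̂/N is at distance at least 1 from 1, so Markov's inequality applies.
    have mk := mul_meas_ge_le_integral_of_nonneg
      (ae_of_all ν fun w : Idx m n → ℝ => abs_nonneg ((∑ I, w I) / N - 1)) hi.abs 1
    rw [one_mul] at mk
    refine (measureReal_mono fun w hw => ?_).trans mk
    have hw' : (∑ I, w I) / N ≤ 0 := hw
    have : 1 ≤ |(∑ I, w I) / N - 1| := by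
      rw [abs_of_nonpos (by linarith)]
      linarith
    exact this
  have hb := abs_le.1 (S.abs_studentized_sub_le z)
  rw [← hQ, ← hF] at hb
  rw [abs_le]
  constructor <;> linarith [hb.1, hb.2]

end Setting

end Normalization

/-! ### From the sampling scheme to the product law. -/

section Sampling

variable {Ω M : Type*} [MeasurableSpace Ω] [MeasurableSpace M] {P : Measure Ω}
  [IsProbabilityMeasure P] {μ : Measure M} {m n : ℕ} {p : ℝ} {X : Fin n → Ω → M}
  {Z : Idx m n → Ω → ℝ}

namespace IsBernoulliSampling

omit [IsProbabilityMeasure P] in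
lemma measurable_sampler (B : IsBernoulliSampling P μ p X Z) : Measurable fun ω i => Z i ω :=
  measurable_pi_lambda _ B.measurable_Z

/-- Only the joint law of data and samplers matters, and independence makes it a product. This moves
the problem to the canonical space on which the estimates above are proved. -/
lemma measurePreserving (B : IsBernoulliSampling P μ p X Z) :
    MeasurePreserving (fun ω => ((fun k => X k ω), fun i => Z i ω)) P
      ((Measure.pi fun _ => μ).prod (P.map fun ω i => Z i ω)) := by
  have hX : Measurable fun ω k => X k ω := measurable_pi_lambda _ B.measurable_X
  refine ⟨hX.prodMk B.measurable_sampler, ?_⟩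
  rw [(indepFun_iff_map_prod_eq_prod_map_map hX.aemeasurable
    B.measurable_sampler.aemeasurable).1 B.indep_X_Z,
    (iIndepFun_iff_map_fun_eq_pi_map fun k => (B.measurable_X k).aemeasurable).1 B.indep_X]
  simp_rw [B.law_X]

lemma memLp_sub (B : IsBernoulliSampling P μ p X Z) (I : Idx m n) :
    MemLp (fun w : Idx m n → ℝ => w I - p) 2 (P.map fun ω i => Z i ω) := by
  rw [memLp_map_measure_iff
    ((measurable_pi_apply I).sub_const p).aestronglyMeasurable B.measurable_sampler.aemeasurable]
  refine MemLp.of_bound (((B.measurable_Z I).sub_const p).aestronglyMeasurable) (1 + |p|) ?_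
  filter_upwards [ae_eq_zero_or_one (B.measurable_Z I) (B.prob_one I) (B.prob_zero I)] with ω hω
  simp only [Function.comp, Real.norm_eq_abs]
  refine (abs_sub _ _).trans (add_le_add_left ?_ _)
  rcases hω with h | h <;> simp [h]

lemma integral_sub_sq (B : IsBernoulliSampling P μ p X Z) (I : Idx m n) :
    ∫ w : Idx m n → ℝ, (w I - p) ^ 2 ∂(P.map fun ω i => Z i ω) = p * (1 - p) := by
  rw [← integral_comp_measurePreserving ⟨B.measurable_sampler, rfl⟩
    (g := fun w : Idx m n → ℝ => (w I - p) ^ 2) (by fun_prop),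
    integral_comp_bernoulli (B.measurable_Z I) (B.prob_one I) (B.prob_zero I)
      fun t => (t - p) ^ 2]
  ring

lemma integral_sub_mul_sub (B : IsBernoulliSampling P μ p X Z) {I J : Idx m n} (hIJ : I ≠ J) :
    ∫ w : Idx m n → ℝ, (w I - p) * (w J - p) ∂(P.map fun ω i => Z i ω) = 0 := by
  rw [← integral_comp_measurePreserving ⟨B.measurable_sampler, rfl⟩
    (g := fun w : Idx m n → ℝ => (w I - p) * (w J - p)) (by fun_prop)]
  have hind := (B.indep_Z.indepFun hIJ).comp (φ := fun t => t - p) (ψ := fun t => t - p)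
    (by fun_prop) (by fun_prop)
  refine (hind.integral_fun_mul_eq_mul_integral
    ((B.measurable_Z I).sub_const p).aestronglyMeasurable
    ((B.measurable_Z J).sub_const p).aestronglyMeasurable).trans ?_
  simp only [Function.comp]
  rw [integral_comp_bernoulli (B.measurable_Z I) (B.prob_one I) (B.prob_zero I) fun t => t - p]
  ring

end IsBernoulliSampling

end Sampling

/-! ### Moments of the projection and of the kernel. -/

section Moments

variable {M : Type*} [MeasurableSpace M] {μ : Measure M} [IsProbabilityMeasure μ] {m : ℕ}
  {h : (Fin m → M) → ℝ}

lemma integrable_abs_firstProj_cube (hhm : Measurable h) (h3 : thirdMomentG h μ ≠ ⊤) :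
    Integrable (fun x => |firstProj h μ x| ^ 3) μ :=
  (lintegral_ofReal_ne_top_iff_integrable
    ((measurable_firstProj hhm).abs.pow_const 3).aestronglyMeasurable
    (ae_of_all _ fun x => by positivity)).1 h3

lemma memLp_firstProj (hhm : Measurable h) (h3 : thirdMomentG h μ ≠ ⊤) :
    MemLp (firstProj h μ) 3 μ := by
  rw [← integrable_norm_rpow_iff (measurable_firstProj hhm).aestronglyMeasurable (by norm_num)
    (by norm_num)]
  refine (integrable_abs_firstProj_cube hhm h3).congr (ae_of_all _ fun x => ?_)
  simp only [Real.norm_eq_abs, ENNReal.toReal_ofNat]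
  exact_mod_cast rfl

lemma thirdMomentG_div (hhm : Measurable h) (h3 : thirdMomentG h μ ≠ ⊤) {n : ℕ} {s : ℝ}
    (hn : 0 < n) (hs : 0 < s) :
    thirdMomentG h μ / ENNReal.ofReal (√n * s ^ 3) = ENNReal.ofReal (Setting.lyapunov μ h n s) := by
  have : (0 : ℝ) < n := by exact_mod_cast hn
  rw [Setting.lyapunov, ENNReal.ofReal_div_of_pos (by positivity),
    ofReal_integral_eq_lintegral_ofReal (integrable_abs_firstProj_cube hhm h3)
      (ae_of_all _ fun x => by positivity)]
  rfl

lemma sigmaG_sq (hm : 0 < m) (hL : MemLp h 2 (Measure.pi fun _ => μ)) (hhm : Measurable h)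
    (h0 : ∫ x, h x ∂(Measure.pi fun _ => μ) = 0) :
    ∫ x, firstProj h μ x ^ 2 ∂μ = sigmaG h μ ^ 2 := by
  rw [sigmaG, Real.sq_sqrt (variance_nonneg _ _), variance_of_integral_eq_zero
    (measurable_firstProj hhm).aemeasurable ((integral_firstProj hm hL hhm).trans h0)]

omit [IsProbabilityMeasure μ] in
lemma sigmaH_sq (hhm : Measurable h) (h0 : ∫ x, h x ∂(Measure.pi fun _ => μ) = 0) :
    ∫ x, h x ^ 2 ∂(Measure.pi fun _ => μ) = sigmaH h μ ^ 2 := by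
  rw [sigmaH, Real.sq_sqrt (variance_nonneg _ _), variance_of_integral_eq_zero hhm.aemeasurable h0]

end Moments

end IncompleteUStat

/-! ### The Berry-Esseen bound for the incomplete U-statistic. -/

theorem theorem2 :
    ∃ C : ℝ, 0 < C ∧
      ∀ {Ω M : Type*} [MeasurableSpace Ω] [MeasurableSpace M]
        (P : Measure Ω) [IsProbabilityMeasure P] (μ : Measure M) [IsProbabilityMeasure μ]
        (m n N : ℕ) (h : (Fin m → M) → ℝ)
        (X : Fin n → Ω → M) (Z : IncompleteUStat.Idx m n → Ω → ℝ),
        2 ≤ m → (m : ℝ) < (n : ℝ) / 2 →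
        0 < N → N < n.choose m →
        Measurable h → IncompleteUStat.IsSymmetricKernel h →
        MemLp h 2 (Measure.pi fun _ : Fin m => μ) →
        ∫ x, h x ∂(Measure.pi fun _ : Fin m => μ) = 0 →
        0 < IncompleteUStat.sigmaH h μ →
        0 < IncompleteUStat.sigmaG h μ →
        IncompleteUStat.IsBernoulliSampling P μ (IncompleteUStat.sampProb m n N) X Z →
        IncompleteUStat.kolmogorovDistNormal P
            (fun ω => √(n : ℝ) *
                IncompleteUStat.incompleteU h (fun k => X k ω) (fun i => Z i ω) /
              ((m : ℝ) * IncompleteUStat.sigmaG h μ)) ≤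
          ENNReal.ofReal C *
            (IncompleteUStat.thirdMomentG h μ /
                ENNReal.ofReal (√(n : ℝ) * IncompleteUStat.sigmaG h μ ^ 3) +
              ENNReal.ofReal √((m : ℝ) / (n : ℝ) *
                (IncompleteUStat.sigmaH h μ ^ 2 /
                  ((m : ℝ) * IncompleteUStat.sigmaG h μ ^ 2) - 1)) +
              ENNReal.ofReal √((n : ℝ) * (1 - IncompleteUStat.sampProb m n N) *
                  IncompleteUStat.sigmaH h μ ^ 2 /
                ((N : ℝ) * (m : ℝ) * IncompleteUStat.sigmaG h μ ^ 2)) +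
              ENNReal.ofReal (1 / √(N : ℝ))) := by
  -- 50 dominates the constants 49, 10 and 3 of `abs_incompleteU_sub_le`.
  refine ⟨50, by norm_num, fun {Ω M} _ _ P _ μ _ m n N h X Z hm hmn hN hNC hhm hs hL h0 _ hG hB => ?_⟩
  -- With an infinite third moment the right-hand side is infinite; otherwise all terms are finite
  -- and the inequality is one between reals.
  by_cases h3 : IncompleteUStat.thirdMomentG h μ = ⊤
  · rw [h3, ENNReal.top_div_of_ne_top ENNReal.ofReal_ne_top, top_add, top_add, top_add,
      ENNReal.mul_top (by simp)]
    exact le_top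
  have hm0 : 0 < m := by omega
  have hm' : (0 : ℝ) < m := by exact_mod_cast hm0
  have hn' : (0 : ℝ) < n := by linarith
  have hn : 0 < n := by exact_mod_cast hn'
  have hN' : (0 : ℝ) < N := by exact_mod_cast hN
  have : IsProbabilityMeasure (P.map fun ω i => Z i ω) :=
    Measure.isProbabilityMeasure_map hB.measurable_sampler.aemeasurable
  have S : IncompleteUStat.Setting μ h (P.map fun ω i => Z i ω) (N : ℝ)
      (IncompleteUStat.sigmaG h μ) :=
    { two_le := hm
      lt_half := hmn
      pos := hN'
      le_choose := by exact_mod_cast hNC.le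
      meas := hhm
      symm := hs
      memLp := hL
      integral_eq := h0
      memLp_proj := IncompleteUStat.memLp_firstProj hhm h3
      s_pos := hG
      s_sq := IncompleteUStat.sigmaG_sq hm0 hL hhm h0
      memLp_sampling := hB.memLp_sub
      var_sampling := hB.integral_sub_sq
      cov_sampling := fun _ _ => hB.integral_sub_mul_sub }
  have hγ : 0 ≤ IncompleteUStat.Setting.lyapunov μ h n (IncompleteUStat.sigmaG h μ) :=
    S.summand_law.2.2.2.2.2.le
  set A := (m : ℝ) / (n : ℝ) * (IncompleteUStat.sigmaH h μ ^ 2 /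
    ((m : ℝ) * IncompleteUStat.sigmaG h μ ^ 2) - 1) with hA
  rw [IncompleteUStat.thirdMomentG_div hhm h3 hn hG,
    ← ENNReal.ofReal_add hγ (Real.sqrt_nonneg _),
    ← ENNReal.ofReal_add (by positivity) (Real.sqrt_nonneg _),
    ← ENNReal.ofReal_add (by positivity) (by positivity), ← ENNReal.ofReal_mul (by norm_num)]
  refine iSup_le fun z => ENNReal.ofReal_le_ofReal ?_
  have hE : MeasurableSet {q : (Fin n → M) × (IncompleteUStat.Idx m n → ℝ) |
      √n * IncompleteUStat.incompleteU h q.1 q.2 / (m * IncompleteUStat.sigmaG h μ) ≤ z} :=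
    measurableSet_le ((S.measurable_incompleteU.const_mul _).div_const _) measurable_const
  have hT := hB.measurePreserving.measureReal_preimage hE.nullMeasurableSet
  have hA' : A = (∫ x, h x ^ 2 ∂(Measure.pi fun _ => μ) - m * IncompleteUStat.sigmaG h μ ^ 2) /
      (n * IncompleteUStat.sigmaG h μ ^ 2) := by
    rw [hA, IncompleteUStat.sigmaH_sq hhm h0]
    field_simp
  have key := S.abs_incompleteU_sub_le hA' rfl z
  rw [← hT, IncompleteUStat.sigmaH_sq hhm h0] at key
  refine key.trans ?_
  have h1 : 0 ≤ 1 / √(N : ℝ) := by positivity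
  have h2 := Real.sqrt_nonneg A
  have h4 := Real.sqrt_nonneg ((n : ℝ) * (1 - IncompleteUStat.sampProb m n N) *
    IncompleteUStat.sigmaH h μ ^ 2 / ((N : ℝ) * (m : ℝ) * IncompleteUStat.sigmaG h μ ^ 2))
  rw [IncompleteUStat.sampProb] at h4 ⊢
  linarith
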